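/- Let $\mathcal O$ be a discrete valuation ring with residue field $k$, fraction field $K$, uniformizer $t$, containing a field $k_0$ such that $\mathcal O$ is essentially of finite type and (formally) smooth over $k_0$ and $k/k_0$ is finite separable. Put $\sigma=\operatorname{Spec}k$, $\eta=\operatorname{Spec}K$. Let $f:X\to\operatorname{Spec}\mathcal O$ be flat and quasi-projective, with $X$ essentially smooth over $k_0$ and $X_\eta$ smooth over $\eta$. A singular point is a point at which $X_\sigma$ is not smooth over $k$; suppose that the residue field of every singular point that is closed in $X_\sigma$ is separable over $k$ (automatic if $k$ is perfect). Write $P\subset X$ for the set of singular points, and for $p\in P$ write $m_p\subset\mathcal O_{X,p}$ for the maximal ideal and $k(p)$ for the residue field. Two closed subschemes $D,E$ of the special fibre of a scheme $Y$ over $\mathcal O$ are said to meet transversely if $D\cap E$ is smooth over $k$ and its codimension in $Y$ at each of its points is the sum of the codimensions of $D$ and $E$. Then the following are equivalent. (A) $X_\sigma$ has only isolated singular points and is reduced (reducedness being required only at points $x$ with $\dim\mathcal O_{X_\sigma,x}\ge1$); and if $\pi:\hat X\to X$ is the blow-up of $X$ at $P$, then the strict transform $\overline{\pi^{-1}(X_\sigma\setminus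 P)}$ (with reduced structure) is smooth over $k$ and meets the component $E_p=\pi^{-1}(p)$ of the exceptional divisor transversely for each $p\in P$. (B) (1) $X_\sigma$ has only isolated singular points; and (2) for each $p\in P$, if $e_p$ is the largest integer with $f^*(t)\in m_p^{e_p}$, the class $\overline{f^*(t)}_p$ of $f^*(t)$ in $m_p^{e_p}/m_p^{e_p+1}$ defines a hypersurface in $\operatorname{Proj}\operatorname{Sym}^*(m_p/m_p^2)\cong\mathbb P^{n}_{k(p)}$, $n+1=\dim_{k(p)}m_p/m_p^2$, that is smooth over $k(p)$. Moreover, if (A) holds, then each $p\in P$ has an open neighbourhood $U$ such that, for the blow-up $\rho:\hat U\to U$ of $U$ at $p$, with exceptional divisor $D_1=\rho^{-1}(p)$ and strict transform $D_2=\overline{\rho^{-1}(U_\sigma\setminus\{p\})}$, one has: the special fibre is the Cartier divisor $\hat U_\sigma=e_pD_1+D_2$; $D_1$ is reduced; $D_1$ and $D_2$ are smooth over $k$ and meet transversely; and there is an isomorphism $D_1\cong\mathbb P^{n}_{k(p)}$ over $k(p)$ under which $D_1\cap D_2$ is the hypersurface $V(\overline{f^*(t)}_p)$. More precisely, for every minimal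 system of generators $s_0,\dots,s_n$ of $m_p$, with $F\in k(p)[T_0,\dots,T_n]$ homogeneous of degree $e_p$ such that $f^*(t)\equiv F(s_0,\dots,s_n)\bmod m_p^{e_p+1}$, the neighbourhood $U$ can be chosen so that the $s_j$ extend to $U$ and the isomorphism can be chosen so that $T_j/T_i$ corresponds to $s_j/s_i$ and $D_1\cap D_2$ to $V(F)$. -/

import Mathlib

open CategoryTheory CategoryTheory.Limits AlgebraicGeometry

universe u

noncomputable section

namespace SingleBlowUp

/-! ### Projective space and projective hypersurfaces -/

section Projective

variable (R : Type u) [CommRing R] (n : ℕ)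

/-- The standard grading of `R[T_0, …, T_n]`. -/
abbrev grading : ℕ → Submodule R (MvPolynomial (Fin (n + 1)) R) :=
  MvPolynomial.homogeneousSubmodule (Fin (n + 1)) R

instance : GradedAlgebra (grading R n) := MvPolynomial.gradedAlgebra

/-- Projective space `ℙⁿ_R = Proj R[T_0, …, T_n]`. -/
def projSpace : Scheme.{u} := Proj (grading R n)

/-- The structure morphism `ℙⁿ_R ⟶ Spec R`. -/
def projSpaceToSpec : projSpace R n ⟶ Spec (.of R) :=
  Proj.toSpecZero (grading R n) ≫
    Spec.map (CommRingCat.ofHom (algebraMap R (grading R n 0)))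

variable {R n}

lemma X_mem_grading (i : Fin (n + 1)) :
    (MvPolynomial.X i : MvPolynomial (Fin (n + 1)) R) ∈ grading R n 1 :=
  MvPolynomial.isHomogeneous_X R i

/-- For `F` homogeneous of degree `e`, the element `F / T_i ^ e` of the degree zero part of
`R[T_0, …, T_n][1 / T_i]`, i.e. the function on the chart `T_i ≠ 0` given by the
dehomogenisation of `F`. -/
def dehomogenise (F : MvPolynomial (Fin (n + 1)) R) (e : ℕ) (hF : F.IsHomogeneous e)
    (i : Fin (n + 1)) :
    HomogeneousLocalization.Away (grading R n) (MvPolynomial.X i) :=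
  HomogeneousLocalization.Away.mk (grading R n) (X_mem_grading i) e F
    (by simpa using hF)

/-- The open subset `T_i ≠ 0` of `ℙⁿ_R`. -/
def chart (R : Type u) [CommRing R] {n : ℕ} (i : Fin (n + 1)) : (projSpace R n).Opens :=
  Proj.basicOpen (grading R n) (MvPolynomial.X i)

/-- The function `T_j / T_i` on the open subset `T_i ≠ 0` of `ℙⁿ_R`. -/
def coordinate (R : Type u) [CommRing R] {n : ℕ} (i j : Fin (n + 1)) :
    Γ(projSpace R n, chart R i) :=
  (Proj.awayToSection (grading R n) (MvPolynomial.X i)).hom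
    (dehomogenise (MvPolynomial.X j) 1 (MvPolynomial.isHomogeneous_X R j) i)

/-- The ideal sheaf of the closed subscheme `V(F)` of `ℙⁿ_R` defined by a homogeneous polynomial
`F` of degree `e`: a section belongs to it iff, on every chart `T_i ≠ 0`, it is a multiple of
`F / T_i ^ e`. -/
def projHypersurface (F : MvPolynomial (Fin (n + 1)) R) (e : ℕ) (hF : F.IsHomogeneous e) :
    (projSpace R n).IdealSheafData :=
  ⨅ i : Fin (n + 1), Scheme.Hom.ker
    (Spec.map (CommRingCat.ofHom (Ideal.Quotient.mk (Ideal.span {dehomogenise F e hF i}))) ≫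
      Proj.awayι (grading R n) (MvPolynomial.X i) (X_mem_grading i) one_pos)

end Projective

/-! ### Blow-ups -/

/-- The ideal sheaf is invertible, i.e. it defines an effective Cartier divisor: locally it is
generated by a nonzerodivisor. -/
def IsInvertible {X : Scheme.{u}} (I : X.IdealSheafData) : Prop :=
  ∀ x : X, ∃ U : X.affineOpens, x ∈ U.1 ∧
    ∃ a ∈ nonZeroDivisors Γ(X, U.1), I.ideal U = Ideal.span {a}

/-- `π : Y ⟶ X` is the blow-up of `X` along the closed subscheme with ideal sheaf `I`:
the inverse image ideal sheaf is invertible, and `π` is terminal with this property. -/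
structure IsBlowUp {X Y : Scheme.{u}} (π : Y ⟶ X) (I : X.IdealSheafData) : Prop where
  invertible : IsInvertible (I.comap π)
  existsUnique_lift : ∀ (T : Scheme.{u}) (g : T ⟶ X), IsInvertible (I.comap g) →
    ∃! h : T ⟶ Y, h ≫ π = g

/-- The ideal sheaf of the reduced closed subscheme supported on the closure of `S`. -/
def reducedIdeal {X : Scheme.{u}} (S : Set X) : X.IdealSheafData :=
  Scheme.IdealSheafData.vanishingIdeal (TopologicalSpace.Closeds.closure S)

/-- The ideal sheaf of the strict (proper) transform under `π` of a closed subset `Z`, with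
respect to the centre `P`: the closure of `π⁻¹(Z \ P)`, with its reduced structure. -/
def strictTransform {X Y : Scheme.{u}} (π : Y ⟶ X) (Z P : Set X) : Y.IdealSheafData :=
  reducedIdeal (π ⁻¹' (Z \ P))

/-- The ideal sheaf of the scheme-theoretic inverse image of a (closed) point `p`; for the blow-up
at a reduced discrete closed set containing `p`, this is the exceptional divisor over `p`. -/
def exceptionalDivisor {X Y : Scheme.{u}} (π : Y ⟶ X) (p : X) : Y.IdealSheafData :=
  (reducedIdeal {p}).comap π

/-! ### Schemes over a discrete valuation ring -/

/-- A scheme over a field `k₀` is smooth in the sense of essentially finite type schemes: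
on affine opens it is given by `k₀`-algebras which are essentially of finite type and formally
smooth. -/
def IsEssSmooth {k₀ : Type u} [Field k₀] {X : Scheme.{u}} (h : X ⟶ Spec (.of k₀)) : Prop :=
  ∀ V : X.affineOpens,
    ((Scheme.ΓSpecIso (.of k₀)).inv ≫ h.appLE ⊤ V.1 le_top).hom.EssFiniteType ∧
    ((Scheme.ΓSpecIso (.of k₀)).inv ≫ h.appLE ⊤ V.1 le_top).hom.FormallySmooth

section DVR

variable {O : Type u} [CommRing O] [IsLocalRing O]

/-- A morphism to `Spec O` is quasi-projective: it factors through an immersion into some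
`ℙᴺ_O`. -/
def IsQuasiProjective {X : Scheme.{u}} (f : X ⟶ Spec (.of O)) : Prop :=
  ∃ (N : ℕ) (i : X ⟶ projSpace O N), IsImmersion i ∧ i ≫ projSpaceToSpec O N = f

variable (O) in
/-- The inclusion `σ ⟶ Spec O` of the closed point. -/
def closedPt : Spec (.of (IsLocalRing.ResidueField O)) ⟶ Spec (.of O) :=
  Spec.map (CommRingCat.ofHom (IsLocalRing.residue O))

variable (O) in
/-- The inclusion `η ⟶ Spec O` of the generic point. -/
def genericPt [IsDomain O] : Spec (.of (FractionRing O)) ⟶ Spec (.of O) :=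
  Spec.map (CommRingCat.ofHom (algebraMap O (FractionRing O)))

variable {X : Scheme.{u}} (f : X ⟶ Spec (.of O))

/-- The special fibre `X_σ`. -/
abbrev specialFibre : Scheme.{u} := pullback f (closedPt O)

/-- The closed immersion `X_σ ⟶ X`. -/
abbrev specialFibreι : specialFibre f ⟶ X := pullback.fst f (closedPt O)

/-- The structure morphism `X_σ ⟶ σ`. -/
abbrev specialFibreToResidue :
    specialFibre f ⟶ Spec (.of (IsLocalRing.ResidueField O)) :=
  pullback.snd f (closedPt O)

/-- The ideal sheaf on `X` of the special fibre `X_σ`. -/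
def specialFibreIdeal : X.IdealSheafData := (specialFibreι f).ker

/-- `y` is a singular point of the special fibre: `X_σ` is not smooth over `σ` near `y`. -/
def IsSingularPoint (y : specialFibre f) : Prop :=
  ¬ ∃ U : (specialFibre f).Opens, y ∈ U ∧ Smooth (U.ι ≫ specialFibreToResidue f)

/-- The set of singular points of the special fibre, as a subset of `X`. -/
def singularSet : Set X := specialFibreι f '' {y | IsSingularPoint f y}

/-- The residue field of `X_σ` at `y` is a separable algebraic extension of `k`. -/
def HasSeparableResidueField (y : specialFibre f) : Prop :=
  letI : Algebra (IsLocalRing.ResidueField O) ((specialFibre f).residueField y) :=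
    (Spec.preimage ((specialFibre f).fromSpecResidueField y ≫
      specialFibreToResidue f)).hom.toAlgebra
  Algebra.IsSeparable (IsLocalRing.ResidueField O) ((specialFibre f).residueField y)

/-- A scheme over `Spec O` is in fact a scheme over the closed point `σ = Spec k`, and is smooth
over `k`. -/
def IsSmoothOverResidue {D : Scheme.{u}} (g : D ⟶ Spec (.of O)) : Prop :=
  ∃ h : D ⟶ Spec (.of (IsLocalRing.ResidueField O)), h ≫ closedPt O = g ∧ Smooth h

/-- Two closed subschemes (with ideal sheaves `I` and `J`, contained in the special fibre) of a
scheme `Y` over `Spec O` meet transversely: the scheme-theoretic intersection is smooth over `k`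
and its codimension at each of its points is the sum of the two codimensions. -/
structure MeetTransversely {Y : Scheme.{u}} (g : Y ⟶ Spec (.of O)) (I J : Y.IdealSheafData) :
    Prop where
  smooth : IsSmoothOverResidue ((I ⊔ J).subschemeι ≫ g)
  codim : ∀ (x : (I ⊔ J).subscheme) (y : I.subscheme) (z : J.subscheme),
    I.subschemeι y = (I ⊔ J).subschemeι x → J.subschemeι z = (I ⊔ J).subschemeι x →
      ringKrullDim ((I ⊔ J).subscheme.presheaf.stalk x) +
          ringKrullDim (Y.presheaf.stalk ((I ⊔ J).subschemeι x)) =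
        ringKrullDim (I.subscheme.presheaf.stalk y) + ringKrullDim (J.subscheme.presheaf.stalk z)

/-- The special fibre has only isolated singularities and is reduced (reducedness is only required
at points where `X_σ` has positive local dimension, so that nonreduced isolated points are allowed),
and the blow-up of `X` at the set `P` of singular points of `X_σ` has the property that the strict
transform of `X_σ` is smooth over `k` and meets each component `E_p` (`p ∈ P`) of the exceptional
divisor transversely. -/
structure ResolvedBySingleBlowUp : Prop where
  isolated : _root_.IsDiscrete (singularSet f)
  reduced : ∀ y : specialFibre f, 1 ≤ ringKrullDim ((specialFibre f).presheaf.stalk y) →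
    IsReduced ((specialFibre f).presheaf.stalk y)
  blowUp : ∃ (Y : Scheme.{u}) (π : Y ⟶ X), IsBlowUp π (reducedIdeal (singularSet f)) ∧
    IsSmoothOverResidue
      ((strictTransform π (Set.range (specialFibreι f)) (singularSet f)).subschemeι ≫ π ≫ f) ∧
    ∀ p ∈ singularSet f, MeetTransversely (π ≫ f) (exceptionalDivisor π p)
      (strictTransform π (Set.range (specialFibreι f)) (singularSet f))

end DVR

/-! ### Leading forms -/

/-- `s_0, …, s_n` is a minimal system of generators of the maximal ideal `m` of the local ring `R`,
`e` is the largest integer with `a ∈ m ^ e`, and the homogeneous polynomial `F` of degree `e`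
over the residue field represents the class of `a` in `m ^ e / m ^ (e + 1)`, i.e.
`a ≡ F(s_0, …, s_n)` modulo `m ^ (e + 1)`. If `R` is regular, then `F` is the leading form of `a`
under the identification `⨁ m ^ i / m ^ (i + 1) = Sym (m / m ^ 2) = κ[T_0, …, T_n]` given by
`s_0, …, s_n`. -/
structure IsLeadingForm {R : Type u} [CommRing R] [IsLocalRing R] (a : R) {n : ℕ}
    (s : Fin (n + 1) → R) (e : ℕ)
    (F : MvPolynomial (Fin (n + 1)) (IsLocalRing.ResidueField R)) : Prop where
  span_eq : Ideal.span (Set.range s) = IsLocalRing.maximalIdeal R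
  finrank_eq : Module.finrank (IsLocalRing.ResidueField R) (IsLocalRing.CotangentSpace R) = n + 1
  order : IsGreatest {i : ℕ | a ∈ IsLocalRing.maximalIdeal R ^ i} e
  homogeneous : F.IsHomogeneous e
  represents : ∃ G : MvPolynomial (Fin (n + 1)) R, G.IsHomogeneous e ∧
    MvPolynomial.map (IsLocalRing.residue R) G = F ∧
    a - MvPolynomial.eval s G ∈ IsLocalRing.maximalIdeal R ^ (e + 1)

section Main

variable {O : Type u} [CommRing O] [IsLocalRing O] {X : Scheme.{u}} (f : X ⟶ Spec (.of O))

/-- The germ at `p` of the function `f^*(t)`. -/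
def pullbackGerm (t : O) (p : X) : X.presheaf.stalk p :=
  (X.presheaf.germ ⊤ p trivial).hom (f.appTop.hom ((Scheme.ΓSpecIso (.of O)).inv.hom t))

/-- The leading form of `f^*(t)` at `p` defines a smooth hypersurface in
`Proj Sym (m_p / m_p ^ 2) ≅ ℙⁿ_{k(p)}`. -/
def HasSmoothLeadingForm (t : O) (p : X) : Prop :=
  ∃ (n e : ℕ) (s : Fin (n + 1) → X.presheaf.stalk p)
    (F : MvPolynomial (Fin (n + 1)) (X.residueField p))
    (hF : IsLeadingForm (pullbackGerm f t p) s e F),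
    Smooth ((projHypersurface F e hF.homogeneous).subschemeι ≫
      projSpaceToSpec (X.residueField p) n)

/-- `ρ : Û ⟶ U` is a blow-up of an open neighbourhood `U` of `p` at `p`; `s_0, …, s_n` are
functions on `U` and `F` is a form of degree `e` over `k(p)`. With `D₁` the exceptional divisor
and `D₂` the strict transform of `U_σ`, the special fibre of `Û` is the Cartier divisor
`e D₁ + D₂`; `D₁` is reduced, `D₁` and `D₂` are smooth over `k` and meet transversely; and there is
an isomorphism `ℙⁿ_{k(p)} ≅ D₁` over `k(p)`, with `T_j / T_i` corresponding to `s_j / s_i`,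
under which `D₁ ∩ D₂` corresponds to the hypersurface `V(F)`. -/
structure BlowUpDescription {p : X} {U : X.Opens} (hp : p ∈ U) {n : ℕ} (s : Fin (n + 1) → Γ(X, U))
    (e : ℕ) (F : MvPolynomial (Fin (n + 1)) (X.residueField p)) (hF : F.IsHomogeneous e)
    {Y : Scheme.{u}} (ρ : Y ⟶ U) (D₁ D₂ : Y.IdealSheafData) : Prop where
  specialFibre_eq : specialFibreIdeal (ρ ≫ U.ι ≫ f) = D₁ ^ e * D₂
  isReduced : IsReduced D₁.subscheme
  smooth₁ : IsSmoothOverResidue (D₁.subschemeι ≫ ρ ≫ U.ι ≫ f)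
  smooth₂ : IsSmoothOverResidue (D₂.subschemeι ≫ ρ ≫ U.ι ≫ f)
  transverse : MeetTransversely (ρ ≫ U.ι ≫ f) D₁ D₂
  exists_iso : ∃ φ : projSpace (X.residueField p) n ≅ D₁.subscheme,
    φ.hom ≫ D₁.subschemeι ≫ ρ ≫ U.ι =
      projSpaceToSpec (X.residueField p) n ≫ X.fromSpecResidueField p ∧
    (∀ i, ∃ (V : Y.Opens) (hV : V ≤ (ρ ≫ U.ι) ⁻¹ᵁ U)
      (hi : chart (X.residueField p) i ≤ (φ.hom ≫ D₁.subschemeι) ⁻¹ᵁ V)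
      (a : Fin (n + 1) → Γ(Y, V)), ∀ j,
        ((ρ ≫ U.ι).appLE U V hV).hom (s j) = a j * ((ρ ≫ U.ι).appLE U V hV).hom (s i) ∧
        ((φ.hom ≫ D₁.subschemeι).appLE V (chart (X.residueField p) i) hi).hom (a j) =
          coordinate (X.residueField p) i j) ∧
    D₂.comap (φ.hom ≫ D₁.subschemeι) = projHypersurface F e hF

end Main

end SingleBlowUp

end

namespace SingleBlowUp

/-! ### Leading forms in formally smooth local algebras -/

section LeadingForms

open IsLocalRing MvPolynomial

/-! Everything rests on one computation. Near a singular point `p`, write `τ = f^*(t)` as `G(s)`, a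
form of degree `e` in generators `s_0, …, s_n` of the ideal of `p`, with functions as coefficients.
On the chart of the blow-up where `s_i` generates the exceptional ideal, `s_j = a_j s_i`, so `τ =
s_i ^ e * G(a)`. If `s` is quasi-regular (the associated graded ring is a polynomial ring over
`k(p)`), setting `s_i = 0` gives the ring `k(p)[T_j / T_i]`, and `G(a)` restricts to the
dehomogenised leading form `F`. As this is nonzero in a domain, `s_i` is regular modulo `G(a)`;
since the fibre is reduced away from `p`, the strict transform is exactly `V(G(a))`. Hence it meets
the exceptional divisor in `V(F)`, scheme-theoretically.

Transversality therefore makes `V(F)` smooth over `k`, which is the same as over `k(p)` because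
`k(p)` is separable of finite type over `k`. Conversely, if `V(F)` is smooth, the strict transform
contains it as a Cartier divisor with smooth complement, and
`smooth_of_smooth_quotient_of_smooth_away` shows that it is smooth. Codimensions add because the
equations are regular, one after the other.

Quasi-regularity is drawn from formal smoothness over `k₀` of both the local ring and its residue
field (`map_residue_eq_zero_of_eval_mem`): such a local ring maps to truncated polynomials in a way
that separates leading forms. It is spread out to an affine neighbourhood in
`exists_isConicalChart`. It also makes the reducedness condition automatic: for `n ≥ 1` the local
ring modulo `τ` has positive depth, so it has no nilpotents supported at `p`; for `n = 0` the fibre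
has dimension zero at `p`.

Blow-ups are characterised by their universal property. `exists_isBlowUp` constructs them by glueing
affine blow-up algebras, and `IsBlowUp.exists_charts` finds these algebras as charts in every
blow-up, so the local computation applies to all of them. Glueing the exceptional charts gives the
isomorphism with projective space (`exists_projSpace_iso`). -/

lemma mul_sub_mul_mem_pow {Q : Type*} [CommRing Q] {J : Ideal Q} {a b c d : Q} {m n : ℕ}
    (ha : a ∈ J ^ m) (hab : a - b ∈ J ^ (m + 1)) (hd : d ∈ J ^ n) (hcd : c - d ∈ J ^ (n + 1)) :
    a * c - b * d ∈ J ^ (m + n + 1) := by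
  have h : a * c - b * d = a * (c - d) + (a - b) * d := by ring
  rw [h]
  refine Ideal.add_mem _ ?_ ?_
  · rw [add_assoc, pow_add]; exact Ideal.mul_mem_mul ha hcd
  · rw [add_right_comm, pow_add]; exact Ideal.mul_mem_mul hab hd

lemma pow_sub_pow_mem_pow {Q : Type*} [CommRing Q] {J : Ideal Q} {a b : Q}
    (ha : a ∈ J) (hb : b ∈ J) (hab : a - b ∈ J ^ 2) (n : ℕ) : a ^ n - b ^ n ∈ J ^ (n + 1) := by
  induction n with
  | zero => simp
  | succ n ih =>
    rw [pow_succ a, pow_succ b]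
    exact mul_sub_mul_mem_pow (m := n) (n := 1) (Ideal.pow_mem_pow ha n) ih
      (by rwa [pow_one]) hab

lemma prod_pow_sub_prod_pow_mem_pow {Q ι : Type*} [CommRing Q] {J : Ideal Q} {x y : ι → Q}
    (hx : ∀ j, x j ∈ J) (hy : ∀ j, y j ∈ J) (hxy : ∀ j, x j - y j ∈ J ^ 2) (α : ι → ℕ)
    (S : Finset ι) :
    ∏ j ∈ S, x j ^ α j - ∏ j ∈ S, y j ^ α j ∈ J ^ (∑ j ∈ S, α j + 1) := by
  classical
  induction S using Finset.induction_on with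
  | empty => simp
  | insert j S hj ih =>
    rw [Finset.prod_insert hj, Finset.prod_insert hj, Finset.sum_insert hj]
    refine mul_sub_mul_mem_pow (Ideal.pow_mem_pow (hx j) _)
      (pow_sub_pow_mem_pow (hx j) (hy j) (hxy j) _) ?_ ih
    have := Ideal.prod_mem_prod (s := S) (I := fun j ↦ J ^ α j) (x := fun j ↦ y j ^ α j)
      fun i _ ↦ Ideal.pow_mem_pow (hy i) _
    rwa [Finset.prod_pow_eq_pow_sum] at this

variable {k R : Type*} [CommRing k] [CommRing R] [IsLocalRing R] [Algebra k R]
  {ι : Type*} [Fintype ι]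

/-- Minimal generators of the maximal ideal are linearly independent modulo its square. -/
lemma mem_maximalIdeal_of_sum_mul_mem {s : ι → R}
    (hs : Ideal.span (Set.range s) = maximalIdeal R)
    (hcard : Module.finrank (ResidueField R) (CotangentSpace R) = Fintype.card ι)
    {r : ι → R} (h : ∑ j, r j * s j ∈ maximalIdeal R ^ 2) (j : ι) : r j ∈ maximalIdeal R := by
  have hmem : ∀ j, s j ∈ maximalIdeal R := fun j ↦ hs ▸ Ideal.subset_span ⟨j, rfl⟩
  let v : ι → CotangentSpace R := fun j ↦ (maximalIdeal R).toCotangent ⟨s j, hmem j⟩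
  have hspan : ⊤ ≤ Submodule.span (ResidueField R) (Set.range v) := by
    rintro x -
    obtain ⟨⟨x, hx⟩, rfl⟩ := Ideal.toCotangent_surjective _ x
    obtain ⟨c, hc⟩ := Ideal.mem_span_range_iff_exists_fun.mp (hs.symm ▸ hx : x ∈ Ideal.span _)
    have : (maximalIdeal R).toCotangent ⟨x, hx⟩ = ∑ j, residue R (c j) • v j := by
      have e : (⟨x, hx⟩ : maximalIdeal R) = ∑ j, c j • ⟨s j, hmem j⟩ := by
        ext; simp [hc]
      rw [e, map_sum]
      refine Finset.sum_congr rfl fun j _ ↦ ?_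
      rw [map_smul]; rfl
    rw [this]
    exact Submodule.sum_mem _ fun j _ ↦ Submodule.smul_mem _ _ (Submodule.subset_span ⟨j, rfl⟩)
  -- A spanning family with as many members as the dimension is a basis; this is where minimality
  -- enters.
  have hli := linearIndependent_of_top_le_span_of_card_eq_finrank hspan hcard.symm
  rw [Fintype.linearIndependent_iff] at hli
  rw [← residue_eq_zero_iff]
  refine hli (fun j ↦ residue R (r j)) ?_ j
  have e : ∑ j, residue R (r j) • v j = (maximalIdeal R).toCotangent (∑ j, r j • ⟨s j, hmem j⟩) := by
    rw [map_sum]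
    refine Finset.sum_congr rfl fun j _ ↦ ?_
    rw [map_smul]; rfl
  rw [e, Ideal.toCotangent_eq_zero]
  simpa using h

variable (k) in
/-- A formally smooth local algebra maps to truncated polynomials over the residue field. -/
lemma exists_truncation [Algebra.FormallySmooth k R] [Algebra.FormallySmooth k (ResidueField R)]
    {s : ι → R} (hs : Ideal.span (Set.range s) = maximalIdeal R)
    (hcard : Module.finrank (ResidueField R) (CotangentSpace R) = Fintype.card ι) (d : ℕ) :
    ∃ ψ : R →+* MvPolynomial ι (ResidueField R) ⧸ idealOfVars ι (ResidueField R) ^ (d + 2),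
      (∀ r, ψ r - Ideal.Quotient.mk _ (C (residue R r)) ∈
        (idealOfVars ι (ResidueField R)).map (Ideal.Quotient.mk _)) ∧
      ∀ j, ψ (s j) - Ideal.Quotient.mk _ (X j) ∈
        (idealOfVars ι (ResidueField R)).map (Ideal.Quotient.mk _) ^ 2 := by
  classical
  set κ := ResidueField R
  set m := maximalIdeal R
  set T := MvPolynomial ι κ
  set I := idealOfVars ι κ with hI
  have hmem : ∀ j, s j ∈ m := fun j ↦ hs ▸ Ideal.subset_span ⟨j, rfl⟩
  have hXI : ∀ j, (X j : T) ∈ I := fun j ↦ Ideal.subset_span ⟨j, rfl⟩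
  -- The kernel of `q` squares to zero, so formal smoothness of the residue field lifts its identity
  -- to a section `σ`: a coefficient field in `R ⧸ m ^ 2`.
  let q : (R ⧸ m ^ 2) →ₐ[k] κ := Ideal.Quotient.liftₐ (m ^ 2) (IsScalarTower.toAlgHom k R κ)
    fun a ha ↦ (residue_eq_zero_iff a).mpr (Ideal.pow_le_self two_ne_zero ha)
  have hq : ∀ r : R, q (Ideal.Quotient.mk _ r) = residue R r := fun r ↦ rfl
  have hqs : Function.Surjective q := fun x ↦ by
    obtain ⟨r, rfl⟩ := residue_surjective x; exact ⟨Ideal.Quotient.mk _ r, hq r⟩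
  have hqk : IsNilpotent (RingHom.ker (q : (R ⧸ m ^ 2) →+* κ)) := by
    refine ⟨2, ?_⟩
    rw [Ideal.zero_eq_bot, eq_bot_iff, pow_two (RingHom.ker _), Ideal.mul_le]
    intro a ha b hb
    obtain ⟨a, rfl⟩ := Ideal.Quotient.mk_surjective a
    obtain ⟨b, rfl⟩ := Ideal.Quotient.mk_surjective b
    rw [Ideal.mem_bot, ← map_mul, Ideal.Quotient.eq_zero_iff_mem, pow_two]
    exact Ideal.mul_mem_mul ((residue_eq_zero_iff a).mp ha) ((residue_eq_zero_iff b).mp hb)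
  let σ : κ →ₐ[k] R ⧸ m ^ 2 :=
    Algebra.FormallySmooth.liftOfSurjective (AlgHom.id k κ) q hqs hqk
  have hσ : ∀ x, q (σ x) = x := fun x ↦
    Algebra.FormallySmooth.liftOfSurjective_apply (AlgHom.id k κ) q hqs hqk x
  -- The coefficient field presents `R ⧸ m ^ 2` as a quotient of the polynomial ring. Minimality of
  -- `s` puts the kernel inside `I ^ 2`, which is what a map back to `T ⧸ I ^ 2` requires.
  let θ : T →+* R ⧸ m ^ 2 := eval₂Hom (σ : κ →+* R ⧸ m ^ 2) fun j ↦ Ideal.Quotient.mk _ (s j)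
  have hθC : ∀ c, θ (C c) = σ c := fun c ↦ eval₂Hom_C _ _ _
  have hθX : ∀ j, θ (X j) = Ideal.Quotient.mk _ (s j) := fun j ↦ eval₂Hom_X' _ _ _
  have hσr : ∀ r : R, ∃ a ∈ m, Ideal.Quotient.mk (m ^ 2) r = σ (residue R r) + Ideal.Quotient.mk _ a := by
    intro r
    obtain ⟨b, hb⟩ := Ideal.Quotient.mk_surjective (σ (residue R r))
    refine ⟨r - b, ?_, ?_⟩
    · rw [← residue_eq_zero_iff, map_sub, ← hq b, hb, hσ, sub_self]
    · rw [map_sub, hb]; ring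
  have hσm : ∀ r : R, ∀ a ∈ m, Ideal.Quotient.mk (m ^ 2) (r * a) =
      σ (residue R r) * Ideal.Quotient.mk _ a := by
    intro r a ha
    obtain ⟨b, hb, h⟩ := hσr r
    have : Ideal.Quotient.mk (m ^ 2) (b * a) = 0 := by
      rw [Ideal.Quotient.eq_zero_iff_mem, pow_two]; exact Ideal.mul_mem_mul hb ha
    rw [map_mul, h, add_mul, ← map_mul _ b, this, add_zero]
  have hθs : Function.Surjective θ := by
    intro x
    obtain ⟨r, rfl⟩ := Ideal.Quotient.mk_surjective x
    obtain ⟨a, ha, h⟩ := hσr r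
    obtain ⟨c, rfl⟩ := Ideal.mem_span_range_iff_exists_fun.mp (hs.symm ▸ ha : a ∈ Ideal.span _)
    refine ⟨C (residue R r) + ∑ j, C (residue R (c j)) * X j, ?_⟩
    rw [h, map_add, map_sum, map_sum]
    congr 1
    · exact hθC _
    · refine Finset.sum_congr rfl fun j _ ↦ ?_
      rw [hσm _ _ (hmem j), map_mul, hθC, hθX]
  have hθk : RingHom.ker θ ≤ I ^ 2 := by
    intro P hP
    rw [RingHom.mem_ker] at hP
    have hc : constantCoeff P = 0 := by
      have : (q : (R ⧸ m ^ 2) →+* κ).comp θ = constantCoeff := by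
        refine MvPolynomial.ringHom_ext (fun c ↦ ?_) fun j ↦ ?_
        · rw [RingHom.comp_apply, hθC, constantCoeff_C]; exact hσ c
        · rw [RingHom.comp_apply, hθX, constantCoeff_X]
          exact (residue_eq_zero_iff _).mpr (hmem j)
      rw [← this, RingHom.comp_apply, hP, map_zero]
    have hPI : P ∈ I := by
      rw [← pow_one I, hI, mem_pow_idealOfVars_iff']
      intro x hx
      have : x = 0 := by rwa [Nat.lt_one_iff, Finsupp.degree_eq_zero_iff] at hx
      rw [this]; exact hc
    obtain ⟨g, hg⟩ := Ideal.mem_span_range_iff_exists_fun.mp hPI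
    choose c hcr using fun j ↦ residue_surjective (constantCoeff (g j))
    have hdiff : P - ∑ j, C (residue R (c j)) * X j ∈ I ^ 2 := by
      rw [← hg, ← Finset.sum_sub_distrib]
      refine Ideal.sum_mem _ fun j _ ↦ ?_
      rw [← sub_mul, pow_two]
      refine Ideal.mul_mem_mul ?_ (hXI j)
      rw [← pow_one I, hI, mem_pow_idealOfVars_iff']
      intro x hx
      have : x = 0 := by rwa [Nat.lt_one_iff, Finsupp.degree_eq_zero_iff] at hx
      rw [this, hcr, coeff_sub, coeff_zero_C, constantCoeff_eq, sub_self]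
    have hθI : ∀ P ∈ I ^ 2, θ P = 0 := by
      intro P hP
      have h1 : I ≤ (m.map (Ideal.Quotient.mk (m ^ 2))).comap θ := by
        rw [hI, idealOfVars, Ideal.span_le]
        rintro _ ⟨j, rfl⟩
        rw [SetLike.mem_coe, Ideal.mem_comap, hθX]
        exact Ideal.mem_map_of_mem _ (hmem j)
      have h2 := (Ideal.pow_right_mono h1 2).trans (Ideal.le_comap_pow θ 2) hP
      rw [Ideal.mem_comap, ← Ideal.map_pow, Ideal.map_quotient_self] at h2
      exact h2
    have h0 := hθI _ hdiff
    rw [map_sub, hP, zero_sub, neg_eq_zero, map_sum] at h0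
    have : ∑ j, c j * s j ∈ m ^ 2 := by
      rw [← Ideal.Quotient.eq_zero_iff_mem, map_sum, ← h0]
      refine Finset.sum_congr rfl fun j _ ↦ ?_
      rw [hσm _ _ (hmem j), map_mul, hθC, hθX]
    have hz : ∑ j, C (residue R (c j)) * X j = (0 : T) := by
      refine Finset.sum_eq_zero fun j _ ↦ ?_
      rw [(residue_eq_zero_iff _).mpr (mem_maximalIdeal_of_sum_mul_mem hs hcard this j)]
      simp
    rwa [hz, sub_zero] at hdiff
  let τ : (R ⧸ m ^ 2) →+* T ⧸ I ^ 2 :=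
    (Ideal.Quotient.factor hθk).comp (RingHom.quotientKerEquivOfSurjective hθs).symm.toRingHom
  have hτ : ∀ P, τ (θ P) = Ideal.Quotient.mk _ P := by
    intro P
    have : (RingHom.quotientKerEquivOfSurjective hθs).symm (θ P) = Ideal.Quotient.mk _ P := by
      rw [RingEquiv.symm_apply_eq]; rfl
    change Ideal.Quotient.factor hθk ((RingHom.quotientKerEquivOfSurjective hθs).symm (θ P)) = _
    rw [this]; rfl
  let τ' : (R ⧸ m ^ 2) →ₐ[k] T ⧸ I ^ 2 :=
    { τ with
      commutes' := fun x ↦ by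
        have : algebraMap k (R ⧸ m ^ 2) x = θ (C (algebraMap k κ x)) := by
          rw [hθC]; exact (σ.commutes x).symm
        change τ _ = _
        rw [this, hτ]; rfl }
  have hle : I ^ (d + 2) ≤ I ^ 2 := Ideal.pow_le_pow_right (by omega)
  let p : (T ⧸ I ^ (d + 2)) →ₐ[k] T ⧸ I ^ 2 :=
    { Ideal.Quotient.factor hle with
      commutes' := fun x ↦ rfl }
  have hpk : RingHom.ker (p : (T ⧸ I ^ (d + 2)) →+* T ⧸ I ^ 2) = (I.map (Ideal.Quotient.mk (I ^ (d + 2)))) ^ 2 := by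
    rw [← Ideal.map_pow]
    change RingHom.ker (Ideal.Quotient.factor hle) = _
    rw [Ideal.Quotient.factor_ker]
  have hps : Function.Surjective p := Ideal.Quotient.factor_surjective hle
  have hpn : IsNilpotent (RingHom.ker (p : (T ⧸ I ^ (d + 2)) →+* T ⧸ I ^ 2)) := by
    refine ⟨d + 2, ?_⟩
    rw [hpk, ← Ideal.map_pow, ← Ideal.map_pow, ← pow_mul, Ideal.zero_eq_bot, eq_bot_iff,
      Ideal.map_le_iff_le_comap]
    intro x hx
    rw [Ideal.mem_comap, Ideal.mem_bot, Ideal.Quotient.eq_zero_iff_mem]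
    exact Ideal.pow_le_pow_right (by omega) hx
  -- Formal smoothness of `R` lifts the first-order map through the nilpotent thickening, which
  -- fixes `ψ` on constants modulo `J` and on the `s j` modulo `J ^ 2`.
  let ψ : R →ₐ[k] T ⧸ I ^ (d + 2) := Algebra.FormallySmooth.liftOfSurjective
    (τ'.comp (Ideal.Quotient.mkₐ k (m ^ 2))) p hps hpn
  have hψ : ∀ r, p (ψ r) = τ (Ideal.Quotient.mk _ r) := fun r ↦
    Algebra.FormallySmooth.liftOfSurjective_apply (τ'.comp (Ideal.Quotient.mkₐ k (m ^ 2))) p hps hpn r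
  have hpm : ∀ P, p (Ideal.Quotient.mk _ P) = Ideal.Quotient.mk _ P := fun P ↦ rfl
  have key : ∀ r P, Ideal.Quotient.mk (m ^ 2) r = θ P →
      ψ r - Ideal.Quotient.mk _ P ∈ (I.map (Ideal.Quotient.mk (I ^ (d + 2)))) ^ 2 := by
    intro r P h
    rw [← hpk, RingHom.mem_ker, map_sub]
    change p (ψ r) - p _ = 0
    rw [hψ, hpm, h, hτ, sub_self]
  refine ⟨ψ, fun r ↦ ?_, fun j ↦ key _ _ (hθX j).symm⟩
  obtain ⟨a, ha, h⟩ := hσr r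
  obtain ⟨c, rfl⟩ := Ideal.mem_span_range_iff_exists_fun.mp (hs.symm ▸ ha : a ∈ Ideal.span _)
  have h1 := key r (C (residue R r) + ∑ j, C (residue R (c j)) * X j) (by
    rw [h, map_add, map_sum, map_sum]
    congr 1
    · exact (hθC _).symm
    · refine Finset.sum_congr rfl fun j _ ↦ ?_
      rw [hσm _ _ (hmem j), map_mul, hθC, hθX])
  have h2 := Ideal.pow_le_self two_ne_zero h1
  have h3 : Ideal.Quotient.mk (I ^ (d + 2)) (∑ j, C (residue R (c j)) * X j) ∈
      I.map (Ideal.Quotient.mk (I ^ (d + 2))) :=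
    Ideal.mem_map_of_mem _ (Ideal.sum_mem _ fun j _ ↦ Ideal.mul_mem_left _ _ (hXI j))
  have := Ideal.add_mem _ h2 h3
  convert! this using 1
  rw [map_add]
  change ψ r - _ = ψ r - _ + _
  ring

variable (k) in
/-- Minimal generators of the maximal ideal of a formally smooth local algebra are quasi-regular. -/
theorem map_residue_eq_zero_of_eval_mem [Algebra.FormallySmooth k R]
    [Algebra.FormallySmooth k (ResidueField R)]
    {s : ι → R} (hs : Ideal.span (Set.range s) = maximalIdeal R)
    (hcard : Module.finrank (ResidueField R) (CotangentSpace R) = Fintype.card ι) {d : ℕ}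
    {G : MvPolynomial ι R} (hG : G.IsHomogeneous d) (h : eval s G ∈ maximalIdeal R ^ (d + 1)) :
    map (residue R) G = 0 := by
  classical
  let I := idealOfVars ι (ResidueField R)
  let J := I.map (Ideal.Quotient.mk (I ^ (d + 2)))
  obtain ⟨ψ, hψ, hψs⟩ : ∃ ψ : R →+* MvPolynomial ι (ResidueField R) ⧸ I ^ (d + 2),
      (∀ r, ψ r - Ideal.Quotient.mk _ (C (residue R r)) ∈ J) ∧
      ∀ j, ψ (s j) - Ideal.Quotient.mk _ (X j) ∈ J ^ 2 := exists_truncation k hs hcard d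
  have hX : ∀ j, Ideal.Quotient.mk (I ^ (d + 2)) (X j) ∈ J := fun j ↦
    Ideal.mem_map_of_mem _ (Ideal.subset_span ⟨j, rfl⟩)
  have hψJ : ∀ j, ψ (s j) ∈ J := fun j ↦ by
    have := Ideal.add_mem _ (Ideal.pow_le_self two_ne_zero (hψs j)) (hX j)
    rwa [sub_add_cancel] at this
  have h1 : maximalIdeal R ≤ J.comap ψ := by
    rw [← hs, Ideal.span_le]
    rintro _ ⟨j, rfl⟩
    exact hψJ j
  -- The image of `G(s)` lies in `J ^ (d + 1)` and agrees modulo `J ^ (d + 1)` with the reduction of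
  -- `G`. Truncation at `d + 2` is fine enough to lift this to `I ^ (d + 1)`, where a form of degree
  -- `d` must vanish.
  have h2 : ψ (eval s G) ∈ J ^ (d + 1) :=
    ((Ideal.pow_right_mono h1 _).trans (Ideal.le_comap_pow ψ _)) h
  have h3 : ψ (eval s G) - Ideal.Quotient.mk _ (map (residue R) G) ∈ J ^ (d + 1) := by
    rw [eval_eq', map_sum]
    have : map (residue R) G = ∑ α ∈ G.support,
        C (residue R (coeff α G)) * ∏ j, X j ^ α j := by
      conv_lhs => rw [G.as_sum]
      rw [map_sum]
      refine Finset.sum_congr rfl fun α _ ↦ ?_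
      rw [map_monomial, monomial_eq, Finsupp.prod_fintype _ _ (by simp)]
    rw [this, map_sum, ← Finset.sum_sub_distrib]
    refine Ideal.sum_mem _ fun α hα ↦ ?_
    have hd : ∑ j, α j = d := by
      rw [← hG (mem_support_iff.mp hα), Finsupp.weight_apply, Finsupp.sum_fintype _ _ (by simp)]
      simp
    have hp := prod_pow_sub_prod_pow_mem_pow hψJ hX hψs α Finset.univ
    have hp' : ∏ j, Ideal.Quotient.mk (I ^ (d + 2)) (X j) ^ α j ∈ J ^ d := by
      have := Ideal.prod_mem_prod (s := Finset.univ) (I := fun j ↦ J ^ α j)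
        (x := fun j ↦ Ideal.Quotient.mk (I ^ (d + 2)) (X j) ^ α j)
        fun i _ ↦ Ideal.pow_mem_pow (hX i) _
      rwa [Finset.prod_pow_eq_pow_sum, hd] at this
    rw [hd] at hp
    have hc := hψ (coeff α G)
    have := mul_sub_mul_mem_pow (J := J) (m := 0) (n := d) (a := ψ (coeff α G)) (by simp)
      (by simpa using hc) hp' hp
    rw [zero_add] at this
    simpa only [map_mul, map_prod, map_pow] using this
  have h4 : Ideal.Quotient.mk (I ^ (d + 2)) (map (residue R) G) ∈ J ^ (d + 1) := by
    have := Ideal.sub_mem _ h2 h3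
    rwa [sub_sub_cancel] at this
  rw [← Ideal.map_pow] at h4
  obtain ⟨P, hP, hPG⟩ := (Ideal.mem_map_iff_of_surjective _ Ideal.Quotient.mk_surjective).mp h4
  have h5 : map (residue R) G ∈ I ^ (d + 1) := by
    have : map (residue R) G - P ∈ I ^ (d + 2) := by
      rw [← Ideal.Quotient.eq_zero_iff_mem, map_sub, hPG, sub_self]
    have := Ideal.add_mem _ (Ideal.pow_le_pow_right (by omega) this) hP
    rwa [sub_add_cancel] at this
  rw [show I = idealOfVars ι (ResidueField R) from rfl, mem_pow_idealOfVars_iff'] at h5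
  ext α
  rw [coeff_zero]
  by_contra hne
  have hd := (hG.map (residue R)) hne
  refine hne (h5 α ?_)
  have : Finsupp.degree α = d := by rw [Finsupp.degree_eq_weight_one]; exact hd
  omega

/-- `s` generates the maximal ideal of the local ring `R`, and a form that has no
unit coefficient is the only one whose value at `s` has larger order than expected. -/
structure IsQuasiRegularSystem (s : ι → R) : Prop where
  span_eq : Ideal.span (Set.range s) = maximalIdeal R
  map_eq_zero : ∀ (d : ℕ) (G : MvPolynomial ι R), G.IsHomogeneous d →
    eval s G ∈ maximalIdeal R ^ (d + 1) → map (residue R) G = 0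

variable (k) in
lemma IsQuasiRegularSystem.of_formallySmooth [Algebra.FormallySmooth k R]
    [Algebra.FormallySmooth k (ResidueField R)]
    {s : ι → R} (hs : Ideal.span (Set.range s) = maximalIdeal R)
    (hcard : Module.finrank (ResidueField R) (CotangentSpace R) = Fintype.card ι) :
    IsQuasiRegularSystem s :=
  ⟨hs, fun _ _ hG h ↦ map_residue_eq_zero_of_eval_mem k hs hcard hG h⟩

lemma eval_mem_pow_of_map_residue_eq_zero {s : ι → R}
    (hs : Ideal.span (Set.range s) = maximalIdeal R) {d : ℕ}
    {G : MvPolynomial ι R} (hG : G.IsHomogeneous d) (h : map (residue R) G = 0) :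
    eval s G ∈ maximalIdeal R ^ (d + 1) := by
  rw [eval_eq']
  refine Ideal.sum_mem _ fun α hα ↦ ?_
  have hd : ∑ j, α j = d := by
    rw [← hG (mem_support_iff.mp hα), Finsupp.weight_apply, Finsupp.sum_fintype _ _ (by simp)]
    simp
  rw [pow_succ']
  refine Ideal.mul_mem_mul ?_ ?_
  · rw [← residue_eq_zero_iff, ← coeff_map, h, coeff_zero]
  · have := Ideal.prod_mem_prod (s := Finset.univ) (I := fun j ↦ maximalIdeal R ^ α j)
        (x := fun j ↦ s j ^ α j)
        fun i _ ↦ Ideal.pow_mem_pow (hs ▸ Ideal.subset_span ⟨i, rfl⟩) _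
    rwa [Finset.prod_pow_eq_pow_sum, hd] at this

/-- A nonzero element of a Noetherian local ring has a leading form. -/
lemma exists_leadingForm [IsNoetherianRing R] {s : ι → R}
    (hs : Ideal.span (Set.range s) = maximalIdeal R) {a : R} (ha : a ≠ 0) :
    ∃ (d : ℕ) (G : MvPolynomial ι R), G.IsHomogeneous d ∧ eval s G = a ∧ map (residue R) G ≠ 0 ∧
      IsGreatest {i : ℕ | a ∈ maximalIdeal R ^ i} d := by
  classical
  have hinf := Ideal.iInf_pow_eq_bot_of_isLocalRing (maximalIdeal R) (Ideal.IsPrime.ne_top')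
  have hex : ∃ i, a ∉ maximalIdeal R ^ i := by
    by_contra! h
    exact ha (by rw [← Ideal.mem_bot, ← hinf, Ideal.mem_iInf]; exact h)
  have h0 : Nat.find hex ≠ 0 := fun h ↦ Nat.find_spec hex (by simp [h])
  obtain ⟨d, hd⟩ := Nat.exists_eq_succ_of_ne_zero h0
  have hspec := Nat.find_spec hex
  rw [hd] at hspec
  have hmem : a ∈ maximalIdeal R ^ d := by
    by_contra h
    exact Nat.find_min hex (by omega) h
  obtain ⟨G, hG, hGa⟩ := (Ideal.mem_span_pow_iff_exists_isHomogeneous s a).mp (hs.symm ▸ hmem)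
  refine ⟨d, G, hG, hGa, fun h ↦ hspec ?_, hmem, fun i hi ↦ ?_⟩
  · rw [← hGa]; exact eval_mem_pow_of_map_residue_eq_zero hs hG h
  · by_contra! hlt
    exact hspec (Ideal.pow_le_pow_right hlt hi)

namespace IsQuasiRegularSystem

variable {s : ι → R}

/-- The leading forms of two nonzero elements have a nonzero product over the residue field, so
quasi-regularity keeps the product of the elements from vanishing. -/
lemma isDomain [IsNoetherianRing R] (hs : IsQuasiRegularSystem s) : IsDomain R := by
  have : NoZeroDivisors R := by
    refine ⟨fun {a b} hab ↦ ?_⟩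
    by_contra! h
    obtain ⟨d, G, hG, hGa, hG0, -⟩ := exists_leadingForm hs.span_eq h.1
    obtain ⟨d', G', hG', hGa', hG0', -⟩ := exists_leadingForm hs.span_eq h.2
    have := hs.map_eq_zero _ (G * G') (hG.mul hG') (by simp [hGa, hGa', hab])
    rw [map_mul, mul_eq_zero] at this
    exact this.elim hG0 hG0'
  exact NoZeroDivisors.to_isDomain R

/-- Two distinct members of a quasi-regular system form a regular sequence. -/
lemma dvd_of_mul_eq_mul [IsNoetherianRing R] (hs : IsQuasiRegularSystem s) {i j : ι} (hij : i ≠ j)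
    {a b : R} (h : s i * a = s j * b) : s j ∣ a := by
  have := hs.isDomain
  have hsj : s j ∈ maximalIdeal R := hs.span_eq ▸ Ideal.subset_span ⟨j, rfl⟩
  -- Successive approximation of `a` by multiples of `s j`, to every order; Krull's intersection
  -- theorem in the quotient by `s j` then gives divisibility.
  have key : ∀ r : ℕ, ∃ c, a - s j * c ∈ maximalIdeal R ^ r := by
    intro r
    induction r with
    | zero => exact ⟨0, by simp⟩
    | succ r ih =>
      obtain ⟨c, hc⟩ := ih
      have h' : s i * (a - s j * c) = s j * (b - s i * c) := by linear_combination h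
      obtain ⟨G, hG, hGa⟩ := (Ideal.mem_span_pow_iff_exists_isHomogeneous s _).mp
        (hs.span_eq.symm ▸ hc)
      by_cases hG0 : map (residue R) G = 0
      · exact ⟨c, hGa ▸ eval_mem_pow_of_map_residue_eq_zero hs.span_eq hG hG0⟩
      have hXG : (X i * G : MvPolynomial ι R).IsHomogeneous (1 + r) := (isHomogeneous_X R i).mul hG
      obtain ⟨H, hH, hHb, hXH⟩ : ∃ H : MvPolynomial ι R, H.IsHomogeneous r ∧
          eval s H = b - s i * c ∧ map (residue R) (X i * G) = map (residue R) (X j * H) := by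
        by_cases hb : b - s i * c ∈ maximalIdeal R ^ r
        · obtain ⟨H, hH, hHb⟩ := (Ideal.mem_span_pow_iff_exists_isHomogeneous s _).mp
            (hs.span_eq.symm ▸ hb)
          refine ⟨H, hH, hHb, ?_⟩
          have := hs.map_eq_zero (1 + r) (X i * G - X j * H)
            (hXG.sub ((isHomogeneous_X R j).mul hH)) (by simp [hGa, hHb, h'])
          rwa [map_sub, sub_eq_zero] at this
        -- If `b - s i * c` had order `d < r`, then `s j` times it would have a nonzero leading form
        -- of degree `d + 1`; but that product equals `s i * (a - s j * c)`, which lies in `m ^ (r +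
        -- 1)`.
        · exfalso
          have hb0 : b - s i * c ≠ 0 := fun h0 ↦ hb (h0 ▸ Ideal.zero_mem _)
          obtain ⟨d, H, hH, hHb, hH0, hd⟩ := exists_leadingForm hs.span_eq hb0
          have hdr : d < r := by
            by_contra! hle
            exact hb (Ideal.pow_le_pow_right hle hd.1)
          have := hs.map_eq_zero (1 + d) (X j * H) ((isHomogeneous_X R j).mul hH) (by
            rw [map_mul, eval_X, hHb, ← h']
            have := Ideal.mul_mem_mul (hs.span_eq ▸ Ideal.subset_span ⟨i, rfl⟩ :
              s i ∈ maximalIdeal R) hc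
            rw [← pow_succ'] at this
            exact Ideal.pow_le_pow_right (by omega) this)
          rw [map_mul, map_X, mul_eq_zero] at this
          exact this.elim (X_ne_zero j) hH0
      -- From `X i * G = X j * H` over the residue field with `i ≠ j`, the monomials of `G` free of
      -- `X j` have vanishing coefficients there. Dividing `G` by `X j` thus corrects `c` to the
      -- next order.
      have hmod : map (residue R) (G.modMonomial (Finsupp.single j 1)) = 0 := by
        ext α
        rw [coeff_map, coeff_zero]
        by_cases hα : Finsupp.single j 1 ≤ α
        · rw [coeff_modMonomial_of_le _ hα, map_zero]
        rw [coeff_modMonomial_of_not_le _ hα]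
        have hαj : α j = 0 := by
          by_contra hne
          exact hα (Finsupp.single_le_iff.mpr (Nat.one_le_iff_ne_zero.mpr hne))
        classical
        have := congrArg (coeff (Finsupp.single i 1 + α)) hXH
        rw [map_mul, map_X, coeff_X_mul, coeff_map, map_mul, map_X, mul_comm,
          coeff_mul_X', if_neg] at this
        · exact this
        · simp [hαj, hij]
      have hmh : (G.modMonomial (Finsupp.single j 1)).IsHomogeneous r := by
        intro α hα
        by_cases hle : Finsupp.single j 1 ≤ α
        · exact absurd (coeff_modMonomial_of_le _ hle) hα
        · rw [coeff_modMonomial_of_not_le _ hle] at hα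
          exact hG hα
      refine ⟨c + eval s (G.divMonomial (Finsupp.single j 1)), ?_⟩
      have := eval_mem_pow_of_map_residue_eq_zero hs.span_eq hmh hmod
      convert! this using 1
      have e := congrArg (eval s) (divMonomial_add_modMonomial_single G j)
      rw [map_add, map_mul, eval_X, hGa] at e
      linear_combination -e
  have hmem : a ∈ Ideal.span {s j} := by
    have h1 : Ideal.Quotient.mk (Ideal.span {s j}) a ∈
        (⨅ r : ℕ, maximalIdeal R ^ r • ⊤ : Submodule R (R ⧸ Ideal.span {s j})) := by
      rw [Submodule.mem_iInf]
      intro r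
      obtain ⟨c, hc⟩ := key r
      have : Ideal.Quotient.mk (Ideal.span {s j}) a = (a - s j * c) • 1 := by
        rw [Algebra.smul_def, mul_one, Ideal.Quotient.algebraMap_eq, Ideal.Quotient.mk_eq_mk_iff_sub_mem,
          sub_sub_cancel]
        exact Ideal.mul_mem_right _ _ (Ideal.mem_span_singleton_self _)
      rw [this]
      exact Submodule.smul_mem_smul hc trivial
    rw [Ideal.iInf_pow_smul_eq_bot_of_isLocalRing _ Ideal.IsPrime.ne_top', Submodule.mem_bot] at h1
    exact Ideal.Quotient.eq_zero_iff_mem.mp h1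
  exact Ideal.mem_span_singleton.mp hmem

/-- The quotient of `R` by a nonzerodivisor has positive depth. -/
lemma mem_span_of_forall_pow_mul_mem [IsNoetherianRing R] (hs : IsQuasiRegularSystem s)
    (hι : 1 < Fintype.card ι) {t b : R} (ht : t ≠ 0)
    (hb : ∀ i, ∃ N, s i ^ N * b ∈ Ideal.span {t}) : b ∈ Ideal.span {t} := by
  classical
  have := hs.isDomain
  have hs0 : ∀ i, s i ≠ 0 := fun i h ↦ by
    have := hs.map_eq_zero 1 (X i) (isHomogeneous_X R i) (by simp [h])
    exact X_ne_zero (R := ResidueField R) i (by simp at this)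
  obtain ⟨i, j, hij⟩ := Fintype.one_lt_card_iff.mp hι
  -- Double induction lowers both exponents to one. From `s j * b = t * c` and `s i * b = t * d` one
  -- gets `s i * c = s j * d`, so `s j` divides `c`, and cancelling it shows that `t` divides `b`.
  have step : ∀ N M : ℕ, ∀ b, s i ^ N * b ∈ Ideal.span {t} → s j ^ M * b ∈ Ideal.span {t} →
      b ∈ Ideal.span {t} := by
    intro N
    induction N with
    | zero => intro M b h _; simpa using h
    | succ N ihN =>
      intro M
      induction M with
      | zero => intro b _ h; simpa using h
      | succ M ihM =>
        intro b hi hj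
        have h1 : s j * b ∈ Ideal.span {t} := ihM _
          (by rw [mul_left_comm]; exact Ideal.mul_mem_left _ _ hi)
          (by rwa [← mul_assoc, ← pow_succ])
        have h2 : s i * b ∈ Ideal.span {t} := ihN 1 _ (by rwa [← mul_assoc, ← pow_succ])
          (by rw [pow_one, mul_left_comm]; exact Ideal.mul_mem_left _ _ h1)
        obtain ⟨c, hc⟩ := Ideal.mem_span_singleton'.mp h1
        obtain ⟨d, hd⟩ := Ideal.mem_span_singleton'.mp h2
        have h3 : s i * c = s j * d := by
          refine mul_left_cancel₀ ht ?_
          linear_combination s i * hc - s j * hd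
        obtain ⟨e, rfl⟩ := hs.dvd_of_mul_eq_mul hij h3
        refine Ideal.mem_span_singleton'.mpr ⟨e, mul_left_cancel₀ (hs0 j) ?_⟩
        linear_combination hc
  obtain ⟨N, hN⟩ := hb i
  obtain ⟨M, hM⟩ := hb j
  exact step N M b hN hM

end IsQuasiRegularSystem

end LeadingForms


/-! ### Smoothness along a smooth Cartier divisor -/

section CartierDivisor

open IsLocalRing TensorProduct KaehlerDifferential

/-- Tensoring with a quotient ring is reduction modulo the ideal. This turns injectivity for
base-changed conormal modules into membership in products of ideals. -/
lemma one_tmul_eq_zero_iff_mem_smul_top {P K M : Type*} [CommRing P] [CommRing K] [Algebra P K]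
    [AddCommGroup M] [Module P M] (h : Function.Surjective (algebraMap P K)) (x : M) :
    (1 : K) ⊗ₜ[P] x = 0 ↔ x ∈ RingHom.ker (algebraMap P K) • (⊤ : Submodule P M) := by
  let e : (P ⧸ RingHom.ker (algebraMap P K)) ≃ₐ[P] K :=
    Ideal.quotientKerAlgEquivOfSurjective (f := Algebra.ofId P K) h
  let E : K ⊗[P] M ≃ₗ[P] M ⧸ (RingHom.ker (algebraMap P K) • (⊤ : Submodule P M)) :=
    (LinearEquiv.rTensor M e.toLinearEquiv).symm ≪≫ₗ
      TensorProduct.quotTensorEquivQuotSMul M (RingHom.ker (algebraMap P K))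
  have : E (1 ⊗ₜ x) = Submodule.Quotient.mk x := by
    have h1 : (LinearEquiv.rTensor M e.toLinearEquiv).symm ((1 : K) ⊗ₜ[P] x) = 1 ⊗ₜ x := by
      rw [LinearEquiv.symm_apply_eq]
      simp
    rw [LinearEquiv.trans_apply, h1]
    simp
  rw [← E.map_eq_zero_iff, this, Submodule.Quotient.mk_eq_zero]

/-- Write `g = a + b * v` with `a ∈ n * J` and `b ∈ n`. Then `b * v ∈ J`, so `b ∈ J` by regularity
of `v` modulo `J`, and `b * v ∈ n * J` because `v ∈ n`. In effect `J / nJ` embeds in `J' / nJ'` for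
`J' = J + (v)`. -/
lemma mem_mul_of_mem_mul_sup_span {P : Type*} [CommRing P] {n J : Ideal P} {g v : P} (hg : g ∈ J)
    (hv : v ∈ n) (h : ∀ b, b * v ∈ J → b ∈ J) (hmem : g ∈ n * (J ⊔ Ideal.span {v})) :
    g ∈ n * J := by
  rw [Ideal.mul_sup] at hmem
  obtain ⟨a, ha, c, hc, hac⟩ := Submodule.mem_sup.mp hmem
  obtain ⟨b, hb, rfl⟩ := Ideal.mem_mul_span_singleton.mp hc
  have h3 : b * v ∈ J := by
    have : b * v = g - a := by rw [← hac]; ring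
    rw [this]
    exact J.sub_mem hg (Ideal.mul_le_right ha)
  rw [← hac]
  refine Ideal.add_mem _ ha ?_
  rw [mul_comm b v]
  exact Ideal.mul_mem_mul hv (h b h3)

lemma ker_mk_span_singleton_comp {P S : Type*} [CommRing P] [CommRing S] {φ : P →+* S}
    (hφ : Function.Surjective φ) {u : S} {v : P} (hv : φ v = u) :
    RingHom.ker ((Ideal.Quotient.mk (Ideal.span {u})).comp φ) =
      RingHom.ker φ ⊔ Ideal.span {v} := by
  ext x
  rw [RingHom.mem_ker, RingHom.comp_apply,
    Ideal.Quotient.eq_zero_iff_mem, Ideal.mem_span_singleton', Submodule.mem_sup]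
  constructor
  · rintro ⟨a, ha⟩
    obtain ⟨b, rfl⟩ := hφ a
    refine ⟨x - b * v, ?_, b * v, Ideal.mul_mem_left _ _ (Ideal.mem_span_singleton_self v), by ring⟩
    rw [RingHom.mem_ker, map_sub, map_mul, hv, ha, sub_self]
  · rintro ⟨a, ha, c, hc, rfl⟩
    obtain ⟨b, rfl⟩ := Ideal.mem_span_singleton'.mp hc
    exact ⟨φ b, by rw [map_add, (RingHom.mem_ker).mp ha, map_mul, hv, zero_add]⟩

/-- Jacobian criterion over the residue field `K`: a quotient `P / J` is formally smooth iff `K ⊗ J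
→ K ⊗ Ω` is injective. With `J' = J + (v)` the kernel for `S / u`, this map factors through `K ⊗
J'`. The second factor is injective by smoothness of `S / u`, and the first because `u` is a
nonzerodivisor. -/
theorem formallySmooth_of_formallySmooth_quotient_aux {k P S : Type u} [CommRing k]
    [CommRing P] [CommRing S] [IsLocalRing S] [Algebra k P] [Algebra k S] [Algebra P S]
    [IsScalarTower k P S] [Algebra.FormallySmooth k P] [Module.Free P Ω[P⁄k]]
    [Module.Finite P Ω[P⁄k]] [IsNoetherianRing P]
    (hPS : Function.Surjective (algebraMap P S))
    (hP : Function.Surjective (algebraMap P (ResidueField S)))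
    {u : S} (hu : u ∈ nonZeroDivisors S) (hum : u ∈ maximalIdeal S)
    [Algebra.FormallySmooth k (S ⧸ Ideal.span {u})] : Algebra.FormallySmooth k S := by
  let S' := S ⧸ Ideal.span {u}
  let K := ResidueField S
  let q : S' →+* K := Ideal.Quotient.lift _ (residue S) fun a ha ↦
    (residue_eq_zero_iff a).mpr ((Ideal.span_singleton_le_iff_mem _).mpr hum ha)
  let : Algebra S' K := q.toAlgebra
  have : IsScalarTower S S' K := .of_algebraMap_eq fun _ ↦ rfl
  have : IsScalarTower P S' K := .of_algebraMap_eq fun x ↦ rfl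
  have hS' : IsLocalRing S' :=
    have : Nontrivial S' := Ideal.Quotient.nontrivial_iff.mpr fun h ↦ by
      rw [Ideal.span_singleton_eq_top] at h
      exact hum h
    IsLocalRing.of_surjective' _ Ideal.Quotient.mk_surjective
  have hPS' : Function.Surjective (algebraMap P S') :=
    Ideal.Quotient.mk_surjective.comp hPS
  have hJ := (Algebra.FormallySmooth.iff_injective_cotangentComplexBaseChange (R := k) (S := S')
    P K hPS' (IsNoetherian.noetherian _) (fun x hx ↦ by
      obtain ⟨x, rfl⟩ := Ideal.Quotient.mk_surjective x
      have : x ∈ maximalIdeal S := fun hxu ↦ hx (hxu.map _)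
      exact (residue_eq_zero_iff x).mpr this)).mp inferInstance
  rw [Algebra.FormallySmooth.iff_injective_cotangentComplexBaseChange (R := k) (S := S)
    P K hPS (IsNoetherian.noetherian _) (fun x hx ↦ (residue_eq_zero_iff x).mpr hx),
    injective_iff_map_eq_zero]
  intro z hz
  let J := RingHom.ker (algebraMap P S)
  let n := RingHom.ker (algebraMap P K)
  obtain ⟨g, rfl⟩ := TensorProduct.mk_surjective P J K hP z
  obtain ⟨v, hv⟩ := hPS u
  have hJ' : RingHom.ker (algebraMap P S') = J ⊔ Ideal.span {v} :=
    ker_mk_span_singleton_comp hPS hv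
  have hvn : v ∈ n := by
    change algebraMap P K v = 0
    rw [IsScalarTower.algebraMap_apply P S K, hv]
    exact (residue_eq_zero_iff u).mpr hum
  have hle : J ≤ RingHom.ker (algebraMap P S') := hJ' ▸ le_sup_left
  -- The element dies in `K ⊗ Ω`, hence already in the conormal module of the quotient `S'`.
  have h0 : (1 : K) ⊗ₜ[P] (⟨g.1, hle g.2⟩ : RingHom.ker (algebraMap P S')) = 0 :=
    (injective_iff_map_eq_zero _).mp hJ _ hz
  rw [one_tmul_eq_zero_iff_mem_smul_top hP] at h0
  change (1 : K) ⊗ₜ[P] g = 0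
  rw [one_tmul_eq_zero_iff_mem_smul_top hP]
  have h1 : (g : P) ∈ n * RingHom.ker (algebraMap P S') := by
    have := Submodule.mem_map_of_mem (f := (RingHom.ker (algebraMap P S')).subtype) h0
    rwa [Submodule.map_smul'', Submodule.map_top, Submodule.range_subtype] at this
  have h2 : (g : P) ∈ n * J := by
    refine mem_mul_of_mem_mul_sup_span g.2 hvn (fun b hb ↦ ?_) (hJ' ▸ h1)
    have hb : algebraMap P S (b * v) = 0 := hb
    rw [map_mul, hv] at hb
    exact (mem_nonZeroDivisors_iff_right.mp hu) _ hb
  have h4 : n * J = Submodule.map J.subtype (n • ⊤) := by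
    rw [Submodule.map_smul'', Submodule.map_top, Submodule.range_subtype]; rfl
  rw [h4] at h2
  obtain ⟨y, hy, hyg⟩ := h2
  rwa [← Subtype.ext hyg]

/-- Let `R` be an algebra of finite type over a Noetherian ring, and `u ∈ R` a nonzerodivisor.
If `R / u` and `R[1 / u]` are smooth, then `R` is smooth. -/
theorem smooth_of_smooth_quotient_of_smooth_away {k R : Type u} [CommRing k] [IsNoetherianRing k]
    [CommRing R] [Algebra k R] [Algebra.FiniteType k R] {u : R} (hu : u ∈ nonZeroDivisors R)
    (h₁ : Algebra.FormallySmooth k (R ⧸ Ideal.span {u}))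
    (h₂ : Algebra.FormallySmooth k (Localization.Away u)) : Algebra.Smooth k R := by
  have : Algebra.FinitePresentation k R := Algebra.FinitePresentation.of_finiteType.mp inferInstance
  refine ⟨Algebra.smoothLocus_eq_univ_iff.mp (Set.eq_univ_of_forall fun q ↦ ?_), inferInstance⟩
  -- Smoothness is tested at each prime. A prime containing `u` is handled by the Jacobian criterion
  -- for a localised polynomial ring; any other prime lies in the open set where `u` is inverted.
  by_cases huq : u ∈ q.asIdeal
  · change Algebra.FormallySmooth k (Localization.AtPrime q.asIdeal)
    obtain ⟨n, f₀, hf₀⟩ := Algebra.FiniteType.iff_quotient_mvPolynomial''.mp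
      (inferInstance : Algebra.FiniteType k R)
    let M := q.asIdeal.primeCompl
    let S := Localization.AtPrime q.asIdeal
    let M' := M.comap f₀
    let P' := Localization M'
    let fP : P' →ₐ[k] S := IsLocalization.liftAlgHom (M := M')
        (f := (IsScalarTower.toAlgHom k R S).comp f₀) fun x ↦ by
      simpa using IsLocalization.map_units (M := M) S ⟨f₀ x.1, x.2⟩
    have hf₁ : Function.Surjective fP := by
      intro x
      obtain ⟨x, ⟨s, hs⟩, rfl⟩ := IsLocalization.exists_mk'_eq M x
      obtain ⟨x, rfl⟩ := hf₀ x
      obtain ⟨s, rfl⟩ := hf₀ s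
      refine ⟨IsLocalization.mk' (M := M') _ x ⟨s, hs⟩, ?_⟩
      simp [fP, IsLocalization.lift_mk', Units.mul_inv_eq_iff_eq_mul, IsUnit.liftRight]
    algebraize [fP.toRingHom]
    have : Algebra.FormallyEtale (MvPolynomial (Fin n) k) P' := .of_isLocalization M'
    have : Algebra.FormallySmooth k P' := .comp _ (MvPolynomial (Fin n) k) _
    have : Module.Free P' Ω[P'⁄k] := .of_equiv
      (KaehlerDifferential.tensorKaehlerEquivOfFormallyEtale k (MvPolynomial (Fin n) k) P')
    have : Module.Finite P' Ω[P'⁄k] := .equiv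
      (KaehlerDifferential.tensorKaehlerEquivOfFormallyEtale k (MvPolynomial (Fin n) k) P')
    have : IsNoetherianRing P' := IsLocalization.isNoetherianRing M' _ inferInstance
    let u' : S := algebraMap R S u
    have hu' : u' ∈ nonZeroDivisors S := by
      have := IsLocalization.map_nonZeroDivisors_le M S
      exact this ⟨u, hu, rfl⟩
    have hum : u' ∈ maximalIdeal S := by
      rw [← Localization.AtPrime.map_eq_maximalIdeal]
      exact Ideal.mem_map_of_mem _ huq
    have hq : Algebra.FormallySmooth k (S ⧸ Ideal.span {u'}) := by
      have h3 : Algebra.FormallySmooth k ((R ⧸ Ideal.span {u}) ⊗[R] S) :=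
        have : Algebra.FormallySmooth R S := .of_isLocalization M
        .comp k (R ⧸ Ideal.span {u}) _
      have hmap : (Ideal.span {u}).map (algebraMap R S) = Ideal.span {u'} := by
        rw [Ideal.map_span, Set.image_singleton]
      rw [← hmap]
      let e := Algebra.TensorProduct.quotIdealMapEquivQuotTensor S (Ideal.span {u})
      refine .of_equiv (A := (R ⧸ Ideal.span {u}) ⊗[R] S)
        (AlgEquiv.ofRingEquiv (f := e.symm.toRingEquiv) fun x ↦ ?_)
      change e.symm _ = _
      rw [IsScalarTower.algebraMap_apply k (R ⧸ Ideal.span {u}), e.symm.commutes]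
      rfl
    have : IsScalarTower k P' S := .of_algebraMap_eq' fP.comp_algebraMap.symm
    exact formallySmooth_of_formallySmooth_quotient_aux (P := P') hf₁
      (residue_surjective.comp hf₁) hu' hum
  · have := Algebra.basicOpen_subset_smoothLocus_iff.mpr h₂
    exact this huq

end CartierDivisor

/-! ### Reducedness of smooth algebras over a field -/

section Reduced

open IsLocalRing TensorProduct

/-- The maximal ideal of a Noetherian local ring has a system of generators of length the
dimension of the cotangent space. -/
lemma exists_minimalGenerators (R : Type*) [CommRing R] [IsLocalRing R] [IsNoetherianRing R] :
    ∃ s : Fin (Module.finrank (ResidueField R) (CotangentSpace R)) → R,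
      Ideal.span (Set.range s) = maximalIdeal R := by
  let b := Module.finBasis (ResidueField R) (CotangentSpace R)
  choose s hs using fun i ↦ Ideal.toCotangent_surjective _ (b i)
  refine ⟨fun i ↦ s i, ?_⟩
  have h := (CotangentSpace.span_image_eq_top_iff (R := R) (s := Set.range s)).mp (by
    rw [← Set.range_comp, ← b.span_eq]
    congr 2
    exact funext hs)
  have := congrArg (Submodule.map (maximalIdeal R).subtype) h
  rwa [Submodule.map_span, Submodule.map_top, Submodule.range_subtype, ← Set.range_comp] at this

/-- Formally smooth algebras of finite type over a field are reduced. -/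
theorem isReduced_of_formallySmooth (k A : Type u) [Field k] [CommRing A] [Algebra k A]
    [Algebra.FiniteType k A] [Algebra.FormallySmooth k A] : IsReduced A := by
  -- Over an algebraically closed field the residue fields of the local rings are formally smooth,
  -- so minimal generators are quasi-regular and the local rings are domains. Reducedness descends
  -- because `A` embeds in the base change.
  let K := AlgebraicClosure k
  let A' := K ⊗[k] A
  have hinj : Function.Injective (Algebra.TensorProduct.includeRight : A →ₐ[k] A') :=
    Algebra.TensorProduct.includeRight_injective (algebraMap k K).injective
  have : IsNoetherianRing A' := Algebra.FiniteType.isNoetherianRing K A'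
  suffices IsReduced A' from isReduced_of_injective _ hinj
  refine ⟨fun x hx ↦ eq_zero_of_localization x fun m hm ↦ ?_⟩
  let S := Localization.AtPrime m
  have : IsNoetherianRing S := IsLocalization.isNoetherianRing m.primeCompl _ inferInstance
  have : Algebra.FormallySmooth A' S := .of_isLocalization m.primeCompl
  have : Algebra.FormallySmooth K S := .comp K A' S
  have : Algebra.EssFiniteType K S := .comp K A' S
  have : Algebra.EssFiniteType K (ResidueField S) := .comp K S _
  obtain ⟨s, hs⟩ := exists_minimalGenerators S
  have := (IsQuasiRegularSystem.of_formallySmooth K hs (by simp)).isDomain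
  exact (hx.map (algebraMap A' S)).eq_zero

end Reduced


/-! ### Affine blow-up algebras -/

section AffineBlowUp

open MvPolynomial

/-- The homogenisation of a polynomial with respect to the variable `X i`. -/
noncomputable def homogenise {ι A : Type*} [CommRing A] (i : ι) (P : MvPolynomial ι A) : MvPolynomial ι A :=
  ∑ d ∈ Finset.range (P.totalDegree + 1), homogeneousComponent d P * X i ^ (P.totalDegree - d)

variable {ι A B R : Type*} [CommRing A] [CommRing B] [CommRing R]

lemma isHomogeneous_homogenise (i : ι) (P : MvPolynomial ι A) :
    (homogenise i P).IsHomogeneous P.totalDegree := by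
  refine IsHomogeneous.sum _ _ _ fun d hd ↦ ?_
  have := (homogeneousComponent_isHomogeneous d P).mul (isHomogeneous_X_pow i (P.totalDegree - d))
  rwa [Nat.add_sub_cancel' (Nat.lt_succ_iff.mp (Finset.mem_range.mp hd))] at this

lemma eval₂_homogenise (i : ι) (P : MvPolynomial ι A) (ρ : A →+* R) {c : ι → R} (hc : c i = 1) :
    eval₂ ρ c (homogenise i P) = eval₂ ρ c P := by
  conv_rhs => rw [← sum_homogeneousComponent P]
  simp only [homogenise, ← coe_eval₂Hom, map_sum, map_mul, map_pow, eval₂Hom_X', hc, one_pow,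
    mul_one]

lemma map_homogenise {κ : Type*} [CommRing κ] (χ : A →+* κ) (i : ι) (P : MvPolynomial ι A)
    {C : Type*} [CommRing C] (δ : κ →+* C) {c : ι → C} (hc : c i = 1) :
    eval₂ δ c (map χ (homogenise i P)) = eval₂ (δ.comp χ) c P := by
  rw [eval₂_map, eval₂_homogenise i P _ hc]

/-- Every monomial of degree `d` contributes a factor `u ^ d`. Applied to `f^*(t) = G(s)` on a chart
of the blow-up, this splits off `e` times the exceptional divisor. -/
lemma eval₂_mul_pow_of_isHomogeneous (ρ : A →+* R) {s : ι → A} {c : ι → R} {u : R}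
    (h : ∀ j, ρ (s j) = c j * u) {d : ℕ} {Q : MvPolynomial ι A} (hQ : Q.IsHomogeneous d) :
    ρ (eval s Q) = eval₂ ρ c Q * u ^ d := by
  rw [eval_eq, eval₂_eq, map_sum, Finset.sum_mul]
  refine Finset.sum_congr rfl fun α hα ↦ ?_
  rw [map_mul, map_prod, mul_assoc]
  congr 1
  have hd : ∑ j ∈ α.support, α j = d := by
    rw [← hQ (mem_support_iff.mp hα), Finsupp.weight_apply, Finsupp.sum]
    simp
  rw [← hd, ← Finset.prod_pow_eq_pow_sum, ← Finset.prod_mul_distrib]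
  exact Finset.prod_congr rfl fun j _ ↦ by rw [map_pow, h, mul_pow]

/-- `B` is the affine blow-up algebra `A[I / s_i]` where `I = (s_j)_j`, with `a_j = s_j / s_i`. -/
structure IsAffineBlowUp (φ : A →+* B) (s : ι → A) (i : ι) (a : ι → B) : Prop where
  map_eq : ∀ j, φ (s j) = a j * φ (s i)
  mem_nonZeroDivisors : φ (s i) ∈ nonZeroDivisors B
  surjective : Function.Surjective (eval₂Hom φ a)
  exists_pow_mul_eq_zero : ∀ x, φ x = 0 → ∃ N, s i ^ N * x = 0

/-- The algebra is realised as the subring of `A[1 / s_i]` generated over `A` by the fractions `s_j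
/ s_i`. -/
lemma exists_isAffineBlowUp {ι : Type*} {A : Type u} [CommRing A] (s : ι → A) (i : ι) :
    ∃ (B : CommRingCat.{u}) (φ : A →+* B) (a : ι → B), IsAffineBlowUp φ s i a := by
  let L := Localization.Away (s i)
  let x : ι → L := fun j ↦ IsLocalization.Away.invSelf (s i) * algebraMap A L (s j)
  have hinv : algebraMap A L (s i) * IsLocalization.Away.invSelf (s i) = 1 :=
    IsLocalization.Away.mul_invSelf (s i)
  let f : MvPolynomial ι A →ₐ[A] L := aeval x
  refine ⟨.of f.range, algebraMap A f.range, fun j ↦ ⟨x j, X j, aeval_X _ _⟩, ⟨fun j ↦ ?_, ?_,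
    ?_, fun y hy ↦ ?_⟩⟩
  · apply Subtype.ext
    change algebraMap A L (s j) = IsLocalization.Away.invSelf (s i) * algebraMap A L (s j) *
      algebraMap A L (s i)
    linear_combination (-algebraMap A L (s j)) * hinv
  · rw [mem_nonZeroDivisors_iff_right]
    rintro ⟨y, hy⟩ h
    have h' : y * algebraMap A L (s i) = 0 := congrArg Subtype.val h
    apply Subtype.ext
    change y = 0
    linear_combination IsLocalization.Away.invSelf (s i) * h' - y * hinv
  · have e : eval₂Hom (algebraMap A f.range) (fun j ↦ (⟨x j, X j, aeval_X x j⟩ : f.range)) =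
        f.rangeRestrict.toRingHom := by
      refine ringHom_ext (fun r ↦ ?_) fun j ↦ ?_
      · rw [eval₂Hom_C]
        exact (f.rangeRestrict.commutes r).symm
      · rw [eval₂Hom_X']
        exact Subtype.ext (aeval_X x j).symm
    rw [e]
    exact f.rangeRestrict_surjective
  · have : algebraMap A L y = 0 := congrArg (Subtype.val (p := fun z : L ↦ z ∈ f.range)) hy
    rw [IsLocalization.map_eq_zero_iff (Submonoid.powers (s i)) L] at this
    obtain ⟨⟨_, N, rfl⟩, h⟩ := this
    exact ⟨N, h⟩

namespace IsAffineBlowUp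

variable {φ : A →+* B} {s : ι → A} {i : ι} {a : ι → B} (h : IsAffineBlowUp φ s i a)
include h

lemma eq_one : a i = 1 := by
  have := h.map_eq i
  rw [← sub_eq_zero, ← one_sub_mul] at this
  exact (sub_eq_zero.mp ((mem_nonZeroDivisors_iff_right.mp h.mem_nonZeroDivisors) _ this)).symm

lemma map_span_eq : (Ideal.span (Set.range s)).map φ = Ideal.span {φ (s i)} := by
  refine le_antisymm ?_ ?_
  · rw [Ideal.map_span, Ideal.span_le]
    rintro _ ⟨_, ⟨j, rfl⟩, rfl⟩
    exact Ideal.mem_span_singleton'.mpr ⟨a j, (h.map_eq j).symm⟩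
  · rw [Ideal.span_singleton_le_iff_mem]
    exact Ideal.mem_map_of_mem _ (Ideal.subset_span ⟨i, rfl⟩)

/-- Homogenising a polynomial expression for `b` clears its denominators; this reduces questions
about `B` to questions about `A` up to powers of `s i`. -/
lemma exists_pow_mul_eq (b : B) : ∃ (D : ℕ) (x : A), φ (s i) ^ D * b = φ x := by
  obtain ⟨P, rfl⟩ := h.surjective b
  refine ⟨P.totalDegree, eval s (homogenise i P), ?_⟩
  rw [eval₂_mul_pow_of_isHomogeneous φ h.map_eq (isHomogeneous_homogenise i P),
    eval₂_homogenise i P φ h.eq_one, mul_comm, coe_eval₂Hom]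

lemma ringHom_ext {f g : B →+* R} (hφ : f.comp φ = g.comp φ)
    (hi : f (φ (s i)) ∈ nonZeroDivisors R) : f = g := by
  ext b
  obtain ⟨D, x, hx⟩ := h.exists_pow_mul_eq b
  have hc : ∀ y, g (φ y) = f (φ y) := fun y ↦ (RingHom.congr_fun hφ y).symm
  have h1 : f (φ (s i)) ^ D * f b = f (φ x) := by rw [← map_pow, ← map_mul, hx]
  have h2 : f (φ (s i)) ^ D * g b = f (φ x) := by rw [← hc, ← map_pow, ← map_mul, hx, hc]
  have h3 : (f b - g b) * f (φ (s i)) ^ D = 0 := by linear_combination h1 - h2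
  exact sub_eq_zero.mp ((mem_nonZeroDivisors_iff_right.mp (pow_mem hi D)) _ h3)

/-- The map has to send `a j` to the quotient `c j`. A relation among the `a j`, once homogenised,
becomes a relation among the `s j` up to a power of `s i`; applying `ρ` and cancelling the regular
element `ρ (s i)` gives the same relation among the `c j`. -/
lemma exists_lift (ρ : A →+* R) (hi : ρ (s i) ∈ nonZeroDivisors R)
    (hs : ∀ j, ∃ c, ρ (s j) = c * ρ (s i)) : ∃ f : B →+* R, f.comp φ = ρ := by
  choose c hc using hs
  have hci : c i = 1 := by
    have := hc i
    rw [← sub_eq_zero, ← one_sub_mul] at this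
    exact (sub_eq_zero.mp ((mem_nonZeroDivisors_iff_right.mp hi) _ this)).symm
  have hker : ∀ P ∈ RingHom.ker (eval₂Hom φ a), P ∈ RingHom.ker (eval₂Hom ρ c) := by
    intro P hP
    rw [RingHom.mem_ker, coe_eval₂Hom, ← eval₂_homogenise i P _ h.eq_one] at hP
    have h1 := eval₂_mul_pow_of_isHomogeneous φ h.map_eq (isHomogeneous_homogenise i P)
    rw [hP, zero_mul] at h1
    obtain ⟨N, hN⟩ := h.exists_pow_mul_eq_zero _ h1
    have h2 := congrArg ρ hN
    rw [map_mul, eval₂_mul_pow_of_isHomogeneous ρ hc (isHomogeneous_homogenise i P), map_zero,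
      eval₂_homogenise i P _ hci, mul_left_comm, map_pow, ← pow_add] at h2
    exact (mem_nonZeroDivisors_iff_right.mp (pow_mem hi _)) _ h2
  refine ⟨(eval₂Hom φ a).liftOfSurjective h.surjective ⟨eval₂Hom ρ c, hker⟩, ?_⟩
  ext x
  have := RingHom.liftOfRightInverse_comp_apply (eval₂Hom φ a) _
    (Function.rightInverse_surjInv h.surjective) ⟨eval₂Hom ρ c, hker⟩ (C x)
  simpa using this

end IsAffineBlowUp

/-- `C` is the coordinate ring `κ[T_j / T_i]` of a standard chart of projective space, with
`c_j = T_j / T_i`. -/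
structure IsStandardChart {κ C : Type*} [CommRing κ] [CommRing C] (δ : κ →+* C) (i : ι)
    (c : ι → C) : Prop where
  eq_one : c i = 1
  surjective : Function.Surjective (eval₂Hom δ c)
  eq_zero : ∀ (d : ℕ) (Q : MvPolynomial ι κ), Q.IsHomogeneous d → eval₂ δ c Q = 0 → Q = 0

/-- Homogenisation turns a zero product on the chart into a zero product of forms in the polynomial
ring over `κ`. -/
lemma IsStandardChart.isDomain {κ C : Type*} [CommRing κ] [IsDomain κ] [CommRing C]
    {δ : κ →+* C} {i : ι} {c : ι → C} (h : IsStandardChart δ i c) : IsDomain C := by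
  have : Nontrivial C := by
    refine ⟨1, 0, fun h0 ↦ one_ne_zero (α := MvPolynomial ι κ) (h.eq_zero 0 1 (isHomogeneous_one _ _) ?_)⟩
    rw [eval₂_one, h0]
  have : NoZeroDivisors C := by
    refine ⟨fun {x y} hxy ↦ ?_⟩
    obtain ⟨P, rfl⟩ := h.surjective x
    obtain ⟨Q, rfl⟩ := h.surjective y
    rw [coe_eval₂Hom, ← eval₂_homogenise i P _ h.eq_one,
      ← eval₂_homogenise i Q _ h.eq_one] at hxy ⊢
    rw [← eval₂_mul] at hxy
    have := h.eq_zero _ _ ((isHomogeneous_homogenise i P).mul (isHomogeneous_homogenise i Q)) hxy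
    rcases mul_eq_zero.mp this with h0 | h0
    · left; rw [h0, eval₂_zero]
    · right; rw [h0, eval₂_zero]
  exact NoZeroDivisors.to_isDomain C

/-- `s` generates the kernel of the surjection `χ : A → κ` and the associated graded
ring is the polynomial ring over `κ`. -/
structure IsQuasiRegular {κ : Type*} [CommRing κ] (χ : A →+* κ) (s : ι → A) : Prop where
  surjective : Function.Surjective χ
  span_eq : Ideal.span (Set.range s) = RingHom.ker χ
  map_eq_zero : ∀ (d : ℕ) (G : MvPolynomial ι A), G.IsHomogeneous d →
    eval s G ∈ RingHom.ker χ ^ (d + 1) → map χ G = 0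

namespace IsAffineBlowUp

variable {φ : A →+* B} {s : ι → A} {i : ι} {a : ι → B} (h : IsAffineBlowUp φ s i a)
  {κ C : Type*} [CommRing κ] [CommRing C] {χ : A →+* κ} {δ : κ →+* C} {c : ι → C}
include h

/-- The exceptional divisor on a chart of the blow-up along a quasi-regular ideal is a chart of
projective space. -/
lemma exists_toStandardChart (hs : IsQuasiRegular χ s) (hC : IsStandardChart δ i c) :
    ∃ ψ : B →+* C, ψ.comp φ = δ.comp χ ∧ (∀ j, ψ (a j) = c j) ∧ Function.Surjective ψ ∧
      RingHom.ker ψ = Ideal.span {φ (s i)} := by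
  have hmem : ∀ j, χ (s j) = 0 := fun j ↦ by
    rw [← RingHom.mem_ker, ← hs.span_eq]; exact Ideal.subset_span ⟨j, rfl⟩
  -- A relation among the `a j`, homogenised and multiplied by a power of `X i`, vanishes at `s`, so
  -- quasi-regularity kills its reduction. Hence sending `a j` to `c j` is well defined.
  have hker : ∀ P, eval₂ φ a P = 0 → map χ (homogenise i P) = 0 := by
    intro P hP
    have hH := isHomogeneous_homogenise i P
    rw [← eval₂_homogenise i P _ h.eq_one] at hP
    have h1 := eval₂_mul_pow_of_isHomogeneous φ h.map_eq hH
    rw [hP, zero_mul] at h1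
    obtain ⟨N, hN⟩ := h.exists_pow_mul_eq_zero _ h1
    have h2 := hs.map_eq_zero _ (X i ^ N * homogenise i P)
      ((isHomogeneous_X_pow i N).mul hH) (by
        rw [map_mul, map_pow, eval_X, hN]; exact Ideal.zero_mem _)
    rw [map_mul, map_pow, map_X] at h2
    rw [mul_comm] at h2
    exact (isRegular_X_pow (n := i) N).right (h2.trans (zero_mul _).symm)
  have hev : ∀ P, eval₂ (δ.comp χ) c P = eval₂ δ c (map χ (homogenise i P)) := fun P ↦
    (map_homogenise χ i P δ hC.eq_one).symm
  have hle : RingHom.ker (eval₂Hom φ a) ≤ RingHom.ker (eval₂Hom (δ.comp χ) c) := fun P hP ↦ by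
    change eval₂ _ _ P = 0
    rw [hev, hker P hP, eval₂_zero]
  let ψ := (eval₂Hom φ a).liftOfSurjective h.surjective ⟨eval₂Hom (δ.comp χ) c, hle⟩
  have hψ : ∀ P, ψ (eval₂ φ a P) = eval₂ (δ.comp χ) c P := fun P ↦
    RingHom.liftOfSurjective_comp_apply (eval₂Hom φ a) h.surjective ⟨eval₂Hom (δ.comp χ) c, hle⟩ P
  have hψφ : ψ.comp φ = δ.comp χ := by
    ext x
    have := hψ (MvPolynomial.C x)
    rwa [eval₂_C, eval₂_C] at this
  refine ⟨ψ, hψφ, fun j ↦ by simpa using hψ (X j), fun y ↦ ?_, le_antisymm (fun b hb ↦ ?_) ?_⟩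
  · obtain ⟨Q, rfl⟩ := hC.surjective y
    obtain ⟨P, rfl⟩ := map_surjective χ hs.surjective Q
    exact ⟨eval₂ φ a P, by rw [hψ, coe_eval₂Hom, eval₂_map]⟩
  -- An element of the kernel is the value at `a` of a form with coefficients in `ker χ = (s)`, and
  -- `(s)` generates the ideal of `φ (s i)` in `B`.
  · obtain ⟨P, rfl⟩ := h.surjective b
    rw [RingHom.mem_ker, coe_eval₂Hom, hψ, hev] at hb
    have h0 := hC.eq_zero _ _ ((isHomogeneous_homogenise i P).map χ) hb
    rw [coe_eval₂Hom, ← eval₂_homogenise i P _ h.eq_one, eval₂_eq]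
    refine Ideal.sum_mem _ fun α _ ↦ Ideal.mul_mem_right _ _ ?_
    have hα : coeff α (homogenise i P) ∈ RingHom.ker χ := by
      rw [RingHom.mem_ker, ← coeff_map, h0, coeff_zero]
    rw [← h.map_span_eq, hs.span_eq]
    exact Ideal.mem_map_of_mem _ hα
  · rw [Ideal.span_singleton_le_iff_mem, RingHom.mem_ker, ← RingHom.comp_apply, hψφ,
      RingHom.comp_apply, hmem, map_zero]

/-- Away from the exceptional divisor, the strict transform `V(g)` of `V(τ)` is `V(τ)`. -/
lemma isLocalization_away_quotient {τ : A} {e : ℕ} {g : B} (hg : φ τ = φ (s i) ^ e * g)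
    {L : Type*} [CommRing L] [Algebra (B ⧸ Ideal.span {g}) L] [Algebra (A ⧸ Ideal.span {τ}) L]
    (hL : ∀ x, algebraMap (A ⧸ Ideal.span {τ}) L (Ideal.Quotient.mk _ x) =
      algebraMap (B ⧸ Ideal.span {g}) L (Ideal.Quotient.mk _ (φ x)))
    [IsLocalization.Away (Ideal.Quotient.mk (Ideal.span {g}) (φ (s i))) L] :
    IsLocalization.Away (Ideal.Quotient.mk (Ideal.span {τ}) (s i)) L := by
  have hu : IsUnit (algebraMap (A ⧸ Ideal.span {τ}) L (Ideal.Quotient.mk _ (s i))) := by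
    rw [hL]; exact IsLocalization.Away.algebraMap_isUnit _
  refine IsLocalization.Away.mk _ hu (fun z ↦ ?_) fun x y hxy ↦ ?_
  · obtain ⟨N, b, hb⟩ := IsLocalization.Away.surj
      (Ideal.Quotient.mk (Ideal.span {g}) (φ (s i))) z
    obtain ⟨b, rfl⟩ := Ideal.Quotient.mk_surjective b
    obtain ⟨D, y, hy⟩ := h.exists_pow_mul_eq b
    refine ⟨N + D, Ideal.Quotient.mk _ y, ?_⟩
    rw [hL, hL, ← hy, pow_add, ← mul_assoc, hb, map_mul, map_pow, map_mul, map_pow, mul_comm]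
  · obtain ⟨x, rfl⟩ := Ideal.Quotient.mk_surjective x
    obtain ⟨y, rfl⟩ := Ideal.Quotient.mk_surjective y
    rw [hL, hL] at hxy
    obtain ⟨N, hN⟩ := IsLocalization.Away.exists_of_eq
      (Ideal.Quotient.mk (Ideal.span {g}) (φ (s i))) hxy
    rw [← map_pow, ← map_mul, ← map_mul, Ideal.Quotient.eq, Ideal.mem_span_singleton'] at hN
    obtain ⟨b, hb⟩ := hN
    obtain ⟨D, z, hz⟩ := h.exists_pow_mul_eq b
    -- The exponent collects `e` from `τ = s_i ^ e g`, `D` from clearing the denominator of `b`, and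
    -- `N` from equality in the localisation.
    have h1 : φ (s i ^ (e + D + N) * (x - y) - τ * z) = 0 := by
      simp only [map_sub, map_mul, map_pow, ← hz, hg]
      linear_combination - φ (s i) ^ (e + D) * hb
    obtain ⟨M, hM⟩ := h.exists_pow_mul_eq_zero _ h1
    refine ⟨M + (e + D + N), ?_⟩
    rw [← map_pow, ← map_mul, ← map_mul, Ideal.Quotient.eq, Ideal.mem_span_singleton']
    exact ⟨s i ^ M * z, by linear_combination - hM⟩

omit h in
lemma map_eval₂_eq {ψ : B →+* C} (hφ : ψ.comp φ = δ.comp χ) (ha : ∀ j, ψ (a j) = c j)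
    (G : MvPolynomial ι A) : ψ (eval₂ φ a G) = eval₂ δ c (map χ G) := by
  rw [← coe_eval₂Hom, map_eval₂Hom, hφ, eval₂_map]
  rw [show (fun j ↦ ψ (a j)) = c from _root_.funext ha, coe_eval₂Hom]

end IsAffineBlowUp

/-- If `u * b = d * g`, then `d` dies in the domain `C`, where `g` does not; so `d` is a multiple of
`u`, which can be cancelled. This reverses the order of the regular sequence `u, g`. -/
lemma mem_span_singleton_of_mul_mem {C : Type*} [CommRing C] [IsDomain C] {ψ : B →+* C} {u : B}
    (hker : RingHom.ker ψ = Ideal.span {u}) (hi : u ∈ nonZeroDivisors B)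
    {g : B} (hg : ψ g ≠ 0) {b : B} (hb : u * b ∈ Ideal.span {g}) : b ∈ Ideal.span {g} := by
  rw [Ideal.mem_span_singleton'] at hb ⊢
  obtain ⟨d, hd⟩ := hb
  have h0 : ψ (u) = 0 := by
    rw [← RingHom.mem_ker, hker]; exact Ideal.mem_span_singleton_self _
  have h1 : d ∈ RingHom.ker ψ := by
    have := congrArg ψ hd
    rw [map_mul, map_mul, h0, zero_mul] at this
    exact (mul_eq_zero.mp this).resolve_right hg
  rw [hker, Ideal.mem_span_singleton'] at h1
  obtain ⟨d', rfl⟩ := h1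
  refine ⟨d', sub_eq_zero.mp ((mem_nonZeroDivisors_iff_right.mp hi) _ ?_)⟩
  linear_combination hd

/-- The condition on leading forms can be tested in the local ring, since `ker χ` maps into its
maximal ideal and both rings have the same residue map. -/
lemma IsQuasiRegularSystem.isQuasiRegular [Fintype ι] [IsLocalRing R] [Algebra A R] {s : ι → A}
    (hs : IsQuasiRegularSystem fun j ↦ algebraMap A R (s j))
    (hsurj : Function.Surjective ((IsLocalRing.residue R).comp (algebraMap A R)))
    (hspan : Ideal.span (Set.range s) =
      RingHom.ker ((IsLocalRing.residue R).comp (algebraMap A R))) :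
    IsQuasiRegular ((IsLocalRing.residue R).comp (algebraMap A R)) s := by
  refine ⟨hsurj, hspan, fun d G hG h ↦ ?_⟩
  rw [← map_map]
  refine hs.map_eq_zero d _ (hG.map _) ?_
  have h1 : (RingHom.ker ((IsLocalRing.residue R).comp (algebraMap A R))).map (algebraMap A R) ≤
      IsLocalRing.maximalIdeal R := by
    rw [Ideal.map_le_iff_le_comap]
    intro x hx
    exact (IsLocalRing.residue_eq_zero_iff _).mp hx
  have h2 := Ideal.mem_map_of_mem (algebraMap A R) h
  rw [Ideal.map_pow] at h2
  have h3 : eval (fun j ↦ algebraMap A R (s j)) (map (algebraMap A R) G) =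
      algebraMap A R (eval s G) := by
    rw [MvPolynomial.eval_map, ← coe_eval₂Hom, MvPolynomial.eval, map_eval₂Hom]
    rfl
  rw [h3]
  exact Ideal.pow_right_mono h1 _ h2

end AffineBlowUp


/-! ### Ideal sheaves on affine charts -/

section OnChart

open Scheme

variable {X Y : Scheme.{u}} {A B : CommRingCat.{u}}

/-- The pullback of an ideal sheaf along a morphism from an affine scheme, as an ideal. -/
noncomputable def onChart (q : Spec B ⟶ Y) (J : Y.IdealSheafData) : Ideal B :=
  ((J.comap q).ideal ⟨⊤, isAffineOpen_top _⟩).comap (ΓSpecIso B).inv.hom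

lemma onChart_comap (q : Spec B ⟶ Y) (π : Y ⟶ X) (J : X.IdealSheafData) :
    onChart q (J.comap π) = onChart (q ≫ π) J := by
  rw [onChart, onChart, IdealSheafData.comap_comp]

lemma onChart_mono (q : Spec B ⟶ Y) : Monotone (onChart q) := fun _ _ h ↦
  Ideal.comap_mono (IdealSheafData.comap_mono q h _)

lemma onChart_id_le_iff {I J : (Spec B).IdealSheafData} :
    onChart (𝟙 _) I ≤ onChart (𝟙 _) J ↔ I ≤ J := by
  refine ⟨fun h ↦ ?_, fun h ↦ onChart_mono _ h⟩
  simp only [onChart, IdealSheafData.comap_id] at h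
  refine IdealSheafData.le_of_isAffine fun x hx ↦ ?_
  have := @h ((ΓSpecIso B).hom.hom x) (by simpa using hx)
  simpa using this

lemma onChart_id_injective : Function.Injective (onChart (𝟙 (Spec B))) := fun _ _ h ↦
  le_antisymm (onChart_id_le_iff.mp h.le) (onChart_id_le_iff.mp h.ge)

lemma onChart_id_surjective : Function.Surjective (onChart (𝟙 (Spec B))) := by
  intro I
  refine ⟨IdealSheafData.ofIdealTop (I.comap (ΓSpecIso B).hom.hom), ?_⟩
  rw [onChart, IdealSheafData.comap_id]
  ext x
  simp [IdealSheafData.ofIdealTop]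

lemma onChart_eq_onChart_id (q : Spec B ⟶ Y) (J : Y.IdealSheafData) :
    onChart q J = onChart (𝟙 _) (J.comap q) := by
  rw [onChart_comap, Category.id_comp]

lemma onChart_id_map (φ : A ⟶ B) (I : (Spec B).IdealSheafData) :
    onChart (𝟙 _) (I.map (Spec.map φ)) = (onChart (𝟙 _) I).comap φ.hom := by
  rw [onChart, onChart, IdealSheafData.comap_id, IdealSheafData.comap_id,
    IdealSheafData.ideal_map_of_isAffineHom, Ideal.comap_comap, Ideal.comap_comap]
  congr 1
  rw [← CommRingCat.hom_comp, ← CommRingCat.hom_comp]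
  congr 1
  exact ΓSpecIso_inv_naturality φ |>.symm

/-- Both sides are compared with an arbitrary ideal: extension and contraction of ideals are
adjoint, as are inverse and direct image of ideal sheaves, and the right adjoints agree. -/
lemma onChart_SpecMap (φ : A ⟶ B) (I : (Spec A).IdealSheafData) :
    onChart (Spec.map φ) I = (onChart (𝟙 _) I).map φ.hom := by
  refine eq_of_forall_ge_iff fun K ↦ ?_
  obtain ⟨K, rfl⟩ := onChart_id_surjective K
  rw [Ideal.map_le_iff_le_comap, ← onChart_id_map, onChart_id_le_iff,
    IdealSheafData.le_map_iff_comap_le, onChart_eq_onChart_id, onChart_id_le_iff]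

lemma onChart_SpecMap_comp (φ : A ⟶ B) (p : Spec A ⟶ Y) (I : Y.IdealSheafData) :
    onChart (Spec.map φ ≫ p) I = (onChart p I).map φ.hom := by
  rw [← onChart_comap, onChart_SpecMap, ← onChart_eq_onChart_id]

lemma onChart_comap_eq_map {q : Spec B ⟶ Y} {π : Y ⟶ X} {p : Spec A ⟶ X} {φ : A ⟶ B}
    (h : q ≫ π = Spec.map φ ≫ p) (I : X.IdealSheafData) :
    onChart q (I.comap π) = (onChart p I).map φ.hom := by
  rw [onChart_comap, h, onChart_SpecMap_comp]

lemma onChart_sup (q : Spec B ⟶ Y) (I J : Y.IdealSheafData) :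
    onChart q (I ⊔ J) = onChart q I ⊔ onChart q J := by
  refine eq_of_forall_ge_iff fun K ↦ ?_
  obtain ⟨K, rfl⟩ := onChart_id_surjective K
  rw [sup_le_iff, onChart_eq_onChart_id, onChart_eq_onChart_id q I, onChart_eq_onChart_id q J,
    onChart_id_le_iff, onChart_id_le_iff, onChart_id_le_iff, IdealSheafData.comap_sup, sup_le_iff]

lemma onChart_bot (q : Spec B ⟶ Y) : onChart q ⊥ = ⊥ := by
  rw [eq_bot_iff]
  obtain ⟨K, hK⟩ := onChart_id_surjective (⊥ : Ideal B)
  rw [← hK, onChart_eq_onChart_id, onChart_id_le_iff, IdealSheafData.comap_bot]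
  exact bot_le

lemma onChart_iSup_opensRange {ι : Type*} {B : ι → CommRingCat.{u}} (q : ∀ i, Spec (B i) ⟶ Y)
    [∀ i, IsOpenImmersion (q i)] (hq : ∀ y, ∃ i, y ∈ Set.range (q i)) :
    ⨆ i, (q i).opensRange = ⊤ := by
  rw [← top_le_iff]
  intro y _
  obtain ⟨i, hi⟩ := hq y
  exact TopologicalSpace.Opens.mem_iSup.mpr ⟨i, hi⟩

lemma onChart_fromSpec {W : X.Opens} (hW : IsAffineOpen W) (J : X.IdealSheafData) :
    onChart hW.fromSpec J = J.ideal ⟨W, hW⟩ := by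
  have key : ∀ (U V : X.affineOpens) (h : U = V),
      J.ideal U = (J.ideal V).comap (X.presheaf.map (eqToHom (congrArg Subtype.val h.symm)).op).hom := by
    rintro U _ rfl
    simp
  have h : hW.fromSpec ''ᵁ ⊤ = W := by simp
  rw [onChart, IdealSheafData.ideal_comap_of_isOpenImmersion,
    key _ ⟨W, hW⟩ (Subtype.ext h),
    Ideal.comap_comap, Ideal.comap_comap, ← CommRingCat.hom_comp, ← CommRingCat.hom_comp]
  convert Ideal.comap_id _
  rw [← CommRingCat.hom_id]
  congr 1
  have h1 : hW.fromSpec.appLE W ⊤ (by simp) = (ΓSpecIso _).inv := by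
    rw [Scheme.Hom.appLE, hW.fromSpec_app_self, Category.assoc, ← Functor.map_comp]
    exact (congrArg ((ΓSpecIso Γ(X, W)).inv ≫ ·)
      ((Spec Γ(X, W)).presheaf.map_id _)).trans (Category.comp_id _)
  have h2 := hW.fromSpec.appLE_appIso_inv (U := W) (V := ⊤) (by simp)
  rw [h1] at h2
  have h3 : ((ΓSpecIso _).inv ≫ (hW.fromSpec.appIso ⊤).inv) ≫
      X.presheaf.map (eqToHom h.symm).op = 𝟙 _ := by
    rw [h2, ← Functor.map_comp]
    exact X.presheaf.map_id _
  exact h3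

lemma SpecMap_appLE_ΓSpecIso_fromSpec (q : Spec B ⟶ Y) {U : Y.Opens} (hU : IsAffineOpen U)
    (h : ⊤ ≤ q ⁻¹ᵁ U) :
    Spec.map (q.appLE U ⊤ h ≫ (ΓSpecIso B).hom) ≫ hU.fromSpec = q := by
  rw [Spec.map_comp, Category.assoc,
    IsAffineOpen.SpecMap_appLE_fromSpec q hU (isAffineOpen_top (Spec B)),
    IsAffineOpen.fromSpec_top, isoSpec_Spec_inv]
  rw [← Spec.map_comp_assoc]
  simp

lemma onChart_eq_map (q : Spec B ⟶ Y) {U : Y.Opens} (hU : IsAffineOpen U) (h : ⊤ ≤ q ⁻¹ᵁ U)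
    (J : Y.IdealSheafData) :
    onChart q J = (J.ideal ⟨U, hU⟩).map (q.appLE U ⊤ h ≫ (ΓSpecIso B).hom).hom := by
  rw [← onChart_fromSpec, ← onChart_SpecMap_comp, SpecMap_appLE_ΓSpecIso_fromSpec]

lemma ideal_comap_eq_map (g : Y ⟶ X) (J : X.IdealSheafData) {W : X.Opens} (hW : IsAffineOpen W)
    {V : Y.Opens} (hV : IsAffineOpen V) (h : V ≤ g ⁻¹ᵁ W) :
    (J.comap g).ideal ⟨V, hV⟩ = (J.ideal ⟨W, hW⟩).map (g.appLE W V h).hom := by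
  rw [← onChart_fromSpec, ← onChart_fromSpec hW]
  exact onChart_comap_eq_map (IsAffineOpen.SpecMap_appLE_fromSpec g hW hV h).symm J

lemma top_le_preimage_opensRange (q : Spec B ⟶ Y) [IsOpenImmersion q] :
    ⊤ ≤ q ⁻¹ᵁ q.opensRange := by
  simp

/-- The ring of an affine chart as the sections on its image. -/
noncomputable def chartIso (q : Spec B ⟶ Y) [IsOpenImmersion q] : Γ(Y, q.opensRange) ≅ B :=
  haveI : IsIso (q.appLE q.opensRange ⊤ (top_le_preimage_opensRange q)) := by
    have := q.appIso_hom' ⊤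
    have h : q ''ᵁ ⊤ = q.opensRange := by simp
    have h2 : q.appLE q.opensRange ⊤ (top_le_preimage_opensRange q) =
        Y.presheaf.map (eqToHom h).op ≫ (q.appIso ⊤).hom := by
      rw [q.appIso_hom', Scheme.Hom.map_appLE]
    rw [h2]
    infer_instance
  asIso (q.appLE q.opensRange ⊤ (top_le_preimage_opensRange q)) ≪≫ ΓSpecIso B

lemma SpecMap_chartIso_fromSpec (q : Spec B ⟶ Y) [IsOpenImmersion q] :
    Spec.map (chartIso q).hom ≫ (isAffineOpen_opensRange q).fromSpec = q :=
  SpecMap_appLE_ΓSpecIso_fromSpec q _ _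

lemma onChart_eq_map_chartIso (q : Spec B ⟶ Y) [IsOpenImmersion q] (J : Y.IdealSheafData) :
    onChart q J =
      (J.ideal ⟨q.opensRange, isAffineOpen_opensRange q⟩).map (chartIso q).hom.hom :=
  onChart_eq_map q _ _ J

lemma onChart_mul (q : Spec B ⟶ Y) [IsOpenImmersion q] (I J : Y.IdealSheafData) :
    onChart q (I * J) = onChart q I * onChart q J := by
  simp only [onChart_eq_map_chartIso, ← Ideal.map_mul]
  rfl

lemma onChart_pow (q : Spec B ⟶ Y) [IsOpenImmersion q] (I : Y.IdealSheafData) (n : ℕ) :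
    onChart q (I ^ n) = onChart q I ^ n := by
  simp only [onChart_eq_map_chartIso, ← Ideal.map_pow]
  rfl

lemma le_of_onChart_le {ι : Type*} {B : ι → CommRingCat.{u}} (q : ∀ i, Spec (B i) ⟶ Y)
    [∀ i, IsOpenImmersion (q i)] (hq : ∀ y, ∃ i, y ∈ Set.range (q i)) {I J : Y.IdealSheafData}
    (h : ∀ i, onChart (q i) I ≤ onChart (q i) J) : I ≤ J := by
  refine IdealSheafData.le_of_iSup_eq_top
    (fun i ↦ ⟨(q i).opensRange, isAffineOpen_opensRange (q i)⟩) (onChart_iSup_opensRange q hq)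
    fun i ↦ ?_
  have hi := h i
  rw [onChart_eq_map_chartIso, onChart_eq_map_chartIso] at hi
  let e := (chartIso (q i)).commRingCatIsoToRingEquiv
  replace hi := Ideal.comap_mono (f := e) hi
  erw [Ideal.comap_map_of_bijective e e.bijective, Ideal.comap_map_of_bijective e e.bijective] at hi
  exact hi

lemma ext_of_onChart {ι : Type*} {B : ι → CommRingCat.{u}} (q : ∀ i, Spec (B i) ⟶ Y)
    [∀ i, IsOpenImmersion (q i)] (hq : ∀ y, ∃ i, y ∈ Set.range (q i)) {I J : Y.IdealSheafData}
    (h : ∀ i, onChart (q i) I = onChart (q i) J) : I = J :=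
  le_antisymm (le_of_onChart_le q hq fun i ↦ (h i).le) (le_of_onChart_le q hq fun i ↦ (h i).ge)

lemma onChart_vanishingIdeal (q : Spec B ⟶ Y) [IsOpenImmersion q]
    (Z : TopologicalSpace.Closeds Y) :
    onChart q (IdealSheafData.vanishingIdeal Z) = PrimeSpectrum.vanishingIdeal (q ⁻¹' Z) := by
  rw [onChart_eq_map_chartIso, IdealSheafData.vanishingIdeal_ideal]
  let e := (chartIso q).commRingCatIsoToRingEquiv
  have he : ∀ x, (isAffineOpen_opensRange q).fromSpec (Spec.map (chartIso q).hom x) = q x :=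
    fun x ↦ by rw [← Scheme.Hom.comp_apply, SpecMap_chartIso_fromSpec]
  have he' : ∀ x, q (Spec.map (chartIso q).inv x) = (isAffineOpen_opensRange q).fromSpec x :=
    fun x ↦ by
      rw [← he, ← Scheme.Hom.comp_apply (Spec.map (chartIso q).inv), ← Spec.map_comp,
        Iso.hom_inv_id, Spec.map_id]
      rfl
  change Ideal.map e _ = _
  rw [← Ideal.comap_symm]
  ext b
  rw [Ideal.mem_comap, PrimeSpectrum.mem_vanishingIdeal, PrimeSpectrum.mem_vanishingIdeal]
  refine ⟨fun h x hx ↦ ?_, fun h x hx ↦ ?_⟩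
  · have := h (Spec.map (chartIso q).hom x) ((congrArg (· ∈ (Z : Set Y)) (he x)).mpr hx)
    change (chartIso q).hom.hom ((chartIso q).inv.hom b) ∈ x.asIdeal at this
    simpa using this
  · exact h (Spec.map (chartIso q).inv x) ((congrArg (· ∈ (Z : Set Y)) (he' x)).mpr hx)

lemma onChart_id_ker_SpecMap (φ : A ⟶ B) :
    onChart (𝟙 _) (Spec.map φ).ker = RingHom.ker φ.hom := by
  rw [← IdealSheafData.map_bot, onChart_id_map, onChart_bot]
  rfl

/-! ### Closed subschemes on affine charts -/

/-- The inclusion of a chart of a closed subscheme. -/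
noncomputable def chartι (q : Spec B ⟶ Y) (J : Y.IdealSheafData) :
    Spec (.of (B ⧸ onChart q J)) ⟶ J.subscheme :=
  IsClosedImmersion.lift J.subschemeι
    (Spec.map (CommRingCat.ofHom (Ideal.Quotient.mk (onChart q J))) ≫ q) (by
      rw [IdealSheafData.ker_subschemeι, ← IdealSheafData.map_ker,
        IdealSheafData.le_map_iff_comap_le, ← onChart_id_le_iff, ← onChart_eq_onChart_id,
        onChart_id_ker_SpecMap]
      exact (Ideal.mk_ker (I := onChart q J)).ge)

lemma chartι_subschemeι (q : Spec B ⟶ Y) (J : Y.IdealSheafData) :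
    chartι q J ≫ J.subschemeι =
      Spec.map (CommRingCat.ofHom (Ideal.Quotient.mk (onChart q J))) ≫ q :=
  IsClosedImmersion.lift_fac _ _ _

lemma chartι_subschemeι_assoc (q : Spec B ⟶ Y) (J : Y.IdealSheafData) {Z : Scheme.{u}} (g : Y ⟶ Z) :
    chartι q J ≫ J.subschemeι ≫ g =
      Spec.map (CommRingCat.ofHom (Ideal.Quotient.mk (onChart q J))) ≫ q ≫ g := by
  rw [← Category.assoc, chartι_subschemeι, Category.assoc]

instance isClosedImmersion_SpecMap_mk {B : CommRingCat.{u}} (I : Ideal B) :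
    IsClosedImmersion (Spec.map (CommRingCat.ofHom (Ideal.Quotient.mk I))) :=
  IsClosedImmersion.spec_of_surjective _ Ideal.Quotient.mk_surjective

/-- A commuting square whose parallel sides are closed immersions is cartesian once the upper ideal
sheaf is the inverse image of the lower one. As a consequence `chartι q J` is an open immersion
whenever `q` is. -/
lemma isPullback_chartι (q : Spec B ⟶ Y) (J : Y.IdealSheafData) :
    IsPullback (Spec.map (CommRingCat.ofHom (Ideal.Quotient.mk (onChart q J)))) (chartι q J) q
      J.subschemeι := by
  refine isPullback_of_isClosedImmersion _ _ _ _ (chartι_subschemeι q J).symm ?_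
  apply onChart_id_injective
  rw [onChart_id_ker_SpecMap, ← onChart_eq_onChart_id, IdealSheafData.ker_subschemeι]
  exact (Ideal.mk_ker (I := onChart q J)).symm

instance (q : Spec B ⟶ Y) [IsOpenImmersion q] (J : Y.IdealSheafData) :
    IsOpenImmersion (chartι q J) :=
  MorphismProperty.of_isPullback (isPullback_chartι q J) inferInstance

lemma exists_chartι_eq (q : Spec B ⟶ Y) (J : Y.IdealSheafData) (y : J.subscheme)
    (hy : J.subschemeι y ∈ Set.range q) : y ∈ Set.range (chartι q J) := by
  obtain ⟨x, hx⟩ := hy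
  obtain ⟨z, -, hz⟩ := exists_preimage_of_isPullback (isPullback_chartι q J) x y hx
  exact ⟨z, hz⟩

/-- Jointly surjective open immersions form an open cover. -/
noncomputable def openCoverOf {ι : Type*} {Z : ι → Scheme.{u}} (q : ∀ i, Z i ⟶ Y)
    [∀ i, IsOpenImmersion (q i)] (hq : ∀ y, ∃ i, y ∈ Set.range (q i)) : Y.OpenCover :=
  Scheme.Cover.mkOfCovers ι Z q (fun y ↦ let ⟨i, x, hx⟩ := hq y; ⟨i, x, hx⟩) fun _ ↦ inferInstance

variable {ι : Type*} {C : ι → CommRingCat.{u}} (q : ∀ i, Spec (C i) ⟶ Y)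
  [∀ i, IsOpenImmersion (q i)] (hq : ∀ y, ∃ i, y ∈ Set.range (q i))

include hq

/-- The affine charts of a closed subscheme. -/
noncomputable def chartCover (J : Y.IdealSheafData) : J.subscheme.OpenCover :=
  openCoverOf (fun i ↦ chartι (q i) J) fun y ↦ by
    obtain ⟨i, hi⟩ := hq (J.subschemeι y)
    exact ⟨i, exists_chartι_eq _ _ _ hi⟩

lemma isReduced_subscheme (J : Y.IdealSheafData)
    (h : ∀ i, _root_.IsReduced (C i ⧸ onChart (q i) J)) :
    AlgebraicGeometry.IsReduced J.subscheme := by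
  have : ∀ i, AlgebraicGeometry.IsReduced ((chartCover q hq J).X i) := fun i ↦
    (affine_isReduced_iff (.of (C i ⧸ onChart (q i) J))).mpr (h i)
  exact AlgebraicGeometry.IsReduced.of_openCover _ (chartCover q hq J)

variable {O : Type u} [CommRing O] [IsLocalRing O]

instance : IsClosedImmersion (closedPt O) :=
  IsClosedImmersion.spec_of_surjective _ IsLocalRing.residue_surjective

omit [∀ i, IsOpenImmersion (q i)] hq in
lemma onChart_ker_closedPt :
    onChart (𝟙 _) (closedPt O).ker = IsLocalRing.maximalIdeal O := by
  rw [closedPt, onChart_id_ker_SpecMap]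
  exact IsLocalRing.ker_residue

instance : IsZariskiLocalAtSource (@Smooth.{u}) :=
  HasRingHomProperty.instIsZariskiLocalAtSource (Q := RingHom.Smooth)

/-- Smoothness over the residue field of a closed subscheme, on charts. -/
lemma isSmoothOverResidue_iff (J : Y.IdealSheafData)
    (g : Y ⟶ Spec (.of O)) (φ : ∀ i, O →+* C i)
    (hφ : ∀ i, q i ≫ g = Spec.map (CommRingCat.ofHom (φ i))) :
    IsSmoothOverResidue (J.subschemeι ≫ g) ↔
      ∀ i, ∃ ψ : IsLocalRing.ResidueField O →+* C i ⧸ onChart (q i) J,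
        ψ.comp (IsLocalRing.residue O) = (Ideal.Quotient.mk _).comp (φ i) ∧ ψ.Smooth := by
  refine ⟨?_, fun H ↦ ?_⟩
  · rintro ⟨h, hg, hsm⟩ i
    have h1 : Smooth (chartι (q i) J ≫ h) := inferInstance
    obtain ⟨ψ, hψ⟩ := Spec.map_surjective (chartι (q i) J ≫ h)
    refine ⟨ψ.hom, ?_, ?_⟩
    · have : Spec.map ψ ≫ closedPt O = Spec.map (CommRingCat.ofHom (φ i) ≫
          CommRingCat.ofHom (Ideal.Quotient.mk (onChart (q i) J))) := by
        rw [hψ, Category.assoc, hg, chartι_subschemeι_assoc, hφ, ← Spec.map_comp]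
      rw [closedPt, ← Spec.map_comp] at this
      exact congrArg CommRingCat.Hom.hom (Spec.map_injective this)
    · rw [← hψ] at h1
      exact (HasRingHomProperty.Spec_iff (P := @Smooth)).mp h1
  · choose ψ h1 h2 using H
    -- The maps `ψ i` need no explicit glueing: this inclusion of ideals yields a factorisation
    -- through the closed point, and as `closedPt O` is a monomorphism it restricts to each `ψ i`.
    have hker : (closedPt O).ker.comap g ≤ J := by
      refine le_of_onChart_le q hq fun i ↦ ?_
      have := onChart_comap_eq_map (q := q i) (π := g) (p := 𝟙 _) (φ := CommRingCat.ofHom (φ i))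
        (by rw [hφ, Category.comp_id]) (closedPt O).ker
      rw [this, onChart_ker_closedPt, Ideal.map_le_iff_le_comap]
      intro x hx
      rw [Ideal.mem_comap, ← Ideal.Quotient.eq_zero_iff_mem]
      refine (RingHom.congr_fun (h1 i) x).symm.trans ?_
      rw [RingHom.comp_apply, (IsLocalRing.residue_eq_zero_iff x).mpr hx, map_zero]
    have hle : (closedPt O).ker ≤ (J.subschemeι ≫ g).ker := by
      rw [← IdealSheafData.map_ker, IdealSheafData.ker_subschemeι,
        IdealSheafData.le_map_iff_comap_le]
      exact hker
    refine ⟨IsClosedImmersion.lift (closedPt O) _ hle, IsClosedImmersion.lift_fac _ _ _, ?_⟩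
    have key : ∀ i : ι, chartι (q i) J ≫ IsClosedImmersion.lift (closedPt O) _ hle =
        Spec.map (CommRingCat.ofHom (ψ i)) := by
      intro i
      rw [← cancel_mono (closedPt O), Category.assoc, IsClosedImmersion.lift_fac,
        chartι_subschemeι_assoc, hφ, closedPt, ← Spec.map_comp, ← Spec.map_comp]
      congr 1
      exact CommRingCat.hom_ext (h1 i).symm
    rw [IsZariskiLocalAtSource.iff_of_openCover (P := @Smooth) (chartCover q hq J)]
    intro i
    change Smooth (chartι (q i) J ≫ IsClosedImmersion.lift (closedPt O) _ hle)
    rw [key i]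
    exact (HasRingHomProperty.Spec_iff (P := @Smooth)).mpr (h2 i)

omit hq in
lemma ringKrullDim_stalk_chart (q : Spec B ⟶ Y) [IsOpenImmersion q] (x : PrimeSpectrum B) :
    ringKrullDim (Y.presheaf.stalk (q x)) = ringKrullDim (Localization.AtPrime x.asIdeal) := by
  have key : ∀ z : Spec B, IsIso (q.stalkMap z) := fun z ↦ inferInstance
  have := key x
  exact ringKrullDim_eq_of_ringEquiv
    (asIso (q.stalkMap x) ≪≫ Spec.stalkIso B x).commRingCatIsoToRingEquiv

omit hq in
lemma ringKrullDim_stalk_chartι (q : Spec B ⟶ Y) [IsOpenImmersion q] (J : Y.IdealSheafData)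
    (x : PrimeSpectrum (B ⧸ onChart q J)) :
    ringKrullDim (J.subscheme.presheaf.stalk (chartι q J x)) =
      ringKrullDim (Localization.AtPrime x.asIdeal) :=
  ringKrullDim_stalk_chart (B := .of (B ⧸ onChart q J)) (chartι q J) x

end OnChart


/-! ### Morphisms out of a scheme covered by open immersions -/

section GlueMorphisms

variable {ι : Type*} {Y W : Scheme.{u}} {Z : ι → Scheme.{u}} (q : ∀ i, Z i ⟶ Y)
  [∀ i, IsOpenImmersion (q i)] (hq : ∀ y, ∃ i, y ∈ Set.range (q i))
include hq

lemma hom_ext_of_openImmersions {f g : Y ⟶ W} (h : ∀ i, q i ≫ f = q i ≫ g) : f = g :=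
  (openCoverOf q hq).hom_ext _ _ h

lemma exists_glueMorphisms (k : ∀ i, Z i ⟶ W)
    (hk : ∀ i j, pullback.fst (q i) (q j) ≫ k i = pullback.snd (q i) (q j) ≫ k j) :
    ∃ f : Y ⟶ W, ∀ i, q i ≫ f = k i :=
  ⟨(openCoverOf q hq).glueMorphisms k hk, fun i ↦ (openCoverOf q hq).ι_glueMorphisms k hk i⟩

end GlueMorphisms

/-! ### Gluing terminal objects from local models -/

section LocalModels

variable {X : Scheme.{u}}

/-- `U ⟶ X` is a chart for the objects of type `Q` over `X`: it is terminal among the morphisms `g`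
satisfying `Q` for which the subset `G g` is everything, and `G g` is open and compatible with
pullback. -/
structure IsLocalModel (Q : ∀ {T : Scheme.{u}}, (T ⟶ X) → Prop)
    (G : ∀ {T : Scheme.{u}}, (T ⟶ X) → Set T) {U : Scheme.{u}} (p : U ⟶ X) : Prop where
  isOpen : ∀ {T : Scheme.{u}} (g : T ⟶ X), Q g → IsOpen (G g)
  preimage : ∀ {S T : Scheme.{u}} (v : S ⟶ T) (g : T ⟶ X), Q g → Q (v ≫ g) →
    G (v ≫ g) = v ⁻¹' G g
  model : Q p
  eq_univ : G p = Set.univ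
  existsUnique_lift : ∀ {T : Scheme.{u}} (g : T ⟶ X), Q g → G g = Set.univ → ∃! h, h ≫ p = g

/-- The property `Q` of schemes over `X` is local. -/
structure IsLocalProperty (Q : ∀ {T : Scheme.{u}}, (T ⟶ X) → Prop) : Prop where
  comp : ∀ {S T : Scheme.{u}} (v : S ⟶ T) [IsOpenImmersion v] (g : T ⟶ X), Q g → Q (v ≫ g)
  of_cover : ∀ {T : Scheme.{u}} (g : T ⟶ X), (∀ x : T, ∃ (S : Scheme.{u}) (v : S ⟶ T),
    IsOpenImmersion v ∧ x ∈ Set.range v ∧ Q (v ≫ g)) → Q g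

variable {Q : ∀ {T : Scheme.{u}}, (T ⟶ X) → Prop}

namespace IsLocalModel

variable {G : ∀ {T : Scheme.{u}}, (T ⟶ X) → Set T} {U : Scheme.{u}} {p : U ⟶ X}
  (h : IsLocalModel Q G p)
include h

/-- A morphism that factors through the model has full `G`-locus, by compatibility with pullback, so
uniqueness of lifts applies to it. -/
lemma ext {T : Scheme.{u}} {a b : T ⟶ U} (hab : a ≫ p = b ≫ p) (hQ : Q (b ≫ p)) : a = b := by
  refine (h.existsUnique_lift (b ≫ p) hQ ?_).unique hab rfl
  rw [h.preimage b p h.model hQ, h.eq_univ, Set.preimage_univ]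

/-- A chart is an open subscheme of every terminal object. -/
lemma exists_isOpenImmersion (hQ : IsLocalProperty Q) {Y : Scheme.{u}} {π : Y ⟶ X} (hπ : Q π)
    (hY : ∀ (T : Scheme.{u}) (g : T ⟶ X), Q g → ∃! h : T ⟶ Y, h ≫ π = g) :
    ∃ l : U ⟶ Y, l ≫ π = p ∧ IsOpenImmersion l ∧ Set.range l = G π := by
  obtain ⟨l, hl, -⟩ := hY U p h.model
  let W : Y.Opens := ⟨G π, h.isOpen π hπ⟩
  have hQW : Q (W.ι ≫ π) := hQ.comp W.ι π hπ
  obtain ⟨k, hk, -⟩ := h.existsUnique_lift (W.ι ≫ π) hQW (by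
    rw [h.preimage W.ι π hπ hQW]
    exact Set.eq_univ_of_forall fun x ↦ x.2)
  have hlW : Set.range l ⊆ Set.range W.ι := by
    rintro _ ⟨x, rfl⟩
    rw [Scheme.Opens.range_ι]
    have : x ∈ l ⁻¹' G π := by
      rw [← h.preimage l π hπ (hl ▸ h.model), hl, h.eq_univ]; trivial
    exact this
  let l' : U ⟶ W := IsOpenImmersion.lift W.ι l hlW
  have hl' : l' ≫ W.ι = l := IsOpenImmersion.lift_fac _ _ _
  -- One composite is the identity by terminality of `Y`, the other by uniqueness of lifts to the
  -- model.
  have h1 : k ≫ l' = 𝟙 _ := by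
    rw [← cancel_mono W.ι, Category.assoc, hl', Category.id_comp]
    refine (hY W (W.ι ≫ π) hQW).unique ?_ rfl
    rw [Category.assoc, hl, hk]
  have h2 : l' ≫ k = 𝟙 _ := by
    refine h.ext ?_ (by rw [Category.id_comp]; exact h.model)
    rw [Category.assoc, hk, ← Category.assoc, hl', hl, Category.id_comp]
  have : IsIso l' := ⟨k, h2, h1⟩
  refine ⟨l, hl, hl' ▸ inferInstance, ?_⟩
  rw [← hl', Scheme.Hom.comp_base, TopCat.coe_comp, Set.range_comp,
    Set.range_eq_univ.mpr l'.surjective, Set.image_univ, Scheme.Opens.range_ι]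
  rfl

end IsLocalModel

/-! ### Transition maps and the glued terminal object -/

section Glue

variable {J : Type u} {G : J → ∀ {T : Scheme.{u}}, (T ⟶ X) → Set T} {U : J → Scheme.{u}}
  {p : ∀ j, U j ⟶ X} (hQ : IsLocalProperty Q) (hG : ∀ j, IsLocalModel Q (G j) (p j))

/-- The locus of the chart `i` contained in the chart `j`. -/
def overlap (hG : ∀ j, IsLocalModel Q (G j) (p j)) (i j : J) : (U i).Opens :=
  ⟨G j (p i), (hG j).isOpen _ (hG i).model⟩

include hQ in
lemma exists_transition (i j : J) :
    ∃ h : (overlap hG i j : Scheme.{u}) ⟶ U j, h ≫ p j = (overlap hG i j).ι ≫ p i := by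
  have h1 : Q ((overlap hG i j).ι ≫ p i) := hQ.comp _ _ (hG i).model
  refine ((hG j).existsUnique_lift _ h1 ?_).exists
  rw [(hG j).preimage _ _ (hG i).model h1]
  exact Set.eq_univ_of_forall fun x ↦ x.2

/-- The transition maps between charts. -/
noncomputable def transition (i j : J) : (overlap hG i j : Scheme.{u}) ⟶ U j :=
  (exists_transition hQ hG i j).choose

lemma transition_comp (i j : J) : transition hQ hG i j ≫ p j = (overlap hG i j).ι ≫ p i :=
  (exists_transition hQ hG i j).choose_spec

/-- The locus `G k` of a morphism depends only on its composite to `X`, so two lifts of that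
composite to different charts see the same locus. -/
lemma range_subset_overlap {T : Scheme.{u}} {i j k : J} (v : T ⟶ U j) (w : T ⟶ U i)
    (hvw : v ≫ p j = w ≫ p i) (hv : Q (v ≫ p j)) (hw : ∀ x, w x ∈ overlap hG i k) :
    Set.range v ⊆ Set.range (overlap hG j k).ι := by
  rw [Scheme.Opens.range_ι]
  rintro _ ⟨x, rfl⟩
  have h1 : v ⁻¹' G k (p j) = w ⁻¹' G k (p i) := by
    rw [← (hG k).preimage _ _ (hG j).model hv, hvw,
      (hG k).preimage _ _ (hG i).model (hvw ▸ hv)]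
  have h2 : x ∈ w ⁻¹' G k (p i) := hw x
  rw [← h1] at h2
  exact h2

lemma range_transition_subset (i j : J) :
    Set.range (transition hQ hG i j) ⊆ Set.range (overlap hG j i).ι := by
  refine range_subset_overlap hG _ (overlap hG i j).ι (transition_comp hQ hG i j) ?_ fun x ↦ ?_
  · rw [transition_comp]; exact hQ.comp _ _ (hG i).model
  · change _ ∈ G i (p i)
    rw [(hG i).eq_univ]; trivial

lemma range_fst_transition_subset (i j k : J) :
    Set.range (pullback.fst (overlap hG i j).ι (overlap hG i k).ι ≫ transition hQ hG i j) ⊆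
      Set.range (overlap hG j k).ι := by
  have e : (pullback.fst (overlap hG i j).ι (overlap hG i k).ι ≫ transition hQ hG i j) ≫ p j =
      (pullback.snd (overlap hG i j).ι (overlap hG i k).ι ≫ (overlap hG i k).ι) ≫ p i := by
    rw [Category.assoc, transition_comp, ← Category.assoc, pullback.condition]
  refine range_subset_overlap hG _ _ e ?_ fun x ↦ ?_
  · rw [e]; exact hQ.comp _ _ (hG i).model
  · rw [Scheme.Hom.comp_apply]
    exact (pullback.snd (overlap hG i j).ι (overlap hG i k).ι x).2

/-- The transition maps between triple overlaps. -/
noncomputable def tripleTransition (i j k : J) :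
    pullback (overlap hG i j).ι (overlap hG i k).ι ⟶
      pullback (overlap hG j k).ι (overlap hG j i).ι :=
  pullback.lift
    (IsOpenImmersion.lift (overlap hG j k).ι (pullback.fst _ _ ≫ transition hQ hG i j)
      (range_fst_transition_subset hQ hG i j k))
    (pullback.fst _ _ ≫ IsOpenImmersion.lift (overlap hG j i).ι (transition hQ hG i j)
      (range_transition_subset hQ hG i j))
    (by rw [IsOpenImmersion.lift_fac, Category.assoc, IsOpenImmersion.lift_fac])

lemma tripleTransition_comp (i j k : J) :
    tripleTransition hQ hG i j k ≫ pullback.fst _ _ ≫ (overlap hG j k).ι ≫ p j =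
      pullback.fst _ _ ≫ (overlap hG i j).ι ≫ p i := by
  rw [tripleTransition, pullback.lift_fst_assoc, IsOpenImmersion.lift_fac_assoc, Category.assoc,
    transition_comp]

/-- The glueing datum given by local models. -/
noncomputable def modelGlueData : Scheme.GlueData.{u} where
  J := J
  U := U
  V := fun ij ↦ overlap hG ij.1 ij.2
  f i j := (overlap hG i j).ι
  f_mono i j := inferInstance
  f_hasPullback i j k := inferInstance
  f_id i := by
    have : overlap hG i i = ⊤ := by
      ext x
      change x ∈ G i (p i) ↔ True
      simp [(hG i).eq_univ]
    have : Surjective (overlap hG i i).ι := ⟨fun x ↦ ⟨⟨x, by rw [this]; trivial⟩, rfl⟩⟩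
    exact (isIso_iff_isOpenImmersion_and_surjective _).mpr ⟨inferInstance, this⟩
  t i j := IsOpenImmersion.lift (overlap hG j i).ι (transition hQ hG i j)
    (range_transition_subset hQ hG i j)
  t_id i := by
    rw [← cancel_mono (overlap hG i i).ι, IsOpenImmersion.lift_fac, Category.id_comp]
    exact (hG i).ext (transition_comp hQ hG i i) (hQ.comp _ _ (hG i).model)
  t' i j k := tripleTransition hQ hG i j k
  t_fac i j k := pullback.lift_snd _ _ _
  cocycle i j k := by
    -- Both sides are lifts to the model `i` of one and the same morphism to `X`, so the cocycle
    -- condition is an instance of uniqueness.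
    rw [← cancel_mono (pullback.fst _ _ ≫ (overlap hG i j).ι)]
    refine (hG i).ext ?_ ?_
    · simp only [Category.assoc, tripleTransition_comp, Category.id_comp]
    · rw [Category.id_comp]
      exact hQ.comp _ _ (hG i).model
  f_open i j := inferInstance

include hQ hG in
lemma exists_glued :
    ∃ (Y : Scheme.{u}) (c : ∀ j, U j ⟶ Y) (π : Y ⟶ X), (∀ j, IsOpenImmersion (c j)) ∧
      (∀ y, ∃ j x, c j x = y) ∧ (∀ j, c j ≫ π = p j) ∧
      ∀ i j, transition hQ hG i j ≫ c j = (overlap hG i j).ι ≫ c i := by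
  let D := modelGlueData hQ hG
  have ht : ∀ i j : J, D.t i j ≫ D.f j i = transition hQ hG i j := fun i j ↦
    IsOpenImmersion.lift_fac (overlap hG j i).ι (transition hQ hG i j)
      (range_transition_subset hQ hG i j)
  refine ⟨D.glued, D.ι, Multicoequalizer.desc D.diagram _ p ?_, fun j ↦ D.ι_isOpenImmersion j,
    D.ι_jointly_surjective, fun j ↦ Multicoequalizer.π_desc _ _ _ _ _, fun i j ↦ ?_⟩
  · rintro ⟨i, j⟩
    change (overlap hG i j).ι ≫ p i = (D.t i j ≫ D.f j i) ≫ p j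
    exact ((congrArg (· ≫ p j) (ht i j)).trans (transition_comp hQ hG i j)).symm
  · exact (congrArg (· ≫ D.ι j) (ht i j)).symm.trans
      ((Category.assoc _ _ _).trans (D.glue_condition i j))

include hQ hG in
-- Each object over `X` is covered by its loci `G j`, on which it lifts uniquely to the models; the
-- lifts then agree on overlaps and glue.
lemma exists_terminal_of_isLocalModel
    (hcov : ∀ {T : Scheme.{u}} (g : T ⟶ X), Q g → ∀ x, ∃ j, x ∈ G j g) :
    ∃ (Y : Scheme.{u}) (π : Y ⟶ X), Q π ∧
      ∀ (T : Scheme.{u}) (g : T ⟶ X), Q g → ∃! h : T ⟶ Y, h ≫ π = g := by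
  obtain ⟨Y, c, π, hc, hsurj, hπ, hglue⟩ := exists_glued hQ hG
  have hQπ : Q π := by
    refine hQ.of_cover π fun y ↦ ?_
    obtain ⟨i, x, hx⟩ := hsurj y
    exact ⟨_, c i, inferInstance, ⟨x, hx⟩, by rw [hπ]; exact (hG i).model⟩
  have hpre : ∀ i j, c j ⁻¹' G i π = G i (p j) := fun i j ↦ by
    rw [← (hG i).preimage (c j) π hQπ (by rw [hπ]; exact (hG j).model), hπ j]
  have hrange : ∀ i, G i π ⊆ Set.range (c i) := by
    intro i y hy
    obtain ⟨j, x, rfl⟩ := hsurj y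
    have hx : x ∈ overlap hG j i := by
      have : x ∈ c j ⁻¹' G i π := hy
      rw [hpre] at this
      exact this
    obtain ⟨z, rfl⟩ : ∃ z, (overlap hG j i).ι z = x := ⟨⟨x, hx⟩, rfl⟩
    exact ⟨transition hQ hG j i z, by
      rw [← Scheme.Hom.comp_apply, hglue, Scheme.Hom.comp_apply]⟩
  -- Over the locus `G i` both morphisms land in the open chart `U i` of `Y`, where lifts are
  -- unique.
  have huniq : ∀ (T : Scheme.{u}) (a b : T ⟶ Y), a ≫ π = b ≫ π → Q (b ≫ π) → a = b := by
    intro T a b hab hb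
    let V : J → T.Opens := fun i ↦ ⟨G i (b ≫ π), (hG i).isOpen _ hb⟩
    have hV : ∀ x, ∃ i, x ∈ Set.range (V i).ι := fun x ↦ by
      obtain ⟨i, hi⟩ := hcov (b ≫ π) hb x
      exact ⟨i, by rw [Scheme.Opens.range_ι]; exact hi⟩
    refine hom_ext_of_openImmersions (fun i ↦ (V i).ι) hV fun i ↦ ?_
    have ha' : Set.range ((V i).ι ≫ a) ⊆ Set.range (c i) := by
      rintro _ ⟨x, rfl⟩
      have : (V i).ι x ∈ G i (a ≫ π) := by rw [hab]; exact x.2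
      rw [(hG i).preimage _ _ hQπ (hab ▸ hb)] at this
      exact hrange i this
    have hb' : Set.range ((V i).ι ≫ b) ⊆ Set.range (c i) := by
      rintro _ ⟨x, rfl⟩
      have : (V i).ι x ∈ G i (b ≫ π) := x.2
      rw [(hG i).preimage _ _ hQπ hb] at this
      exact hrange i this
    rw [← IsOpenImmersion.lift_fac (c i) _ ha', ← IsOpenImmersion.lift_fac (c i) _ hb']
    congr 1
    refine (hG i).ext ?_ ?_
    · rw [← hπ, IsOpenImmersion.lift_fac_assoc, IsOpenImmersion.lift_fac_assoc, Category.assoc,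
        Category.assoc, hab]
    · rw [← hπ, IsOpenImmersion.lift_fac_assoc, Category.assoc]
      exact hQ.comp _ _ hb
  refine ⟨Y, π, hQπ, fun T g hg ↦ ?_⟩
  let V : J → T.Opens := fun i ↦ ⟨G i g, (hG i).isOpen _ hg⟩
  have hV : ∀ x, ∃ i, x ∈ Set.range (V i).ι := fun x ↦ by
    obtain ⟨i, hi⟩ := hcov g hg x
    exact ⟨i, by rw [Scheme.Opens.range_ι]; exact hi⟩
  have hlift : ∀ i, ∃ h : (V i : Scheme.{u}) ⟶ U i, h ≫ p i = (V i).ι ≫ g := fun i ↦ by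
    have h1 : Q ((V i).ι ≫ g) := hQ.comp _ _ hg
    refine ((hG i).existsUnique_lift _ h1 ?_).exists
    rw [(hG i).preimage _ _ hg h1]
    exact Set.eq_univ_of_forall fun x ↦ x.2
  choose k hk using hlift
  have hcompat : ∀ i j : J, pullback.fst (V i).ι (V j).ι ≫ k i ≫ c i =
      pullback.snd (V i).ι (V j).ι ≫ k j ≫ c j := by
    intro i j
    have e : ∀ i, (k i ≫ c i) ≫ π = (V i).ι ≫ g := fun i ↦ by rw [Category.assoc, hπ, hk]
    refine huniq _ _ _ ?_ ?_
    · rw [Category.assoc, e, Category.assoc, e, pullback.condition_assoc]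
    · rw [Category.assoc, e, ← Category.assoc]
      exact hQ.comp _ _ hg
  obtain ⟨f, hf⟩ := exists_glueMorphisms (fun i ↦ (V i).ι) hV (fun i ↦ k i ≫ c i) hcompat
  have hfac : f ≫ π = g := by
    refine hom_ext_of_openImmersions (fun i ↦ (V i).ι) hV fun i ↦ ?_
    rw [← Category.assoc, hf, Category.assoc, hπ, hk]
  exact ⟨f, hfac, fun h hh ↦ huniq _ _ _ (hh.trans hfac.symm) (hfac.symm ▸ hg)⟩

end Glue

end LocalModels


/-! ### Charts of blow-ups -/

section Charts

variable {X : Scheme.{u}}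

lemma map_mem_nonZeroDivisors_of_flat {R S : Type*} [CommRing R] [CommRing S] {φ : R →+* S}
    (hφ : φ.Flat) {r : R} (hr : r ∈ nonZeroDivisors R) : φ r ∈ nonZeroDivisors S := by
  algebraize [φ]
  have h1 : IsSMulRegular R r := by
    intro x y hxy
    have : (x - y) * r = 0 := by
      have : r * x = r * y := hxy
      linear_combination this
    exact sub_eq_zero.mp ((mem_nonZeroDivisors_iff_right.mp hr) _ this)
  have h2 : IsSMulRegular S (φ r) := h1.of_flat
  rw [mem_nonZeroDivisors_iff_right]
  intro x hx
  refine h2 ?_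
  simp only [smul_zero]
  rw [smul_eq_mul, mul_comm]
  exact hx

lemma restrict_mem_nonZeroDivisors {V V' : X.Opens} (hV : IsAffineOpen V) (hV' : IsAffineOpen V')
    (h : V' ≤ V) {r : Γ(X, V)} (hr : r ∈ nonZeroDivisors Γ(X, V)) :
    (X.presheaf.map (homOfLE h).op).hom r ∈ nonZeroDivisors Γ(X, V') := by
  refine map_mem_nonZeroDivisors_of_flat ?_ hr
  have := (𝟙 X : X ⟶ X).flat_appLE hV hV' h
  have e : (𝟙 X : X ⟶ X).appLE V V' h = X.presheaf.map (homOfLE h).op := by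
    simp only [Scheme.Hom.appLE, Scheme.Hom.id_app]
    exact Category.id_comp _
  rwa [e] at this

/-- Open immersions are flat, so a regular local generator stays regular. -/
lemma isInvertible_comap {Y : Scheme.{u}} (v : Y ⟶ X) [IsOpenImmersion v] {J : X.IdealSheafData}
    (hJ : IsInvertible J) : IsInvertible (J.comap v) := by
  intro y
  obtain ⟨U, hy, a, ha, hJ⟩ := hJ (v y)
  obtain ⟨_, ⟨V, hV, rfl⟩, hyV, hVU⟩ := Y.isBasis_affineOpens.exists_subset_of_mem_open
    (show y ∈ v ⁻¹ᵁ U.1 from hy) (v ⁻¹ᵁ U.1).isOpen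
  refine ⟨⟨V, hV⟩, hyV, (v.appLE U.1 V hVU).hom a, ?_, ?_⟩
  · exact map_mem_nonZeroDivisors_of_flat (v.flat_appLE U.2 hV hVU) ha
  · rw [ideal_comap_eq_map v J U.2 hV hVU, hJ, Ideal.map_span, Set.image_singleton]

lemma isInvertible_of_cover {J : X.IdealSheafData} (h : ∀ x : X, ∃ (S : Scheme.{u}) (v : S ⟶ X),
    IsOpenImmersion v ∧ x ∈ Set.range v ∧ IsInvertible (J.comap v)) : IsInvertible J := by
  intro x
  obtain ⟨S, v, hv, ⟨y, rfl⟩, hS⟩ := h x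
  obtain ⟨U, hy, a, ha, hU⟩ := hS y
  rw [Scheme.IdealSheafData.ideal_comap_of_isOpenImmersion] at hU
  refine ⟨⟨v ''ᵁ U.1, U.2.image_of_isOpenImmersion v⟩, ⟨y, hy, rfl⟩,
    (v.appIso U.1).inv.hom a, ?_, ?_⟩
  · exact map_mem_nonZeroDivisors_of_flat
      (RingHom.Flat.of_bijective (ConcreteCategory.bijective_of_isIso (v.appIso U.1).inv)) ha
  · rw [← Set.image_singleton, ← Ideal.map_span, ← hU, Ideal.map_comap_of_surjective]
    exact (ConcreteCategory.bijective_of_isIso (v.appIso U.1).inv).2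

/-- At `x`, the inverse image of the ideal sheaf `I` is generated by the nonzerodivisor `a`. -/
def GenAt (I : X.IdealSheafData) {W : X.Opens} (hW : IsAffineOpen W) (a : Γ(X, W))
    {T : Scheme.{u}} (g : T ⟶ X) (x : T) : Prop :=
  ∃ (V : T.Opens) (_ : IsAffineOpen V) (h : V ≤ g ⁻¹ᵁ W), x ∈ V ∧
    (g.appLE W V h).hom a ∈ nonZeroDivisors Γ(T, V) ∧
    (I.ideal ⟨W, hW⟩).map (g.appLE W V h).hom = Ideal.span {(g.appLE W V h).hom a}

variable {I : X.IdealSheafData} {W : X.Opens} {hW : IsAffineOpen W} {a : Γ(X, W)}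
  {T : Scheme.{u}} {g : T ⟶ X}

lemma exists_affine_le {U : T.Opens} {x : T} (hx : x ∈ U) :
    ∃ V : T.Opens, IsAffineOpen V ∧ x ∈ V ∧ V ≤ U := by
  obtain ⟨_, ⟨V, hV, rfl⟩, hxV, hVU⟩ := T.isBasis_affineOpens.exists_subset_of_mem_open
    hx U.isOpen
  exact ⟨V, hV, hxV, hVU⟩

lemma restrict_gen {V V' : T.Opens} (hV : IsAffineOpen V) (hV' : IsAffineOpen V')
    (h : V ≤ g ⁻¹ᵁ W) (h' : V' ≤ V)
    (ha : (g.appLE W V h).hom a ∈ nonZeroDivisors Γ(T, V))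
    (hI : (I.ideal ⟨W, hW⟩).map (g.appLE W V h).hom = Ideal.span {(g.appLE W V h).hom a}) :
    (g.appLE W V' (h'.trans h)).hom a ∈ nonZeroDivisors Γ(T, V') ∧
    (I.ideal ⟨W, hW⟩).map (g.appLE W V' (h'.trans h)).hom =
      Ideal.span {(g.appLE W V' (h'.trans h)).hom a} := by
  have e : g.appLE W V' (h'.trans h) = g.appLE W V h ≫ T.presheaf.map (homOfLE h').op := by
    rw [Scheme.Hom.appLE_map]
  rw [e]
  refine ⟨restrict_mem_nonZeroDivisors hV hV' h' ha, ?_⟩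
  rw [CommRingCat.hom_comp, ← Ideal.map_map, hI, Ideal.map_span, Set.image_singleton]
  rfl

/-- One can find the data of `GenAt` inside any open neighbourhood. -/
lemma GenAt.exists_le {x : T} (hx : GenAt I hW a g x) {U : T.Opens} (hU : x ∈ U) :
    ∃ (V : T.Opens) (_ : IsAffineOpen V) (h : V ≤ g ⁻¹ᵁ W), V ≤ U ∧ x ∈ V ∧
    (g.appLE W V h).hom a ∈ nonZeroDivisors Γ(T, V) ∧
    (I.ideal ⟨W, hW⟩).map (g.appLE W V h).hom = Ideal.span {(g.appLE W V h).hom a} := by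
  obtain ⟨V, hV, h, hxV, h1, h2⟩ := hx
  obtain ⟨V', hV', hxV', hle⟩ := exists_affine_le (show x ∈ V ⊓ U from ⟨hxV, hU⟩)
  exact ⟨V', hV', _, hle.trans inf_le_right, hxV',
    restrict_gen hV hV' h (hle.trans inf_le_left) h1 h2⟩

/-- With `u` a regular local generator of the inverse image ideal, `s i` pulls back to `d i * u`.
Cancelling `u` shows that the `d i` generate the unit ideal, so one of them is invertible near `x`,
and there `s i` generates. -/
lemma exists_genAt (hg : IsInvertible (I.comap g)) {ι : Type*} {s : ι → Γ(X, W)}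
    (hs : Ideal.span (Set.range s) = I.ideal ⟨W, hW⟩) {x : T} (hx : g x ∈ W) :
    ∃ i, GenAt I hW (s i) g x := by
  obtain ⟨V₀, hxV₀, u₀, hu₀, hV₀⟩ := hg x
  obtain ⟨V, hV, hxV, hle⟩ := exists_affine_le (show x ∈ V₀.1 ⊓ g ⁻¹ᵁ W from ⟨hxV₀, hx⟩)
  have hVW := hle.trans inf_le_right
  have hVV := hle.trans inf_le_left
  set φ := (g.appLE W V hVW).hom with hφ
  let u := (T.presheaf.map (homOfLE hVV).op).hom u₀
  have hu : u ∈ nonZeroDivisors Γ(T, V) := restrict_mem_nonZeroDivisors V₀.2 hV hVV hu₀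
  have hIu : (I.ideal ⟨W, hW⟩).map φ = Ideal.span {u} := by
    rw [hφ, ← ideal_comap_eq_map g I hW hV hVW,
      ← (I.comap g).map_ideal (U := ⟨V, hV⟩) (V := V₀) hVV, hV₀, Ideal.map_span,
      Set.image_singleton]
    rfl
  have hd : ∀ i, ∃ d, d * u = φ (s i) := fun i ↦ by
    rw [← Ideal.mem_span_singleton', ← hIu]
    exact Ideal.mem_map_of_mem _ (hs ▸ Ideal.subset_span ⟨i, rfl⟩)
  choose d hd using hd
  have htop : Ideal.span (Set.range d) = ⊤ := by
    have h1 : u ∈ Ideal.span (Set.range fun i ↦ φ (s i)) := by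
      have : u ∈ (I.ideal ⟨W, hW⟩).map φ := hIu ▸ Ideal.mem_span_singleton_self u
      rw [← hs, Ideal.map_span, ← Set.range_comp] at this
      exact this
    have h2 : Ideal.span (Set.range fun i ↦ φ (s i)) = Ideal.span (Set.range d) * Ideal.span {u} := by
      rw [Ideal.span_mul_span', Set.mul_singleton, ← Set.range_comp]
      congr 2
      exact funext fun i ↦ (hd i).symm
    rw [h2, Ideal.mem_mul_span_singleton] at h1
    obtain ⟨z, hz, hzu⟩ := h1
    have : (z - 1) * u = 0 := by linear_combination hzu
    rw [sub_eq_zero.mp ((mem_nonZeroDivisors_iff_right.mp hu) _ this)] at hz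
    exact (Ideal.eq_top_iff_one _).mpr hz
  obtain ⟨i, hi⟩ : ∃ i, x ∈ T.basicOpen (d i) := by
    by_contra! hcon
    have : Ideal.span (Set.range d) ≤
        (IsLocalRing.maximalIdeal (T.presheaf.stalk x)).comap (T.presheaf.germ V x hxV).hom := by
      rw [Ideal.span_le]
      rintro _ ⟨i, rfl⟩
      have := hcon i
      rw [Scheme.mem_basicOpen' _ _ ⟨x, hxV⟩] at this
      exact this
    rw [htop, top_le_iff, Ideal.comap_eq_top_iff] at this
    exact Ideal.IsPrime.ne_top' this
  have hle' : T.basicOpen (d i) ≤ V := T.basicOpen_le _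
  refine ⟨i, T.basicOpen (d i), hV.basicOpen _, hle'.trans hVW, hi, ?_⟩
  have e : g.appLE W (T.basicOpen (d i)) (hle'.trans hVW) =
      g.appLE W V hVW ≫ T.presheaf.map (homOfLE hle').op := by
    rw [Scheme.Hom.appLE_map]
  set ρ := (T.presheaf.map (homOfLE hle').op).hom with hρ
  have hunit : IsUnit (ρ (d i)) := T.toRingedSpace.isUnit_res_basicOpen _
  have h1 : (g.appLE W (T.basicOpen (d i)) (hle'.trans hVW)).hom (s i) = ρ (d i) * ρ u := by
    rw [e, ← map_mul, hd]; rfl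
  rw [h1]
  refine ⟨mul_mem hunit.mem_nonZeroDivisors
    (restrict_mem_nonZeroDivisors hV (hV.basicOpen _) hle' hu), ?_⟩
  rw [Ideal.span_singleton_mul_left_unit hunit, e, CommRingCat.hom_comp, ← Ideal.map_map]
  change ((I.ideal ⟨W, hW⟩).map φ).map ρ = _
  rw [hIu, Ideal.map_span, Set.image_singleton]

lemma isInvertible_of_genAt (h : ∀ x, GenAt I hW a g x) : IsInvertible (I.comap g) := by
  intro x
  obtain ⟨V, hV, h, hxV, h1, h2⟩ := h x
  exact ⟨⟨V, hV⟩, hxV, _, h1, (ideal_comap_eq_map g I hW hV h).trans h2⟩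

/-- As `v` need not be flat, regularity does not simply pull back. In both directions `a` is
compared with a regular generator `a'` supplied by invertibility: `a = c * a'`, and `c` is a unit
because each of `a`, `a'` is upstairs a multiple of the other. For the forward direction, `c` being
a unit upstairs means that `c` does not vanish at `v x`. -/
lemma genAt_comp_iff {S : Scheme.{u}} (v : S ⟶ T) (hg : IsInvertible (I.comap g))
    (hvg : IsInvertible (I.comap (v ≫ g))) (x : S) (ha : a ∈ I.ideal ⟨W, hW⟩) :
    GenAt I hW a (v ≫ g) x ↔ GenAt I hW a g (v x) := by
  have hs : Ideal.span (Set.range (Subtype.val : I.ideal ⟨W, hW⟩ → _)) = I.ideal ⟨W, hW⟩ := by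
    rw [Subtype.range_coe]; exact Ideal.span_eq _
  have ecomp : ∀ {V : T.Opens} {V' : S.Opens} (h : V ≤ g ⁻¹ᵁ W) (h' : V' ≤ v ⁻¹ᵁ V)
      (h'' : V' ≤ (v ≫ g) ⁻¹ᵁ W), (v ≫ g).appLE W V' h'' = g.appLE W V h ≫ v.appLE V V' h' :=
    fun h h' h'' ↦ (Scheme.Hom.appLE_comp_appLE _ _ _ _ _ _ _).symm
  refine ⟨fun hx ↦ ?_, fun hx ↦ ?_⟩
  · obtain ⟨V'₀, hV'₀, h'₀, hxV'₀, -, -⟩ := id hx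
    obtain ⟨⟨a', ha'⟩, V, hV, h, hxV, h1, h2⟩ := exists_genAt hg hs (x := v x) (h'₀ hxV'₀)
    obtain ⟨V', hV', h', hle, hxV', h1', h2'⟩ := hx.exists_le (show x ∈ v ⁻¹ᵁ V from hxV)
    obtain ⟨c, hc⟩ : ∃ c, c * (g.appLE W V h).hom a' = (g.appLE W V h).hom a := by
      rw [← Ideal.mem_span_singleton', ← h2]
      exact Ideal.mem_map_of_mem _ ha
    obtain ⟨d, hd⟩ : ∃ d, d * ((v ≫ g).appLE W V' h').hom a = ((v ≫ g).appLE W V' h').hom a' := by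
      rw [← Ideal.mem_span_singleton', ← h2']
      exact Ideal.mem_map_of_mem _ ha'
    have h3 : ((v ≫ g).appLE W V' h').hom a =
        (v.appLE V V' hle).hom c * ((v ≫ g).appLE W V' h').hom a' := by
      rw [ecomp h hle h']
      exact (congrArg (v.appLE V V' hle).hom hc).symm.trans (map_mul _ _ _)
    have h4 : ((v.appLE V V' hle).hom c * d - 1) * ((v ≫ g).appLE W V' h').hom a = 0 := by
      linear_combination (v.appLE V V' hle).hom c * hd - h3
    have hunit : IsUnit ((v.appLE V V' hle).hom c) :=
      .of_mul_eq_one d (sub_eq_zero.mp ((mem_nonZeroDivisors_iff_right.mp h1') _ h4))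
    have hmem : v x ∈ T.basicOpen c := by
      have h5 : S.basicOpen ((v.appLE V V' hle).hom c) = V' := S.basicOpen_of_isUnit hunit
      have h6 : S.basicOpen ((v.appLE V V' hle).hom c) ≤ v ⁻¹ᵁ T.basicOpen c := by
        rw [Scheme.preimage_basicOpen]
        exact (S.basicOpen_res _ _).trans_le inf_le_right
      exact h6 (h5.ge hxV')
    have hle' : T.basicOpen c ≤ V := T.basicOpen_le _
    have hcu : IsUnit ((T.presheaf.map (homOfLE hle').op).hom c) :=
      T.toRingedSpace.isUnit_res_basicOpen _
    have e : g.appLE W (T.basicOpen c) (hle'.trans h) =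
        g.appLE W V h ≫ T.presheaf.map (homOfLE hle').op := by
      rw [Scheme.Hom.appLE_map]
    have h5 : (g.appLE W (T.basicOpen c) (hle'.trans h)).hom a =
        (T.presheaf.map (homOfLE hle').op).hom c *
          (g.appLE W (T.basicOpen c) (hle'.trans h)).hom a' := by
      rw [e]
      exact (congrArg (T.presheaf.map (homOfLE hle').op).hom hc).symm.trans (map_mul _ _ _)
    obtain ⟨h6, h7⟩ := restrict_gen hV (hV.basicOpen c) h hle' h1 h2
    refine ⟨T.basicOpen c, hV.basicOpen c, hle'.trans h, hmem, ?_, ?_⟩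
    · rw [h5]; exact mul_mem hcu.mem_nonZeroDivisors h6
    · rw [h5, Ideal.span_singleton_mul_left_unit hcu, h7]
  · obtain ⟨V, hV, h, hxV, h1, h2⟩ := hx
    obtain ⟨⟨a', ha'⟩, hx'⟩ := exists_genAt hvg hs (x := x) (h hxV)
    obtain ⟨V', hV', h', hle, hxV', h1', h2'⟩ := hx'.exists_le (show x ∈ v ⁻¹ᵁ V from hxV)
    have h3 : (I.ideal ⟨W, hW⟩).map ((v ≫ g).appLE W V' h').hom =
        Ideal.span {((v ≫ g).appLE W V' h').hom a} := by
      rw [ecomp h hle h', CommRingCat.hom_comp, ← Ideal.map_map, h2, Ideal.map_span,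
        Set.image_singleton]
      rfl
    refine ⟨V', hV', h', hxV', ?_, h3⟩
    obtain ⟨c, hc⟩ : ∃ c, c * ((v ≫ g).appLE W V' h').hom a' = ((v ≫ g).appLE W V' h').hom a := by
      rw [← Ideal.mem_span_singleton', ← h2']
      exact Ideal.mem_map_of_mem _ ha
    obtain ⟨d, hd⟩ : ∃ d, d * ((v ≫ g).appLE W V' h').hom a = ((v ≫ g).appLE W V' h').hom a' := by
      rw [← Ideal.mem_span_singleton', ← h3]
      exact Ideal.mem_map_of_mem _ ha'
    have h4 : (d * c - 1) * ((v ≫ g).appLE W V' h').hom a' = 0 := by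
      linear_combination d * hc + hd
    have hunit : IsUnit c := .of_mul_eq_one_right d
      (sub_eq_zero.mp ((mem_nonZeroDivisors_iff_right.mp h1') _ h4))
    rw [← hc]
    exact mul_mem hunit.mem_nonZeroDivisors h1'

lemma isOpen_setOf_genAt : IsOpen {x | GenAt I hW a g x} := by
  rw [isOpen_iff_forall_mem_open]
  rintro x ⟨V, hV, h, hxV, h1, h2⟩
  exact ⟨V, fun y hy ↦ ⟨V, hV, h, hy, h1, h2⟩, V.isOpen, hxV⟩

lemma appLE_SpecMap_comp_fromSpec (hW : IsAffineOpen W) {B : CommRingCat.{u}} (φ : Γ(X, W) ⟶ B)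
    (h : ⊤ ≤ (Spec.map φ ≫ hW.fromSpec) ⁻¹ᵁ W) :
    (Spec.map φ ≫ hW.fromSpec).appLE W ⊤ h = φ ≫ (Scheme.ΓSpecIso B).inv := by
  rw [Iso.eq_comp_inv]
  apply Spec.map_injective
  rw [← cancel_mono hW.fromSpec]
  exact SpecMap_appLE_ΓSpecIso_fromSpec _ hW h

variable {B : CommRingCat.{u}} {ι : Type*} {s : ι → Γ(X, W)} {i : ι} {φ : Γ(X, W) ⟶ B}
  {c : ι → B}

lemma genAt_chart (hs : Ideal.span (Set.range s) = I.ideal ⟨W, hW⟩)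
    (h : IsAffineBlowUp φ.hom s i c) (x : Spec B) :
    GenAt I hW (s i) (Spec.map φ ≫ hW.fromSpec) x := by
  have htop : ⊤ ≤ (Spec.map φ ≫ hW.fromSpec) ⁻¹ᵁ W := by
    simp
  have hbij := ConcreteCategory.bijective_of_isIso (Scheme.ΓSpecIso B).inv
  refine ⟨⊤, isAffineOpen_top _, htop, trivial, ?_, ?_⟩
  · rw [appLE_SpecMap_comp_fromSpec]
    exact map_mem_nonZeroDivisors_of_flat (RingHom.Flat.of_bijective hbij) h.mem_nonZeroDivisors
  · rw [appLE_SpecMap_comp_fromSpec, CommRingCat.hom_comp, ← Ideal.map_map, ← hs, h.map_span_eq,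
      Ideal.map_span, Set.image_singleton]
    rfl

/-- Where `s i` is a regular generator of the inverse image ideal, each `s j` is a multiple of it,
so the universal property of the affine blow-up algebra gives a unique map; the maps on affine
pieces of `T` glue by uniqueness. -/
lemma isLocalModel_chart (hs : Ideal.span (Set.range s) = I.ideal ⟨W, hW⟩)
    (h : IsAffineBlowUp φ.hom s i c) :
    IsLocalModel (fun {T : Scheme.{u}} (g : T ⟶ X) ↦ IsInvertible (I.comap g))
      (fun {T : Scheme.{u}} (g : T ⟶ X) ↦ {x | GenAt I hW (s i) g x})
      (Spec.map φ ≫ hW.fromSpec) := by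
  have hsi : s i ∈ I.ideal ⟨W, hW⟩ := hs ▸ Ideal.subset_span ⟨i, rfl⟩
  have huniq : ∀ {T : Scheme.{u}} (a b : T ⟶ Spec B), a ≫ Spec.map φ ≫ hW.fromSpec =
      b ≫ Spec.map φ ≫ hW.fromSpec →
      (∀ x, GenAt I hW (s i) (b ≫ Spec.map φ ≫ hW.fromSpec) x) → a = b := by
    intro T a b hab hgen
    choose V hV hVW hxV hnzd _ using hgen
    refine hom_ext_of_openImmersions (fun x ↦ (hV x).fromSpec) (fun x ↦ ⟨x, ?_⟩) fun x ↦ ?_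
    · rw [IsAffineOpen.range_fromSpec]; exact hxV x
    obtain ⟨α, hα⟩ := Spec.map_surjective ((hV x).fromSpec ≫ a)
    obtain ⟨β, hβ⟩ := Spec.map_surjective ((hV x).fromSpec ≫ b)
    rw [← hα, ← hβ]
    congr 1
    have e : φ ≫ β = (b ≫ Spec.map φ ≫ hW.fromSpec).appLE W (V x) (hVW x) := by
      apply Spec.map_injective
      rw [← cancel_mono hW.fromSpec, IsAffineOpen.SpecMap_appLE_fromSpec _ hW (hV x), Spec.map_comp,
        hβ, Category.assoc, Category.assoc]
    have e' : φ ≫ α = φ ≫ β := by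
      apply Spec.map_injective
      rw [← cancel_mono hW.fromSpec, Spec.map_comp, Spec.map_comp, hα, hβ]
      simp only [Category.assoc, hab]
    apply CommRingCat.hom_ext
    refine h.ringHom_ext ?_ ?_
    · rw [← CommRingCat.hom_comp, ← CommRingCat.hom_comp, e']
    · rw [← RingHom.comp_apply, ← CommRingCat.hom_comp, e', e]
      exact hnzd x
  refine ⟨fun _ _ ↦ isOpen_setOf_genAt, fun v g hg hvg ↦ ?_, isInvertible_of_genAt
    (genAt_chart hs h), Set.eq_univ_of_forall (genAt_chart hs h), fun {T} g hg hgen ↦ ?_⟩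
  · ext x
    exact genAt_comp_iff v hg hvg x hsi
  have hgen' : ∀ x, GenAt I hW (s i) g x := fun x ↦ Set.eq_univ_iff_forall.mp hgen x
  have hpull : ∀ {S : Scheme.{u}} (v : S ⟶ T) [IsOpenImmersion v] (x : S),
      GenAt I hW (s i) (v ≫ g) x := fun v _ x ↦
    (genAt_comp_iff v hg (by rw [Scheme.IdealSheafData.comap_comp]; exact isInvertible_comap v hg)
      x hsi).mpr (hgen' _)
  choose V hV hVW hxV hnzd hI using hgen'
  have hlift : ∀ x, ∃ f : B ⟶ Γ(T, V x), φ ≫ f = g.appLE W (V x) (hVW x) := by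
    intro x
    obtain ⟨f, hf⟩ := h.exists_lift (g.appLE W (V x) (hVW x)).hom (hnzd x) fun j ↦ by
      have : (g.appLE W (V x) (hVW x)).hom (s j) ∈
          Ideal.span {(g.appLE W (V x) (hVW x)).hom (s i)} := by
        rw [← hI x]
        exact Ideal.mem_map_of_mem _ (hs ▸ Ideal.subset_span ⟨j, rfl⟩)
      obtain ⟨d, hd⟩ := Ideal.mem_span_singleton'.mp this
      exact ⟨d, hd.symm⟩
    exact ⟨CommRingCat.ofHom f, CommRingCat.hom_ext hf⟩
  choose f hf using hlift
  have hV' : ∀ y, ∃ x, y ∈ Set.range (hV x).fromSpec := fun x ↦ ⟨x, by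
    rw [IsAffineOpen.range_fromSpec]; exact hxV x⟩
  have e : ∀ x, Spec.map (f x) ≫ Spec.map φ ≫ hW.fromSpec = (hV x).fromSpec ≫ g := fun x ↦ by
    rw [← Spec.map_comp_assoc, hf, IsAffineOpen.SpecMap_appLE_fromSpec]
  obtain ⟨k, hk⟩ := exists_glueMorphisms (fun x ↦ (hV x).fromSpec) hV' (fun x ↦ Spec.map (f x))
    fun x y ↦ by
      have h1 := pullback.condition (f := (hV x).fromSpec) (g := (hV y).fromSpec)
      refine huniq _ _ ?_ ?_
      · rw [Category.assoc, Category.assoc, e, e, reassoc_of% h1]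
      · rw [Category.assoc, e, ← Category.assoc]
        exact hpull _
  have hkg : k ≫ Spec.map φ ≫ hW.fromSpec = g := by
    refine hom_ext_of_openImmersions (fun x ↦ (hV x).fromSpec) hV' fun x ↦ ?_
    rw [← Category.assoc, hk, e]
  refine ⟨k, hkg, fun k' hk' ↦ huniq _ _ (hk'.trans hkg.symm) fun x ↦ ?_⟩
  rw [hkg]
  simpa using hpull (𝟙 T) x

lemma isLocalProperty_isInvertible (I : X.IdealSheafData) :
    IsLocalProperty (fun {T : Scheme.{u}} (g : T ⟶ X) ↦ IsInvertible (I.comap g)) where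
  comp v _ g hg := by
    rw [Scheme.IdealSheafData.comap_comp]
    exact isInvertible_comap v hg
  of_cover g h := isInvertible_of_cover fun x ↦ by
    obtain ⟨S, v, hv, hx, hS⟩ := h x
    exact ⟨S, v, hv, hx, by rwa [← Scheme.IdealSheafData.comap_comp]⟩

lemma span_range_subtypeVal {R : Type*} [CommRing R] (J : Ideal R) :
    Ideal.span (Set.range (Subtype.val : J → R)) = J := by
  rw [Subtype.range_coe]
  exact Ideal.span_eq J

/-- Blow-ups exist. -/
theorem exists_isBlowUp (I : X.IdealSheafData) :
    ∃ (Y : Scheme.{u}) (π : Y ⟶ X), IsBlowUp π I := by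
  -- The models are indexed by all sections of `I` over all affine opens, so `I` need not be
  -- finitely generated.
  choose B φ c h using fun j : Σ W : X.affineOpens, I.ideal W ↦
    exists_isAffineBlowUp (Subtype.val : I.ideal j.1 → Γ(X, j.1.1)) j.2
  obtain ⟨Y, π, h1, h2⟩ := exists_terminal_of_isLocalModel (isLocalProperty_isInvertible I)
    (fun j : Σ W : X.affineOpens, I.ideal W ↦ isLocalModel_chart (hW := j.1.2) (s := Subtype.val)
      (φ := CommRingCat.ofHom (φ j)) (span_range_subtypeVal (I.ideal j.1)) (h j)) fun g hg x ↦ by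
    obtain ⟨W, hW, hxW, -⟩ := exists_affine_le (show g x ∈ (⊤ : X.Opens) from trivial)
    obtain ⟨a, ha⟩ := exists_genAt hg (span_range_subtypeVal (I.ideal ⟨W, hW⟩)) hxW
    exact ⟨⟨⟨W, hW⟩, a⟩, ha⟩
  exact ⟨Y, π, h1, h2⟩

/-- The affine blow-up algebras give charts of every blow-up. -/
lemma IsBlowUp.exists_chart {Y : Scheme.{u}} {π : Y ⟶ X} (hπ : IsBlowUp π I)
    (hs : Ideal.span (Set.range s) = I.ideal ⟨W, hW⟩) (h : IsAffineBlowUp φ.hom s i c) :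
    ∃ l : Spec B ⟶ Y, l ≫ π = Spec.map φ ≫ hW.fromSpec ∧ IsOpenImmersion l ∧
      Set.range l = {y | GenAt I hW (s i) π y} :=
  (isLocalModel_chart hs h).exists_isOpenImmersion (isLocalProperty_isInvertible I) hπ.invertible
    hπ.existsUnique_lift

lemma IsBlowUp.hom_ext {Y : Scheme.{u}} {π : Y ⟶ X} (hπ : IsBlowUp π I) {T : Scheme.{u}}
    {a b : T ⟶ Y} (h : a ≫ π = b ≫ π) (hb : IsInvertible (I.comap (b ≫ π))) : a = b :=
  (hπ.existsUnique_lift T _ hb).unique h rfl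

end Charts


/-! ### Charts of projective space -/

section Projective

open MvPolynomial

lemma eval₂_mul_of_isHomogeneous {ι A B : Type*} [CommRing A] [CommRing B] (ρ : A →+* B)
    (c : ι → B) (v : B) {d : ℕ} {Q : MvPolynomial ι A} (hQ : Q.IsHomogeneous d) :
    eval₂ ρ (fun j ↦ c j * v) Q = eval₂ ρ c Q * v ^ d := by
  have := eval₂_mul_pow_of_isHomogeneous (RingHom.id B) (s := fun j ↦ c j * v) (c := c) (u := v)
    (fun j ↦ rfl) (hQ.map ρ)
  rwa [RingHom.id_apply, MvPolynomial.eval_map, eval₂_map, RingHom.id_comp] at this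

/-- Lift the coordinates arbitrarily through the thickening, keeping the `i`-th equal to `1`. A
polynomial that vanishes at `c` has zero homogenisation and hence vanishes at the lifted
coordinates, so there is no obstruction. -/
lemma IsStandardChart.formallySmooth {ι κ C : Type*} [CommRing κ] [CommRing C] [Algebra κ C]
    {i : ι} {c : ι → C} (h : IsStandardChart (algebraMap κ C) i c) :
    Algebra.FormallySmooth κ C := by
  classical
  refine Algebra.FormallySmooth.of_comp_surjective fun B _ _ I hI f ↦ ?_
  have hlift : ∀ j, ∃ b : B, Ideal.Quotient.mk I b = f (c j) := fun j ↦
    Ideal.Quotient.mk_surjective _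
  choose b' hb' using hlift
  let b : ι → B := Function.update b' i 1
  have hbi : b i = 1 := Function.update_self ..
  have hb : ∀ j, Ideal.Quotient.mk I (b j) = f (c j) := by
    intro j
    by_cases hj : j = i
    · subst hj; rw [hbi, h.eq_one, map_one, map_one]
    · rw [← hb']; congr 1; exact Function.update_of_ne hj ..
  have hsurj : Function.Surjective (aeval c : MvPolynomial ι κ →ₐ[κ] C) := fun x ↦ by
    obtain ⟨P, hP⟩ := h.surjective x
    exact ⟨P, hP⟩
  have hker : ∀ P : MvPolynomial ι κ, aeval c P = 0 → aeval b P = 0 := by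
    intro P hP
    rw [aeval_def, ← eval₂_homogenise i P _ h.eq_one] at hP
    rw [aeval_def, ← eval₂_homogenise i P _ hbi, h.eq_zero _ _ (isHomogeneous_homogenise i P) hP,
      eval₂_zero]
  refine ⟨AlgHom.liftOfSurjective (aeval c : MvPolynomial ι κ →ₐ[κ] C) hsurj (aeval b) hker, ?_⟩
  refine (AlgHom.cancel_right hsurj).mp ?_
  refine MvPolynomial.algHom_ext fun j ↦ ?_
  have h1 : AlgHom.liftOfSurjective (aeval c : MvPolynomial ι κ →ₐ[κ] C) hsurj (aeval b) hker
      (aeval c (X j)) = aeval b (X j) := AlgHom.liftOfSurjective_apply ..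
  rw [AlgHom.comp_apply, AlgHom.comp_apply, h1, AlgHom.comp_apply, aeval_X, aeval_X]
  exact hb j

lemma IsStandardChart.smooth {ι κ C : Type*} [Finite ι] [CommRing κ] [IsNoetherianRing κ]
    [CommRing C] {δ : κ →+* C} {i : ι} {c : ι → C} (h : IsStandardChart δ i c) : δ.Smooth := by
  algebraize [δ]
  have := IsStandardChart.formallySmooth (κ := κ) (C := C) h
  have : Algebra.FiniteType κ C := by
    refine Algebra.FiniteType.of_surjective (aeval c : MvPolynomial ι κ →ₐ[κ] C) fun x ↦ ?_
    obtain ⟨P, hP⟩ := h.surjective x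
    exact ⟨P, hP⟩
  have : Algebra.FinitePresentation κ C := Algebra.FinitePresentation.of_finiteType.mp this
  exact ⟨inferInstance, inferInstance⟩

variable {R : Type u} [CommRing R] {n : ℕ}

/-- The coordinate ring of the chart `T_i ≠ 0` of projective space. -/
abbrev chartRing (R : Type u) [CommRing R] {n : ℕ} (i : Fin (n + 1)) : Type u :=
  HomogeneousLocalization.Away (grading R n) (X i)

/-- The function `T_j / T_i`. -/
noncomputable def chartCoord (R : Type u) [CommRing R] {n : ℕ} (i j : Fin (n + 1)) :
    chartRing R i :=
  dehomogenise (X j) 1 (isHomogeneous_X R j) i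

/-- The inclusion of the constants. -/
noncomputable def chartC (R : Type u) [CommRing R] {n : ℕ} (i : Fin (n + 1)) :
    R →+* chartRing R i :=
  (HomogeneousLocalization.fromZeroRingHom (grading R n) _).comp (algebraMap R (grading R n 0))

/-- The chart `T_i ≠ 0` of projective space. -/
noncomputable def projChart (R : Type u) [CommRing R] {n : ℕ} (i : Fin (n + 1)) :
    Spec (.of (chartRing R i)) ⟶ projSpace R n :=
  Proj.awayι (grading R n) (X i) (X_mem_grading i) one_pos

instance (i : Fin (n + 1)) : IsOpenImmersion (projChart R i) :=
  inferInstanceAs (IsOpenImmersion (Proj.awayι _ _ _ _))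

lemma val_dehomogenise (F : MvPolynomial (Fin (n + 1)) R) (e : ℕ) (hF : F.IsHomogeneous e)
    (i : Fin (n + 1)) : (dehomogenise F e hF i).val =
      Localization.mk F ⟨X i ^ e, (Submonoid.mem_powers_iff _ _).mpr ⟨e, rfl⟩⟩ := rfl

/-- This identifies evaluation at the coordinates with an explicit fraction in `Proj`, so the
abstract results on standard charts apply to projective space. -/
lemma eval₂_chartCoord (F : MvPolynomial (Fin (n + 1)) R) (e : ℕ) (hF : F.IsHomogeneous e)
    (i : Fin (n + 1)) : eval₂ (chartC R i) (chartCoord R i) F = dehomogenise F e hF i := by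
  apply HomogeneousLocalization.val_injective
  let L := Localization (Submonoid.powers (X i : MvPolynomial (Fin (n + 1)) R))
  let ρ := algebraMap (MvPolynomial (Fin (n + 1)) R) L
  let v : chartRing R i →+* L := algebraMap (chartRing R i) L
  change v (eval₂ _ _ F) = _
  have h1 : v (eval₂ (chartC R i) (chartCoord R i) F) =
      eval₂ (ρ.comp MvPolynomial.C) (fun j ↦ v (chartCoord R i j)) F := by
    rw [← coe_eval₂Hom, map_eval₂Hom, coe_eval₂Hom]
    congr 1
  have h2 : ∀ j, ρ (X j) = v (chartCoord R i j) * ρ (X i) := fun j ↦ by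
    change algebraMap _ L _ = Localization.mk _ _ * algebraMap _ L _
    rw [← Localization.mk_one_eq_algebraMap, ← Localization.mk_one_eq_algebraMap,
      Localization.mk_mul, Localization.mk_eq_mk_iff, Localization.r_iff_exists]
    exact ⟨1, by simp; ring⟩
  have h3 := eval₂_mul_pow_of_isHomogeneous ρ h2 (hF.map MvPolynomial.C)
  have h4 : eval X (map MvPolynomial.C F) = F := by
    rw [MvPolynomial.eval_map]; exact eval₂_eta F
  rw [h4, eval₂_map] at h3
  rw [h1, val_dehomogenise, Localization.mk_eq_mk', eq_comm, IsLocalization.mk'_eq_iff_eq_mul]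
  exact h3.trans (congrArg _ (map_pow ρ _ _).symm)

lemma isStandardChart_chartRing (i : Fin (n + 1)) :
    IsStandardChart (chartC R i) i (chartCoord R i) where
  eq_one := by
    apply HomogeneousLocalization.val_injective
    rw [chartCoord, val_dehomogenise, HomogeneousLocalization.val_one, ← Localization.mk_one,
      Localization.mk_eq_mk_iff, Localization.r_iff_exists]
    exact ⟨1, by simp⟩
  surjective x := by
    obtain ⟨d, a, ha, rfl⟩ := HomogeneousLocalization.Away.mk_surjective (grading R n)
      (X_mem_grading i) x
    have ha' : a.IsHomogeneous d := by simpa using ha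
    exact ⟨a, eval₂_chartCoord a d ha' i⟩
  eq_zero d Q hQ h := by
    rw [eval₂_chartCoord Q d hQ i] at h
    have h1 := congrArg HomogeneousLocalization.val h
    rw [val_dehomogenise, HomogeneousLocalization.val_zero, Localization.mk_eq_mk',
      IsLocalization.mk'_eq_zero_iff] at h1
    obtain ⟨⟨_, N, rfl⟩, h2⟩ := h1
    have h3 : Q * X i ^ N = 0 := by rw [mul_comm]; exact h2
    exact (isRegular_X_pow (n := i) N).right (h3.trans (zero_mul _).symm)

lemma projChart_projSpaceToSpec (i : Fin (n + 1)) :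
    projChart R i ≫ projSpaceToSpec R n = Spec.map (CommRingCat.ofHom (chartC R i)) := by
  rw [projChart, projSpaceToSpec]
  erw [Proj.awayι_toSpecZero_assoc]
  rw [← Spec.map_comp]
  rfl

lemma opensRange_projChart (i : Fin (n + 1)) : (projChart R i).opensRange = chart R i :=
  Proj.opensRange_awayι _ _ _ _

lemma exists_mem_range_projChart (x : projSpace R n) : ∃ i, x ∈ Set.range (projChart R i) := by
  have h : ⨆ i : Fin (n + 1), Proj.basicOpen (grading R n) (X i) = ⊤ := by
    refine Proj.iSup_basicOpen_eq_top' (grading R n) _ (fun i ↦ ⟨1, X_mem_grading i⟩) ?_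
    rw [eq_top_iff]
    intro P _
    have : P ∈ Algebra.adjoin R (Set.range (X : Fin (n + 1) → MvPolynomial (Fin (n + 1)) R)) := by
      rw [MvPolynomial.adjoin_range_X]; trivial
    refine Algebra.adjoin_induction (fun x hx ↦ Algebra.subset_adjoin hx) (fun r ↦ ?_)
      (fun x y _ _ hx hy ↦ add_mem hx hy) (fun x y _ _ hx hy ↦ mul_mem hx hy) this
    exact Subalgebra.algebraMap_mem _ (algebraMap R (grading R n 0) r)
  have hx : x ∈ (⨆ i : Fin (n + 1), Proj.basicOpen (grading R n) (X i)) := by rw [h]; trivial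
  obtain ⟨i, hi⟩ := TopologicalSpace.Opens.mem_iSup.mp hx
  refine ⟨i, ?_⟩
  have := (opensRange_projChart (R := R) i).ge hi
  exact this

/-- The ring of the intersection of two charts of projective space. -/
abbrev overlapRing (R : Type u) [CommRing R] {n : ℕ} (i j : Fin (n + 1)) : Type u :=
  HomogeneousLocalization.Away (grading R n) (X i * X j)

/-- Restriction of functions from the chart `i` to the intersection with the chart `j`. -/
noncomputable def overlapLeft (R : Type u) [CommRing R] {n : ℕ} (i j : Fin (n + 1)) :
    chartRing R i →+* overlapRing R i j :=
  HomogeneousLocalization.awayMap (grading R n) (X_mem_grading j) rfl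

/-- Restriction of functions from the chart `j` to the intersection with the chart `i`. -/
noncomputable def overlapRight (R : Type u) [CommRing R] {n : ℕ} (i j : Fin (n + 1)) :
    chartRing R j →+* overlapRing R i j :=
  HomogeneousLocalization.awayMap (grading R n) (X_mem_grading i) (mul_comm _ _)

lemma isPullback_projChart (i j : Fin (n + 1)) :
    IsPullback (Spec.map (CommRingCat.ofHom (overlapLeft R i j)))
      (Spec.map (CommRingCat.ofHom (overlapRight R i j))) (projChart R i) (projChart R j) := by
  refine IsPullback.of_iso_pullback ⟨?_⟩ (Proj.pullbackAwayιIso (grading R n) (X_mem_grading i)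
    one_pos (X_mem_grading j) one_pos rfl).symm ?_ ?_
  · erw [Proj.SpecMap_awayMap_awayι, Proj.SpecMap_awayMap_awayι]
  · exact Proj.pullbackAwayιIso_inv_fst (grading R n) (X_mem_grading i) one_pos
      (X_mem_grading j) one_pos rfl
  · exact Proj.pullbackAwayιIso_inv_snd (grading R n) (X_mem_grading i) one_pos
      (X_mem_grading j) one_pos rfl

lemma overlapLeft_chartC (i j : Fin (n + 1)) :
    (overlapLeft R i j).comp (chartC R i) = (overlapRight R i j).comp (chartC R j) := by
  refine RingHom.ext fun r ↦ ?_
  exact (HomogeneousLocalization.awayMap_fromZeroRingHom (grading R n) (X_mem_grading j) rfl _).trans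
    (HomogeneousLocalization.awayMap_fromZeroRingHom (grading R n) (X_mem_grading i)
      (mul_comm _ _) _).symm

lemma overlapLeft_chartCoord (i j k : Fin (n + 1)) :
    overlapLeft R i j (chartCoord R i k) =
      overlapRight R i j (chartCoord R j k) * overlapLeft R i j (chartCoord R i j) := by
  apply HomogeneousLocalization.val_injective
  have h1 : ∀ k, (overlapLeft R i j (chartCoord R i k)).val = Localization.mk (X k * X j ^ 1)
      ⟨(X i * X j) ^ 1, (Submonoid.mem_powers_iff _ _).mpr ⟨1, rfl⟩⟩ := fun k ↦
    HomogeneousLocalization.val_awayMap_mk ..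
  have h2 : (overlapRight R i j (chartCoord R j k)).val = Localization.mk (X k * X i ^ 1)
      ⟨(X i * X j) ^ 1, (Submonoid.mem_powers_iff _ _).mpr ⟨1, rfl⟩⟩ :=
    HomogeneousLocalization.val_awayMap_mk ..
  rw [HomogeneousLocalization.val_mul, h1, h1, h2, Localization.mk_mul, Localization.mk_eq_mk_iff,
    Localization.r_iff_exists]
  exact ⟨1, by simp; ring⟩

lemma _root_.AlgebraicGeometry.Proj.awayToSection_appLE {A σ : Type*} [CommRing A] [SetLike σ A]
    [AddSubgroupClass σ A] (𝒜 : ℕ → σ) [GradedRing 𝒜] (f : A) {m : ℕ} (hf : f ∈ 𝒜 m) (hm : 0 < m)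
    (h : ⊤ ≤ Proj.awayι 𝒜 f hf hm ⁻¹ᵁ Proj.basicOpen 𝒜 f) :
    Proj.awayToSection 𝒜 f ≫ (Proj.awayι 𝒜 f hf hm).appLE (Proj.basicOpen 𝒜 f) ⊤ h =
      (Scheme.ΓSpecIso _).inv := by
  have h1 := Proj.basicOpenToSpec_app_top 𝒜 f
  let e := Proj.basicOpenIsoSpec 𝒜 f hf hm
  have h2 : e.hom ≫ Proj.awayι 𝒜 f hf hm = (Proj.basicOpen 𝒜 f).ι := Iso.hom_inv_id_assoc e _
  have h3 : e.hom.app ⊤ = (Scheme.ΓSpecIso _).hom ≫ Proj.awayToSection 𝒜 f ≫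
      (Proj.basicOpen 𝒜 f).topIso.inv := h1
  have h4 : (Proj.awayι 𝒜 f hf hm).appLE (Proj.basicOpen 𝒜 f) ⊤ h ≫ e.hom.app ⊤ =
      (Proj.basicOpen 𝒜 f).topIso.inv := by
    rw [Scheme.Hom.app_eq_appLE, Scheme.Hom.appLE_comp_appLE]
    simp only [h2]
    rw [Scheme.Hom.appLE, Scheme.Opens.topIso_inv, Scheme.Opens.ι_app]
    exact (Functor.map_comp (Proj 𝒜).presheaf _ _).symm
  rw [← cancel_mono (e.hom.app ⊤), Category.assoc, h4]
  exact (Iso.eq_inv_comp _).mpr h3.symm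

lemma awayToSection_appLE (i : Fin (n + 1)) (h : ⊤ ≤ projChart R i ⁻¹ᵁ chart R i) (j) :
    ((projChart R i).appLE (chart R i) ⊤ h).hom (coordinate R i j) =
      (Scheme.ΓSpecIso (.of (chartRing R i))).inv.hom (chartCoord R i j) :=
  congr($(Proj.awayToSection_appLE (grading R n) (X i) (X_mem_grading i) one_pos h).hom
    (chartCoord R i j))

lemma onChart_iInf {Y : Scheme.{u}} {B : CommRingCat.{u}} (q : Spec B ⟶ Y) [IsOpenImmersion q]
    {ι : Type*} [Finite ι] (J : ι → Y.IdealSheafData) :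
    onChart q (⨅ i, J i) = ⨅ i, onChart q (J i) := by
  let e := (chartIso q).commRingCatIsoToRingEquiv
  have h (I : Y.IdealSheafData) : onChart q I =
      (I.ideal ⟨q.opensRange, isAffineOpen_opensRange q⟩).comap e.symm :=
    (onChart_eq_map_chartIso q I).trans (Ideal.comap_symm e).symm
  simp only [h, Scheme.IdealSheafData.ideal_iInf, iInf_apply, Ideal.comap_iInf]

lemma ker_comap_of_isPullback {X Y U V : Scheme.{u}} {f : X ⟶ Y} {f' : U ⟶ V} {g : U ⟶ X}
    {q : V ⟶ Y} [IsOpenImmersion q] [QuasiCompact f] (H : IsPullback f' g q f) :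
    f.ker.comap q = f'.ker := by
  ext W : 2
  rw [Scheme.IdealSheafData.ideal_comap_of_isOpenImmersion,
    Scheme.ker_ideal_of_isPullback_of_isOpenImmersion f f' g q H]

/-- Forming the scheme-theoretic image commutes with restriction to an open chart. On the overlap
`Spec D` the closed subscheme is given by the extended ideal, and taking its image in `Spec A`
contracts that ideal. -/
lemma onChart_ker_of_isPullback {Y : Scheme.{u}} {A A' D : CommRingCat.{u}} {q : Spec A ⟶ Y}
    {q' : Spec A' ⟶ Y} [IsOpenImmersion q] [QuasiCompact q'] {α : A ⟶ D} {β : A' ⟶ D}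
    (h : IsPullback (Spec.map α) (Spec.map β) q q') (I : Ideal A') :
    onChart q (Spec.map (CommRingCat.ofHom (Ideal.Quotient.mk I)) ≫ q').ker =
      (I.map β.hom).comap α.hom := by
  let m := CommRingCat.ofHom (Ideal.Quotient.mk I)
  let m' := CommRingCat.ofHom (Ideal.Quotient.mk (I.map β.hom))
  have hle : I ≤ (I.map β.hom).comap β.hom := Ideal.le_comap_map
  let b : CommRingCat.of (A' ⧸ I) ⟶ CommRingCat.of (D ⧸ I.map β.hom) :=
    CommRingCat.ofHom (Ideal.quotientMap _ β.hom hle)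
  have hm : m ≫ b = β ≫ m' := CommRingCat.hom_ext (Ideal.quotientMap_comp_mk hle)
  have h1 : IsPullback (Spec.map m') (Spec.map b) (Spec.map β) (Spec.map m) := by
    refine isPullback_of_isClosedImmersion _ _ _ _ ?_ ?_
    · rw [← Spec.map_comp, ← Spec.map_comp, hm]
    · apply onChart_id_injective
      rw [onChart_id_ker_SpecMap, ← onChart_eq_onChart_id, onChart_SpecMap,
        onChart_id_ker_SpecMap]
      exact (congrArg (Ideal.map β.hom) (Ideal.mk_ker (I := I))).trans Ideal.mk_ker.symm
  have h2 := (h1.flip.paste_vert h.flip).flip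
  rw [← Spec.map_comp] at h2
  rw [onChart_eq_onChart_id, ker_comap_of_isPullback h2, onChart_id_ker_SpecMap,
    CommRingCat.hom_comp, ← RingHom.comap_ker]
  exact congrArg _ Ideal.mk_ker

/-- The chart `j` contributes the contraction of an ideal of the overlap. Since `F / T_i ^ e = (F /
T_j ^ e) * (T_j / T_i) ^ e` there, each contribution contains `F / T_i ^ e`, while the chart `i`
itself contributes no more than its multiples. -/
lemma onChart_projHypersurface (F : MvPolynomial (Fin (n + 1)) R) (e : ℕ) (hF : F.IsHomogeneous e)
    (i : Fin (n + 1)) :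
    onChart (projChart R i) (projHypersurface F e hF) = Ideal.span {dehomogenise F e hF i} := by
  have : (projSpace R n).IsSeparated := inferInstanceAs (Proj (grading R n)).IsSeparated
  have key : ∀ j, onChart (projChart R i) (Scheme.Hom.ker
    (Spec.map (CommRingCat.ofHom (Ideal.Quotient.mk (Ideal.span {dehomogenise F e hF j}))) ≫
      projChart R j)) = ((Ideal.span {dehomogenise F e hF j}).map (overlapRight R i j)).comap
        (overlapLeft R i j) := fun j ↦ onChart_ker_of_isPullback (isPullback_projChart i j) _
  refine le_antisymm ?_ ?_
  · refine (onChart_mono (projChart R i) (iInf_le _ i)).trans ?_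
    change onChart (projChart R i) (Scheme.Hom.ker (_ ≫ projChart R i)) ≤ _
    rw [← Scheme.IdealSheafData.map_bot, Scheme.IdealSheafData.map_comp, onChart_eq_onChart_id]
    refine (onChart_mono _ (Scheme.IdealSheafData.comap_map_le _ _)).trans ?_
    rw [Scheme.IdealSheafData.map_bot, onChart_id_ker_SpecMap]
    exact Ideal.mk_ker.le
  · refine le_of_le_of_eq (le_iInf fun j ↦ ?_) (onChart_iInf (projChart R i) _).symm
    refine le_of_le_of_eq ?_ (key j).symm
    rw [Ideal.span_singleton_le_iff_mem, Ideal.mem_comap, Ideal.map_span, Set.image_singleton,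
      Ideal.mem_span_singleton']
    refine ⟨overlapLeft R i j (chartCoord R i j) ^ e, ?_⟩
    have h (f : chartRing R i →+* overlapRing R i j) :
        f (dehomogenise F e hF i) = eval₂ (f.comp (chartC R i)) (fun k ↦ f (chartCoord R i k)) F :=
      (congrArg f (eval₂_chartCoord F e hF i).symm).trans
        (map_eval₂Hom (chartC R i) (chartCoord R i) f F)
    have h' (f : chartRing R j →+* overlapRing R i j) :
        f (dehomogenise F e hF j) = eval₂ (f.comp (chartC R j)) (fun k ↦ f (chartCoord R j k)) F :=
      (congrArg f (eval₂_chartCoord F e hF j).symm).trans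
        (map_eval₂Hom (chartC R j) (chartCoord R j) f F)
    rw [h, h', overlapLeft_chartC, mul_comm, ← eval₂_mul_of_isHomogeneous _ _ _ hF]
    congr 1
    exact _root_.funext fun k ↦ (overlapLeft_chartCoord i j k).symm

/-- Smoothness over an affine base of a closed subscheme, on charts. -/
lemma smooth_subschemeι_iff {Y : Scheme.{u}} {ι : Type*} {B : ι → CommRingCat.{u}}
    (q : ∀ i, Spec (B i) ⟶ Y) [∀ i, IsOpenImmersion (q i)] (hq : ∀ y, ∃ i, y ∈ Set.range (q i))
    (J : Y.IdealSheafData) {K : CommRingCat.{u}} (g : Y ⟶ Spec K) (φ : ∀ i, K →+* B i)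
    (hφ : ∀ i, q i ≫ g = Spec.map (CommRingCat.ofHom (φ i))) :
    Smooth (J.subschemeι ≫ g) ↔
      ∀ i, ((Ideal.Quotient.mk (onChart (q i) J)).comp (φ i)).Smooth := by
  rw [IsZariskiLocalAtSource.iff_of_openCover (P := @Smooth) (chartCover q hq J)]
  refine forall_congr' fun (i : ι) ↦ ?_
  have h : chartι (q i) J ≫ J.subschemeι ≫ g =
      Spec.map (CommRingCat.ofHom ((Ideal.Quotient.mk (onChart (q i) J)).comp (φ i))) := by
    rw [chartι_subschemeι_assoc, hφ, ← Spec.map_comp]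
    rfl
  change Smooth (chartι (q i) J ≫ J.subschemeι ≫ g) ↔ _
  rw [h]
  exact HasRingHomProperty.Spec_iff (P := @Smooth)

lemma smooth_projHypersurface_iff (F : MvPolynomial (Fin (n + 1)) R) (e : ℕ)
    (hF : F.IsHomogeneous e) :
    Smooth ((projHypersurface F e hF).subschemeι ≫ projSpaceToSpec R n) ↔
      ∀ i, ((Ideal.Quotient.mk (Ideal.span {eval₂ (chartC R i) (chartCoord R i) F})).comp
        (chartC R i)).Smooth := by
  rw [smooth_subschemeι_iff (projChart R) exists_mem_range_projChart _ _ _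
    projChart_projSpaceToSpec]
  refine forall_congr' fun i ↦ ?_
  rw [onChart_projHypersurface, eval₂_chartCoord F e hF i]

end Projective


/-! ### Dimension of a Cartier divisor -/

section Dimension

/-- The localisation of `S` at `Q` is that of `R` at `P` modulo the image of `x`, a nonzerodivisor
in the maximal ideal; in a Noetherian local ring the dimension then drops by exactly one. -/
lemma ringKrullDim_localization_add_one {R S : Type*} [CommRing R] [IsNoetherianRing R] [CommRing S]
    {f : R →+* S} (hf : Function.Surjective f) {x : R} (hx : x ∈ nonZeroDivisors R)
    (hker : RingHom.ker f = Ideal.span {x}) (P : Ideal R) (Q : Ideal S) [P.IsPrime] [Q.IsPrime]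
    (h : P = Q.comap f) :
    ringKrullDim (Localization.AtPrime Q) + 1 = ringKrullDim (Localization.AtPrime P) := by
  let g := Localization.localRingHom P Q f h
  have hg : Function.Surjective g := by
    intro y
    obtain ⟨b, s, rfl⟩ := IsLocalization.exists_mk'_eq Q.primeCompl y
    obtain ⟨a, rfl⟩ := hf b
    obtain ⟨⟨s, hs⟩, rfl⟩ : ∃ s' : f ⁻¹' (Q.primeCompl : Set S), (⟨f s', s'.2⟩ : Q.primeCompl) = s := by
      obtain ⟨s, hs⟩ := s
      obtain ⟨s, rfl⟩ := hf s
      exact ⟨⟨s, hs⟩, rfl⟩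
    have hs' : s ∈ P.primeCompl := by subst h; exact hs
    exact ⟨IsLocalization.mk' _ a (⟨s, hs'⟩ : P.primeCompl), Localization.localRingHom_mk' ..⟩
  have hgker : RingHom.ker g = Ideal.span {algebraMap R (Localization.AtPrime P) x} := by
    refine le_antisymm (fun y hy ↦ ?_) ?_
    · obtain ⟨a, s, rfl⟩ := IsLocalization.exists_mk'_eq P.primeCompl y
      have h1 : algebraMap S (Localization.AtPrime Q) (f a) = 0 := by
        rw [← Localization.localRingHom_to_map P Q f h]
        have := (RingHom.ker g).mul_mem_left (algebraMap R _ s) hy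
        rwa [IsLocalization.mk'_spec'] at this
      rw [IsLocalization.map_eq_zero_iff Q.primeCompl] at h1
      obtain ⟨⟨q, hq⟩, h2⟩ := h1
      obtain ⟨q, rfl⟩ := hf q
      have h3 : q * a ∈ RingHom.ker f := by rw [RingHom.mem_ker, map_mul]; exact h2
      rw [hker, Ideal.mem_span_singleton'] at h3
      obtain ⟨r, hr⟩ := h3
      have hq' : q ∈ P.primeCompl := by subst h; exact hq
      rw [Ideal.mem_span_singleton']
      refine ⟨IsLocalization.mk' _ r (⟨q, hq'⟩ * s), ?_⟩
      rw [eq_comm, IsLocalization.mk'_eq_iff_eq_mul]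
      have h4 := IsLocalization.mk'_spec (Localization.AtPrime P) r (⟨q, hq'⟩ * s)
      have hu := IsLocalization.map_units (Localization.AtPrime P) (⟨q, hq'⟩ : P.primeCompl)
      refine hu.mul_left_cancel ?_
      have h5 : algebraMap R (Localization.AtPrime P) q * algebraMap R _ a =
          algebraMap R _ r * algebraMap R _ x := by rw [← map_mul, ← map_mul, hr]
      refine h5.trans ?_
      rw [← h4, Submonoid.coe_mul, map_mul]
      ring
    · rw [Ideal.span_singleton_le_iff_mem, RingHom.mem_ker]
      change Localization.localRingHom P Q f h _ = 0
      have : f x = 0 := by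
        rw [← RingHom.mem_ker, hker]; exact Ideal.mem_span_singleton_self x
      rw [Localization.localRingHom_to_map, this, map_zero]
  have e := RingHom.quotientKerEquivOfSurjective hg
  rw [← ringKrullDim_eq_of_ringEquiv e, hgker]
  have : IsNoetherianRing (Localization.AtPrime P) :=
    IsLocalization.isNoetherianRing P.primeCompl _ inferInstance
  refine ringKrullDim_quotient_span_singleton_succ_eq_ringKrullDim_of_mem_nonZeroDivisors ?_ ?_
  · exact IsLocalization.map_nonZeroDivisors_le P.primeCompl _ (Submonoid.mem_map_of_mem _ hx)
  · rw [← Localization.AtPrime.map_eq_maximalIdeal]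
    refine Ideal.mem_map_of_mem _ ?_
    rw [h, Ideal.mem_comap]
    have : f x = 0 := by
      rw [← RingHom.mem_ker, hker]; exact Ideal.mem_span_singleton_self x
    rw [this]
    exact Q.zero_mem

end Dimension

/-! ### Algebras over a local ring that are smooth over its residue field -/

section ResidueSmooth

open IsLocalRing

variable {O R S : Type u} [CommRing O] [IsLocalRing O] [CommRing R] [CommRing S]

/-- The `O`-algebra `R` is a smooth algebra over the residue field of `O`. -/
def IsResidueSmooth (φ : O →+* R) : Prop :=
  ∃ ψ : ResidueField O →+* R, ψ.comp (residue O) = φ ∧ ψ.Smooth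

namespace IsResidueSmooth

variable {φ : O →+* R}

lemma comp (h : IsResidueSmooth φ) {g : R →+* S} (hg : g.Smooth) :
    IsResidueSmooth (g.comp φ) := by
  obtain ⟨ψ, rfl, h⟩ := h
  exact ⟨g.comp ψ, rfl, h.comp hg⟩

lemma isReduced (h : IsResidueSmooth φ) : _root_.IsReduced R := by
  obtain ⟨ψ, -, h⟩ := h
  algebraize [ψ]
  exact isReduced_of_formallySmooth (ResidueField O) R

/-- The zero ring arises as the coordinate ring of an empty intersection. -/
lemma of_subsingleton [Subsingleton R] : IsResidueSmooth φ := by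
  let ψ : ResidueField O →+* R :=
    { toFun := fun _ ↦ 0
      map_one' := Subsingleton.elim _ _
      map_mul' := fun _ _ ↦ Subsingleton.elim _ _
      map_zero' := rfl
      map_add' := fun _ _ ↦ Subsingleton.elim _ _ }
  refine ⟨ψ, RingHom.ext fun _ ↦ Subsingleton.elim _ _, ?_⟩
  algebraize [ψ]
  exact inferInstanceAs (Algebra.Smooth (ResidueField O) R)

end IsResidueSmooth

lemma isResidueSmooth_ringEquiv_comp_iff {φ : O →+* R} (e : R ≃+* S) :
    IsResidueSmooth ((e : R →+* S).comp φ) ↔ IsResidueSmooth φ := by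
  refine ⟨fun h ↦ ?_, fun h ↦ h.comp (.of_bijective e.bijective)⟩
  have := h.comp (g := (e.symm : S →+* R)) (.of_bijective e.symm.bijective)
  rwa [← RingHom.comp_assoc, RingEquiv.symm_comp, RingHom.id_comp] at this

lemma isResidueSmooth_quotient_iff {φ : O →+* R} {f : R →+* S} (hf : Function.Surjective f)
    {I : Ideal R} (hI : RingHom.ker f = I) :
    IsResidueSmooth ((Ideal.Quotient.mk I).comp φ) ↔ IsResidueSmooth (f.comp φ) := by
  subst hI
  rw [← isResidueSmooth_ringEquiv_comp_iff (RingHom.quotientKerEquivOfSurjective hf)]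
  rfl

/-- A map out of the residue field is determined on `O`, so the structures on the quotient and on
the localisation both come from one on `R`, and the criterion for Cartier divisors applies. -/
lemma isResidueSmooth_of_quotient_of_away {φ : O →+* R} (hφ : φ.FiniteType)
    (hm : ∀ x ∈ maximalIdeal O, φ x = 0) {u : R} (hu : u ∈ nonZeroDivisors R)
    (h₁ : IsResidueSmooth ((Ideal.Quotient.mk (Ideal.span {u})).comp φ))
    (h₂ : IsResidueSmooth ((algebraMap R (Localization.Away u)).comp φ)) : IsResidueSmooth φ := by
  obtain ⟨ψ₁, hψ₁, h₁⟩ := h₁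
  obtain ⟨ψ₂, hψ₂, h₂⟩ := h₂
  let ψ : ResidueField O →+* R := Ideal.Quotient.lift _ φ hm
  have hψ : ψ.comp (residue O) = φ := Ideal.Quotient.lift_comp_mk _ _ _
  refine ⟨ψ, hψ, ?_⟩
  have e₁ : ψ₁ = (Ideal.Quotient.mk (Ideal.span {u})).comp ψ :=
    (RingHom.cancel_right residue_surjective).mp (by rw [hψ₁, RingHom.comp_assoc, hψ])
  have e₂ : ψ₂ = (algebraMap R (Localization.Away u)).comp ψ :=
    (RingHom.cancel_right residue_surjective).mp (by rw [hψ₂, RingHom.comp_assoc, hψ])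
  subst e₁ e₂
  have hft : ψ.FiniteType := by
    rw [← hψ] at hφ
    exact hφ.of_comp_finiteType
  algebraize [ψ]
  have h₁' : Algebra.FormallySmooth (ResidueField O) (R ⧸ Ideal.span {u}) := h₁.formallySmooth
  have h₂' : Algebra.FormallySmooth (ResidueField O) (Localization.Away u) := by
    have := h₂.formallySmooth
    unfold RingHom.FormallySmooth at this
    convert this using 1
    exact Algebra.algebra_ext _ _ fun _ ↦ rfl
  exact smooth_of_smooth_quotient_of_smooth_away hu h₁' h₂'

/-- Over a separable extension of finite type `κ` of the residue field `k`, smoothness over `k` and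
over `κ` are the same. -/
lemma isResidueSmooth_comp_iff {κ : Type u} [Field κ] {θ : O →+* κ} {ι : ResidueField O →+* κ}
    (hι : ι.comp (residue O) = θ) (hft : ι.FiniteType)
    (hsep : letI := ι.toAlgebra; Algebra.IsSeparable (ResidueField O) κ) (δ : κ →+* R) :
    IsResidueSmooth (δ.comp θ) ↔ δ.Smooth := by
  algebraize [ι]
  -- Separability makes `κ` formally étale over the residue field, which allows formal smoothness to
  -- be transferred between the two bases.
  have : Algebra.FormallyEtale (ResidueField O) κ := .of_isSeparable _ _
  have hs : ι.Smooth := ⟨inferInstance, Algebra.FinitePresentation.of_finiteType.mp hft⟩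
  refine ⟨?_, fun h ↦ ⟨δ.comp ι, by rw [RingHom.comp_assoc, hι], hs.comp h⟩⟩
  rintro ⟨ψ, hψ, h⟩
  have e : ψ = δ.comp ι :=
    (RingHom.cancel_right residue_surjective).mp (by rw [hψ, RingHom.comp_assoc, hι])
  subst e
  algebraize [δ, δ.comp ι]
  have : Algebra.FormallySmooth κ R := .of_restrictScalars (ResidueField O) κ R
  have : Algebra.FiniteType κ R := .of_restrictScalars_finiteType (ResidueField O) κ R
  exact ⟨inferInstance, Algebra.FinitePresentation.of_finiteType.mp inferInstance⟩

end ResidueSmooth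


/-! ### Strict transforms on affine blow-up algebras -/

section StrictTransform

open MvPolynomial

lemma ker_mk_comp {B C : Type*} [CommRing B] [CommRing C] {ψ : B →+* C}
    (hψ : Function.Surjective ψ) (g : B) :
    RingHom.ker ((Ideal.Quotient.mk (Ideal.span {ψ g})).comp ψ) = RingHom.ker ψ ⊔ Ideal.span {g} := by
  rw [← RingHom.comap_ker, Ideal.mk_ker, ← Set.image_singleton, ← Ideal.map_span,
    Ideal.comap_map_of_surjective' _ hψ, sup_comm]

lemma mk_surjective_comp {B C : Type*} [CommRing B] [CommRing C] {ψ : B →+* C}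
    (hψ : Function.Surjective ψ) (I : Ideal C) :
    Function.Surjective ((Ideal.Quotient.mk I).comp ψ) :=
  Ideal.Quotient.mk_surjective.comp hψ

variable {ι : Type*} {A B : Type u} [CommRing A] [CommRing B] {φ : A →+* B} {s : ι → A} {i : ι}
  {a : ι → B} (h : IsAffineBlowUp φ s i a) {τ : A} {e : ℕ} {g : B}
  (hg : φ τ = φ (s i) ^ e * g)

include h in
lemma IsAffineBlowUp.finiteType [Finite ι] : φ.FiniteType := by
  algebraize [φ]
  exact Algebra.FiniteType.of_surjective (aeval a : MvPolynomial ι A →ₐ[A] B) h.surjective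

include h hg in
/-- Away from the exceptional divisor, the strict transform agrees with the original divisor. -/
lemma IsAffineBlowUp.exists_ringEquiv_away :
    ∃ E : Localization.Away (Ideal.Quotient.mk (Ideal.span {τ}) (s i)) ≃+*
        Localization.Away (Ideal.Quotient.mk (Ideal.span {g}) (φ (s i))),
      ∀ x, E (algebraMap _ _ (Ideal.Quotient.mk (Ideal.span {τ}) x)) =
        algebraMap _ _ (Ideal.Quotient.mk (Ideal.span {g}) (φ x)) := by
  have hle : Ideal.span {τ} ≤ (Ideal.span {g}).comap φ := by
    rw [Ideal.span_singleton_le_iff_mem, Ideal.mem_comap, hg]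
    exact Ideal.mul_mem_left _ _ (Ideal.mem_span_singleton_self g)
  let L := Localization.Away (Ideal.Quotient.mk (Ideal.span {g}) (φ (s i)))
  let : Algebra (A ⧸ Ideal.span {τ}) L :=
    ((algebraMap (B ⧸ Ideal.span {g}) L).comp (Ideal.quotientMap _ φ hle)).toAlgebra
  have hL : ∀ x, algebraMap (A ⧸ Ideal.span {τ}) L (Ideal.Quotient.mk _ x) =
      algebraMap (B ⧸ Ideal.span {g}) L (Ideal.Quotient.mk _ (φ x)) := fun x ↦ rfl
  have := h.isLocalization_away_quotient hg hL
  let E := IsLocalization.algEquiv (Submonoid.powers (Ideal.Quotient.mk (Ideal.span {τ}) (s i)))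
    (Localization.Away (Ideal.Quotient.mk (Ideal.span {τ}) (s i))) L
  exact ⟨E.toRingEquiv, fun x ↦ (E.commutes _).trans (hL x)⟩

include h hg in
/-- The ideal of the strict transform, as a reduced subscheme. -/
lemma IsAffineBlowUp.vanishingIdeal_strictTransform
    (hreg : ∀ b, φ (s i) * b ∈ Ideal.span {g} → b ∈ Ideal.span {g})
    (hred : _root_.IsReduced (Localization.Away (Ideal.Quotient.mk (Ideal.span {τ}) (s i)))) :
    PrimeSpectrum.vanishingIdeal
      {x : PrimeSpectrum B | φ τ ∈ x.asIdeal ∧ φ (s i) ∉ x.asIdeal} = Ideal.span {g} := by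
  obtain ⟨E, -⟩ := h.exists_ringEquiv_away hg
  refine le_antisymm (fun b hb ↦ ?_) ?_
  · rw [PrimeSpectrum.mem_vanishingIdeal] at hb
    let L := Localization.Away (Ideal.Quotient.mk (Ideal.span {g}) (φ (s i)))
    have hred' : _root_.IsReduced L := isReduced_of_injective E.symm E.symm.injective
    let r : B →+* L := (algebraMap (B ⧸ Ideal.span {g}) L).comp (Ideal.Quotient.mk (Ideal.span {g}))
    -- Each prime of `L` restricts to a point of the locus defining the strict transform, so `b`
    -- lies in all of them, and `L` is reduced. The power of `s i` that remains is removed by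
    -- `hreg`.
    have h0 : r b = 0 := by
      rw [← Ideal.mem_bot, ← nilradical_eq_bot_iff.mpr hred', nilradical_eq_sInf, Ideal.mem_sInf]
      intro J hJ
      have : J.IsPrime := hJ
      have hJ' := hb ⟨J.comap r, inferInstance⟩ ⟨?_, ?_⟩
      · exact hJ'
      · change r (φ τ) ∈ J
        have : r g = 0 := by
          change algebraMap (B ⧸ Ideal.span {g}) L (Ideal.Quotient.mk (Ideal.span {g}) g) = 0
          rw [Ideal.Quotient.eq_zero_iff_mem.mpr (Ideal.mem_span_singleton_self g), map_zero]
        rw [hg, map_mul, this, mul_zero]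
        exact J.zero_mem
      · change r (φ (s i)) ∉ J
        intro hmem
        exact this.ne_top (Ideal.eq_top_of_isUnit_mem _ hmem
          (IsLocalization.Away.algebraMap_isUnit (Ideal.Quotient.mk (Ideal.span {g}) (φ (s i)))))
    obtain ⟨⟨_, N, rfl⟩, hN⟩ := (IsLocalization.map_eq_zero_iff
      (Submonoid.powers (Ideal.Quotient.mk (Ideal.span {g}) (φ (s i)))) L _).mp h0
    have hN' : φ (s i) ^ N * b ∈ Ideal.span {g} := by
      rw [← Ideal.Quotient.eq_zero_iff_mem, map_mul, map_pow]
      exact hN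
    clear hN
    induction N with
    | zero => simpa using hN'
    | succ N ih =>
      rw [pow_succ', mul_assoc] at hN'
      exact ih (hreg _ hN')
  · rw [Ideal.span_singleton_le_iff_mem, PrimeSpectrum.mem_vanishingIdeal]
    rintro x ⟨hx1, hx2⟩
    rw [hg] at hx1
    exact (x.isPrime.mem_or_mem hx1).resolve_left fun h ↦ hx2 (x.isPrime.mem_of_pow_mem _ h)

variable {O : Type u} [CommRing O] [IsLocalRing O] {φ₀ : O →+* A}

include h hg in
/-- The strict transform is smooth over the residue field if it is so along the exceptional divisor
and the original divisor is so away from the centre. -/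
lemma IsAffineBlowUp.isResidueSmooth_strictTransform [Finite ι] (hft : φ₀.FiniteType)
    (hm : ∀ x ∈ IsLocalRing.maximalIdeal O, φ₀ x ∈ Ideal.span {τ})
    (hreg : ∀ b, φ (s i) * b ∈ Ideal.span {g} → b ∈ Ideal.span {g})
    (h₁ : IsResidueSmooth ((Ideal.Quotient.mk (Ideal.span {φ (s i)} ⊔ Ideal.span {g})).comp
      (φ.comp φ₀)))
    (h₂ : IsResidueSmooth ((algebraMap _ (Localization.Away
      (Ideal.Quotient.mk (Ideal.span {τ}) (s i)))).comp
        ((Ideal.Quotient.mk (Ideal.span {τ})).comp φ₀))) :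
    IsResidueSmooth ((Ideal.Quotient.mk (Ideal.span {g})).comp (φ.comp φ₀)) := by
  obtain ⟨E, hE⟩ := h.exists_ringEquiv_away hg
  -- Modulo `s i` the strict transform becomes its intersection with the exceptional divisor; with
  -- `s i` inverted it becomes the original fibre off the centre.
  refine isResidueSmooth_of_quotient_of_away (u := Ideal.Quotient.mk _ (φ (s i)))
    ((RingHom.FiniteType.of_surjective _ Ideal.Quotient.mk_surjective).comp
      (h.finiteType.comp hft)) (fun x hx ↦ ?_) ?_ ?_ ?_
  · obtain ⟨c, hc⟩ := Ideal.mem_span_singleton'.mp (hm x hx)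
    rw [RingHom.comp_apply, RingHom.comp_apply, ← hc, map_mul, hg, Ideal.Quotient.eq_zero_iff_mem]
    exact Ideal.mul_mem_left _ _ (Ideal.mul_mem_left _ _ (Ideal.mem_span_singleton_self g))
  · rw [mem_nonZeroDivisors_iff_right]
    intro x hx
    obtain ⟨x, rfl⟩ := Ideal.Quotient.mk_surjective x
    rw [← map_mul, Ideal.Quotient.eq_zero_iff_mem, mul_comm] at hx
    exact Ideal.Quotient.eq_zero_iff_mem.mpr (hreg _ hx)
  · have hsurj := mk_surjective_comp (Ideal.Quotient.mk_surjective (I := Ideal.span {g}))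
      (Ideal.span {Ideal.Quotient.mk (Ideal.span {g}) (φ (s i))})
    have hker := ker_mk_comp (Ideal.Quotient.mk_surjective (I := Ideal.span {g})) (φ (s i))
    rw [Ideal.mk_ker, sup_comm] at hker
    exact (isResidueSmooth_quotient_iff hsurj hker).mp h₁
  · rw [← isResidueSmooth_ringEquiv_comp_iff E] at h₂
    convert h₂ using 1
    exact RingHom.ext fun x ↦ (hE _).symm

/-- Codimensions add for the intersection of two divisors. -/
lemma ringKrullDim_add_eq_of_sup [IsNoetherianRing B] {u : B} {I J K : Ideal B}
    (hI : I = Ideal.span {u}) (hK : K = I ⊔ J) (hu : u ∈ nonZeroDivisors B)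
    (hu' : ∀ b, u * b ∈ J → b ∈ J)
    (P : Ideal B) (Q : Ideal (B ⧸ K)) (Q₁ : Ideal (B ⧸ I)) (Q₂ : Ideal (B ⧸ J))
    [P.IsPrime] [Q.IsPrime] [Q₁.IsPrime] [Q₂.IsPrime]
    (hP : Q.comap (Ideal.Quotient.mk _) = P) (hP₁ : Q₁.comap (Ideal.Quotient.mk _) = P)
    (hP₂ : Q₂.comap (Ideal.Quotient.mk _) = P) :
    ringKrullDim (Localization.AtPrime Q) + ringKrullDim (Localization.AtPrime P) =
      ringKrullDim (Localization.AtPrime Q₁) + ringKrullDim (Localization.AtPrime Q₂) := by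
  have hmk {I : Ideal B} := Ideal.Quotient.mk_surjective (I := I)
  have h1 := ringKrullDim_localization_add_one hmk hu (Ideal.mk_ker.trans hI) P Q₁ hP₁.symm
  -- The element `u` is regular on `B` and on `B ⧸ J`, so the passages `B → B ⧸ I` and `B ⧸ J → B ⧸
  -- K` both lower the dimension by one.
  have h2 : ringKrullDim (Localization.AtPrime Q) + 1 = ringKrullDim (Localization.AtPrime Q₂) := by
    have hle : J ≤ K := hK ▸ le_sup_right
    refine ringKrullDim_localization_add_one (f := Ideal.Quotient.factor hle)
      (x := Ideal.Quotient.mk _ u) (Ideal.Quotient.factor_surjective hle) ?_ ?_ _ _ ?_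
    · rw [mem_nonZeroDivisors_iff_right]
      intro x hx
      obtain ⟨x, rfl⟩ := hmk x
      rw [← map_mul, Ideal.Quotient.eq_zero_iff_mem, mul_comm] at hx
      exact Ideal.Quotient.eq_zero_iff_mem.mpr (hu' _ hx)
    · rw [Ideal.Quotient.factor_ker, hK, Ideal.map_sup, Ideal.map_quotient_self, sup_bot_eq, hI,
        Ideal.map_span, Set.image_singleton]
    · refine Ideal.comap_injective_of_surjective _ hmk ?_
      rw [Ideal.comap_comap, hP₂, Ideal.Quotient.factor_comp_mk, hP]
  rw [← h1, ← h2, ← add_assoc, ← add_assoc, add_comm (ringKrullDim (Localization.AtPrime Q))]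

end StrictTransform


/-! ### Charts of blow-ups -/

section BlowUpCharts

open IsLocalRing

lemma IsAffineBlowUp.comp_ringEquiv {ι A A' B : Type*} [CommRing A] [CommRing A'] [CommRing B]
    {φ : A →+* B} {s : ι → A} {i : ι} {a : ι → B} (h : IsAffineBlowUp φ s i a) (e : A' ≃+* A) :
    IsAffineBlowUp (φ.comp (e : A' →+* A)) (fun j ↦ e.symm (s j)) i a where
  map_eq j := by simpa using h.map_eq j
  mem_nonZeroDivisors := by simpa using h.mem_nonZeroDivisors
  surjective b := by
    obtain ⟨P, rfl⟩ := h.surjective b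
    refine ⟨MvPolynomial.map (e.symm : A →+* A') P, ?_⟩
    rw [MvPolynomial.coe_eval₂Hom, MvPolynomial.eval₂_map, RingHom.comp_assoc,
      RingEquiv.comp_symm, RingHom.comp_id]
    rfl
  exists_pow_mul_eq_zero x hx := by
    obtain ⟨N, hN⟩ := h.exists_pow_mul_eq_zero (e x) hx
    refine ⟨N, e.injective ?_⟩
    rw [map_mul, map_pow, RingEquiv.apply_symm_apply, hN, map_zero]

variable {X Y : Scheme.{u}}

/-- The `s i` generate the ideal, so at each point over the chart one of them becomes a regular
generator; the corresponding affine blow-up algebra is an open chart there. -/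
lemma IsBlowUp.exists_charts {π : Y ⟶ X} {I : X.IdealSheafData} (hπ : IsBlowUp π I)
    {A : CommRingCat.{u}} (q₀ : Spec A ⟶ X) [IsOpenImmersion q₀] {ι : Type*} {s : ι → A}
    (hs : Ideal.span (Set.range s) = onChart q₀ I) {B : ι → CommRingCat.{u}} {φ : ∀ i, A ⟶ B i}
    {a : ∀ i, ι → B i} (h : ∀ i, IsAffineBlowUp (φ i).hom s i (a i)) :
    ∃ l : ∀ i, Spec (B i) ⟶ Y, (∀ i, l i ≫ π = Spec.map (φ i) ≫ q₀ ∧ IsOpenImmersion (l i)) ∧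
      ∀ y, π y ∈ Set.range q₀ → ∃ i, y ∈ Set.range (l i) := by
  let e := (chartIso q₀).commRingCatIsoToRingEquiv
  have hW := isAffineOpen_opensRange q₀
  have hs' : Ideal.span (Set.range fun j ↦ e.symm (s j)) = I.ideal ⟨q₀.opensRange, hW⟩ := by
    rw [Set.range_comp' e.symm s, ← Ideal.map_span, hs, onChart_eq_map_chartIso]
    exact Ideal.map_of_equiv e
  have h' : ∀ i, IsAffineBlowUp ((chartIso q₀).hom ≫ φ i).hom (fun j ↦ e.symm (s j)) i (a i) :=
    fun i ↦ (h i).comp_ringEquiv e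
  choose l hl hl' hl'' using fun i ↦ hπ.exists_chart (hW := hW) hs' (h' i)
  refine ⟨l, fun i ↦ ⟨?_, hl' i⟩, fun y hy ↦ ?_⟩
  · rw [hl, Spec.map_comp, Category.assoc, SpecMap_chartIso_fromSpec]
  · obtain ⟨i, hi⟩ := exists_genAt hπ.invertible hs' (x := y) hy
    exact ⟨i, (hl'' i).ge hi⟩

lemma onChart_reducedIdeal {A : CommRingCat.{u}} (q₀ : Spec A ⟶ X)
    [IsOpenImmersion q₀] (P : Set X) :
    onChart q₀ (reducedIdeal P) = PrimeSpectrum.vanishingIdeal (q₀ ⁻¹' P) := by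
  rw [reducedIdeal, onChart_vanishingIdeal, ← PrimeSpectrum.vanishingIdeal_closure (q₀ ⁻¹' P)]
  congr 1
  exact (q₀.isOpenEmbedding.isOpenMap.preimage_closure_eq_closure_preimage q₀.continuous P)

lemma apply_mem_iff_of_isClosed {A : CommRingCat.{u}} (q₀ : Spec A ⟶ X)
    [IsOpenImmersion q₀] {P : Set X} (hP : IsClosed P) (x : PrimeSpectrum A) :
    q₀ x ∈ P ↔ onChart q₀ (reducedIdeal P) ≤ x.asIdeal := by
  rw [onChart_reducedIdeal, ← SetLike.coe_subset_coe, ← PrimeSpectrum.mem_zeroLocus,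
    PrimeSpectrum.zeroLocus_vanishingIdeal_eq_closure]
  exact iff_of_eq (congrArg (x ∈ ·) (IsClosed.closure_eq (hP.preimage q₀.continuous)).symm)

lemma onChart_reducedIdeal_congr {P P' : Set X} {A : CommRingCat.{u}} (q₀ : Spec A ⟶ X)
    [IsOpenImmersion q₀] (h : q₀ ⁻¹' P = q₀ ⁻¹' P') :
    onChart q₀ (reducedIdeal P) = onChart q₀ (reducedIdeal P') :=
  (onChart_reducedIdeal q₀ P).trans
    ((congrArg PrimeSpectrum.vanishingIdeal h).trans (onChart_reducedIdeal q₀ P').symm)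

variable {O : Type u} [CommRing O] [IsLocalRing O] {t : O}
  (ht : maximalIdeal O = Ideal.span {t}) {f : X ⟶ Spec (.of O)}
  {A B : CommRingCat.{u}} {q₀ : Spec A ⟶ X} {φ₀ : O →+* A}
  (hq₀ : q₀ ≫ f = Spec.map (CommRingCat.ofHom φ₀))

include ht hq₀ in
lemma onChart_specialFibreIdeal : onChart q₀ (specialFibreIdeal f) = Ideal.span {φ₀ t} := by
  rw [specialFibreIdeal, specialFibreι, Scheme.IdealSheafData.ker_fst_of_isClosedImmersion,
    onChart_comap_eq_map (φ := CommRingCat.ofHom φ₀) (p := 𝟙 _) (by rw [hq₀, Category.comp_id]),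
    onChart_ker_closedPt, ht]
  exact (Ideal.map_span _ _).trans (by rw [Set.image_singleton]; rfl)

include ht hq₀ in
lemma apply_mem_specialFibre_iff (x : PrimeSpectrum A) :
    q₀ x ∈ Set.range (specialFibreι f) ↔ φ₀ t ∈ x.asIdeal := by
  have h1 : Set.range (closedPt O) = PrimeSpectrum.zeroLocus {t} := by
    have := range_comap_of_surjective _ (residue O) residue_surjective
    rw [ker_residue, ht, PrimeSpectrum.zeroLocus_span] at this
    exact this
  have h2 : ∀ z : Spec A, f (q₀ z) = Spec.map (CommRingCat.ofHom φ₀) z := fun z ↦ by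
    rw [← Scheme.Hom.comp_apply, hq₀]
  rw [specialFibreι, Scheme.Pullback.range_fst, h1]
  refine (iff_of_eq (congrArg (· ∈ PrimeSpectrum.zeroLocus {t}) (h2 x))).trans ?_
  exact Set.singleton_subset_iff

variable {ι : Type*} {φ : A ⟶ B} {s : ι → A} {i : ι} {a : ι → B}
  (h : IsAffineBlowUp φ.hom s i a) {e : ℕ} {g : B}
  (hg : φ.hom (φ₀ t) = φ.hom (s i) ^ e * g)

include ht hq₀ h hg in
-- On this chart the ideal of the centre is generated by `φ (s i)`, so the points over `X_σ \ P` are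
-- those where `φ (φ₀ t)` vanishes and `φ (s i)` does not.
lemma onChart_strictTransform [IsOpenImmersion q₀] {π : Y ⟶ X} {l : Spec B ⟶ Y} [IsOpenImmersion l]
    (hl : l ≫ π = Spec.map φ ≫ q₀) {P : Set X} (hP : IsClosed P)
    (hs : Ideal.span (Set.range s) = onChart q₀ (reducedIdeal P))
    (hreg : ∀ b, φ.hom (s i) * b ∈ Ideal.span {g} → b ∈ Ideal.span {g})
    (hred : _root_.IsReduced (Localization.Away (Ideal.Quotient.mk (Ideal.span {φ₀ t}) (s i)))) :
    onChart l (strictTransform π (Set.range (specialFibreι f)) P) = Ideal.span {g} := by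
  rw [strictTransform, onChart_reducedIdeal, ← h.vanishingIdeal_strictTransform hg hreg hred]
  congr 1
  ext x
  have hx : ∀ z : Spec B, π (l z) = q₀ (Spec.map φ z) := fun z ↦ by
    rw [← Scheme.Hom.comp_apply, hl, Scheme.Hom.comp_apply]
  have hx' := hx x
  refine and_congr ((iff_of_eq (congrArg (· ∈ _) hx')).trans
    (apply_mem_specialFibre_iff ht hq₀ (Spec.map φ x))) (not_congr
      ((iff_of_eq (congrArg (· ∈ P) hx')).trans
        ((apply_mem_iff_of_isClosed q₀ hP (Spec.map φ x)).trans ?_)))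
  rw [← hs]
  change _ ≤ x.asIdeal.comap φ.hom ↔ _
  rw [← Ideal.map_le_iff_le_comap, h.map_span_eq, Ideal.span_singleton_le_iff_mem]

end BlowUpCharts


/-! ### Smoothness and transversality on charts -/

section LocalCriteria

open IsLocalRing

variable {O : Type u} [CommRing O] [IsLocalRing O] {Y : Scheme.{u}} {g : Y ⟶ Spec (.of O)}

lemma IsSmoothOverResidue.isResidueSmooth {J : Y.IdealSheafData}
    (h : IsSmoothOverResidue (J.subschemeι ≫ g)) {B : CommRingCat.{u}} (l : Spec B ⟶ Y)
    [IsOpenImmersion l] {φ : O →+* B} (hφ : l ≫ g = Spec.map (CommRingCat.ofHom φ)) :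
    IsResidueSmooth ((Ideal.Quotient.mk (onChart l J)).comp φ) := by
  obtain ⟨h, hg, hsm⟩ := h
  have h1 : Smooth (chartι l J ≫ h) := inferInstance
  obtain ⟨ψ, hψ⟩ := Spec.map_surjective (chartι l J ≫ h)
  refine ⟨ψ.hom, ?_, ?_⟩
  · have : Spec.map ψ ≫ closedPt O = Spec.map (CommRingCat.ofHom φ ≫
        CommRingCat.ofHom (Ideal.Quotient.mk (onChart l J))) := by
      rw [hψ, Category.assoc, hg, chartι_subschemeι_assoc, hφ, ← Spec.map_comp]
    rw [closedPt, ← Spec.map_comp] at this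
    exact congrArg CommRingCat.Hom.hom (Spec.map_injective this)
  · rw [← hψ] at h1
    exact (HasRingHomProperty.Spec_iff (P := @Smooth)).mp h1

lemma isSmoothOverResidue_of_forall_exists_chart {J : Y.IdealSheafData}
    (H : ∀ y : Y, ∃ (B : CommRingCat.{u}) (l : Spec B ⟶ Y) (φ : O →+* B), IsOpenImmersion l ∧
      y ∈ Set.range l ∧ l ≫ g = Spec.map (CommRingCat.ofHom φ) ∧
      IsResidueSmooth ((Ideal.Quotient.mk (onChart l J)).comp φ)) :
    IsSmoothOverResidue (J.subschemeι ≫ g) := by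
  choose B l φ hl hy hφ h using H
  exact (isSmoothOverResidue_iff l (fun y ↦ ⟨y, hy y⟩) J g φ hφ).mpr h

/-- On each chart the intersection is either empty, or cut out on the second subscheme by an
equation `u` of the first that is regular both on the ambient ring and modulo `J`; then both
codimensions shift by one. -/
lemma meetTransversely_of_forall_exists_chart {I J : Y.IdealSheafData}
    (H : ∀ y : Y, ∃ (B : CommRingCat.{u}) (l : Spec B ⟶ Y) (φ : O →+* B), IsOpenImmersion l ∧
      y ∈ Set.range l ∧ l ≫ g = Spec.map (CommRingCat.ofHom φ) ∧
      IsResidueSmooth ((Ideal.Quotient.mk (onChart l (I ⊔ J))).comp φ) ∧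
      (onChart l (I ⊔ J) = ⊤ ∨ IsNoetherianRing B ∧ ∃ u ∈ nonZeroDivisors B,
        onChart l I = Ideal.span {u} ∧ ∀ b, u * b ∈ onChart l J → b ∈ onChart l J)) :
    MeetTransversely g I J where
  smooth := isSmoothOverResidue_of_forall_exists_chart fun y ↦ by
    obtain ⟨B, l, φ, h1, h2, h3, h4, -⟩ := H y
    exact ⟨B, l, φ, h1, h2, h3, h4⟩
  codim x y z hxy hxz := by
    obtain ⟨B, l, φ, hl, hr, -, -, h⟩ := H ((I ⊔ J).subschemeι x)
    have hz : ∀ (K : Y.IdealSheafData) (w : K.subscheme),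
        K.subschemeι w = (I ⊔ J).subschemeι x → ∃ w' : PrimeSpectrum (B ⧸ onChart l K),
          chartι l K w' = w ∧ l (PrimeSpectrum.comap (Ideal.Quotient.mk _) w') =
            (I ⊔ J).subschemeι x := fun K w hw ↦ by
      obtain ⟨w', rfl⟩ := exists_chartι_eq l K w (hw ▸ hr)
      refine ⟨w', rfl, ?_⟩
      rw [← hw, ← Scheme.Hom.comp_apply (chartι l K), chartι_subschemeι, Scheme.Hom.comp_apply]
      rfl
    obtain ⟨x', hx', hx⟩ := hz _ x rfl
    obtain ⟨y', rfl, hy⟩ := hz _ y hxy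
    obtain ⟨z', rfl, hz⟩ := hz _ z hxz
    have hlinj : Function.Injective l := l.isOpenEmbedding.injective
    have hy' := hlinj (hy.trans hx.symm)
    have hz' := hlinj (hz.trans hx.symm)
    obtain h | ⟨hB, u, hu, hI, hJ⟩ := h
    · exact (x'.isPrime.ne_top (eq_top_iff.mpr fun w _ ↦ by
        obtain ⟨w, rfl⟩ := Ideal.Quotient.mk_surjective w
        rw [Ideal.Quotient.eq_zero_iff_mem.mpr (h ▸ Submodule.mem_top)]
        exact x'.asIdeal.zero_mem)).elim
    · have h1 := ringKrullDim_stalk_chart l (PrimeSpectrum.comap (Ideal.Quotient.mk _) x')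
      have key := ringKrullDim_add_eq_of_sup hI (onChart_sup l I J) hu hJ
        (x'.asIdeal.comap (Ideal.Quotient.mk (onChart l (I ⊔ J)))) x'.asIdeal y'.asIdeal z'.asIdeal
        rfl (congrArg PrimeSpectrum.asIdeal hy') (congrArg PrimeSpectrum.asIdeal hz')
      rw [ringKrullDim_stalk_chartι, ringKrullDim_stalk_chartι, ← key]
      refine congrArg₂ (· + ·) ?_ ((congrArg (fun y ↦ ringKrullDim (Y.presheaf.stalk y))
        hx.symm).trans h1)
      rw [← hx', ringKrullDim_stalk_chartι]

end LocalCriteria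

/-! ### Conical charts -/

section ConicalChart

open IsLocalRing

variable {O : Type u} [CommRing O] [IsLocalRing O] {X : Scheme.{u}}

/-- An affine chart `q₀ : Spec A ⟶ X` around the closed point `p`, with residue map `χ : A → κ`, on
which the function `t` is given by a form `G` of degree `e` in the generators `s` of the maximal
ideal of `p`, which form a quasi-regular sequence; moreover the special fibre is smooth away from
`p`. -/
structure IsConicalChart (f : X ⟶ Spec (.of O)) (t : O) (p : X) {A : CommRingCat.{u}}
    (q₀ : Spec A ⟶ X) (φ₀ : O →+* A) {κ : Type u} [Field κ] (χ : A →+* κ) {n : ℕ}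
    (s : Fin (n + 1) → A) (e : ℕ) (G : MvPolynomial (Fin (n + 1)) A) : Prop where
  comp_eq : q₀ ≫ f = Spec.map (CommRingCat.ofHom φ₀)
  isNoetherianRing : IsNoetherianRing A
  finiteType : φ₀.FiniteType
  isQuasiRegular : IsQuasiRegular χ s
  ker_eq : onChart q₀ (reducedIdeal {p}) = RingHom.ker χ
  isHomogeneous : G.IsHomogeneous e
  eval_eq : φ₀ t = MvPolynomial.eval s G
  map_ne_zero : MvPolynomial.map χ G ≠ 0
  smooth_away : ∀ i, IsResidueSmooth ((algebraMap _ (Localization.Away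
      (Ideal.Quotient.mk (Ideal.span {φ₀ t}) (s i)))).comp
        ((Ideal.Quotient.mk (Ideal.span {φ₀ t})).comp φ₀))
  isSeparable : ∃ θ : ResidueField O →+* κ, θ.comp (residue O) = χ.comp φ₀ ∧
    letI := θ.toAlgebra; Algebra.IsSeparable (ResidueField O) κ

/-- A chart of a blow-up over a conical chart. -/
structure IsConicalBlowUpChart {Y : Scheme.{u}} (π : Y ⟶ X) {A B : CommRingCat.{u}}
    (q₀ : Spec A ⟶ X) {κ : Type u} [Field κ] (χ : A →+* κ) {n : ℕ} (s : Fin (n + 1) → A)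
    (i : Fin (n + 1)) (φ : A ⟶ B) (a : Fin (n + 1) → B) (ψ : B →+* chartRing κ i)
    (l : Spec B ⟶ Y) : Prop where
  isAffineBlowUp : IsAffineBlowUp φ.hom s i a
  comp_eq : ψ.comp φ.hom = (chartC κ i).comp χ
  map_coord : ∀ j, ψ (a j) = chartCoord κ i j
  surjective : Function.Surjective ψ
  ker_eq : RingHom.ker ψ = Ideal.span {φ.hom (s i)}
  comm : l ≫ π = Spec.map φ ≫ q₀
  isOpenImmersion : IsOpenImmersion l

variable {f : X ⟶ Spec (.of O)} {t : O} {p : X} {A : CommRingCat.{u}} {q₀ : Spec A ⟶ X}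
  {φ₀ : O →+* A} {κ : Type u} [Field κ] {χ : A →+* κ} {n : ℕ}
  {s : Fin (n + 1) → A} {e : ℕ} {G : MvPolynomial (Fin (n + 1)) A} {Y : Scheme.{u}}
  {π : Y ⟶ X} {P : Set X}

namespace IsConicalChart

variable (hc : IsConicalChart f t p q₀ φ₀ χ s e G)

include hc in
lemma exists_charts [IsOpenImmersion q₀] (hπ : IsBlowUp π (reducedIdeal P)) (hP : q₀ ⁻¹' P = q₀ ⁻¹' {p}) :
    ∃ (B : Fin (n + 1) → CommRingCat.{u}) (φ : ∀ i, A ⟶ B i) (a : ∀ i, Fin (n + 1) → B i)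
      (ψ : ∀ i, B i →+* chartRing κ i) (l : ∀ i, Spec (B i) ⟶ Y),
      (∀ i, IsConicalBlowUpChart π q₀ χ s i (φ i) (a i) (ψ i) (l i)) ∧
      ∀ y, π y ∈ Set.range q₀ → ∃ i, y ∈ Set.range (l i) := by
  have hs : Ideal.span (Set.range s) = onChart q₀ (reducedIdeal P) := by
    rw [onChart_reducedIdeal_congr q₀ hP, hc.ker_eq, hc.isQuasiRegular.span_eq]
  choose B φ a h using exists_isAffineBlowUp s
  choose ψ h1 h2 h3 h4 using fun i ↦
    (h i).exists_toStandardChart hc.isQuasiRegular (isStandardChart_chartRing (R := κ) i)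
  obtain ⟨l, hl, hl'⟩ := hπ.exists_charts q₀ hs (φ := fun i ↦ CommRingCat.ofHom (φ i)) h
  exact ⟨B, fun i ↦ CommRingCat.ofHom (φ i), a, ψ, l, fun i ↦
    ⟨h i, h1 i, h2 i, h3 i, h4 i, (hl i).1, (hl i).2⟩, hl'⟩

end IsConicalChart

namespace IsConicalBlowUpChart

variable {B : CommRingCat.{u}} {i : Fin (n + 1)} {φ : A ⟶ B} {a : Fin (n + 1) → B}
    {ψ : B →+* chartRing κ i} {l : Spec B ⟶ Y} (h : IsConicalBlowUpChart π q₀ χ s i φ a ψ l)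
    (hc : IsConicalChart f t p q₀ φ₀ χ s e G)

include h hc

lemma comp_eq_SpecMap : l ≫ π ≫ f = Spec.map (CommRingCat.ofHom (φ.hom.comp φ₀)) := by
  rw [← Category.assoc, h.comm, Category.assoc, hc.comp_eq, ← Spec.map_comp]
  rfl

lemma onChart_exceptionalDivisor : onChart l (exceptionalDivisor π p) =
    Ideal.span {φ.hom (s i)} := by
  rw [exceptionalDivisor, onChart_comap_eq_map h.comm, hc.ker_eq, ← hc.isQuasiRegular.span_eq,
    h.isAffineBlowUp.map_span_eq]

lemma map_eq_pow_mul : φ.hom (φ₀ t) = φ.hom (s i) ^ e * MvPolynomial.eval₂ φ.hom a G := by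
  rw [hc.eval_eq, eval₂_mul_pow_of_isHomogeneous φ.hom h.isAffineBlowUp.map_eq hc.isHomogeneous,
    mul_comm]

omit hc in
omit [CommRing O] [IsLocalRing O] in
lemma map_strictTransform : ψ (MvPolynomial.eval₂ φ.hom a G) =
    MvPolynomial.eval₂ (chartC κ i) (chartCoord κ i) (MvPolynomial.map χ G) :=
  IsAffineBlowUp.map_eval₂_eq h.comp_eq h.map_coord G

/-- A nonzero form keeps a nonzero dehomogenisation on every standard chart, so the strict transform
never contains a chart of the exceptional divisor. -/
lemma map_strictTransform_ne_zero : ψ (MvPolynomial.eval₂ φ.hom a G) ≠ 0 := by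
  rw [h.map_strictTransform]
  exact fun h0 ↦ hc.map_ne_zero
    ((isStandardChart_chartRing i).eq_zero _ _ (hc.isHomogeneous.map χ) h0)

lemma mem_span_of_mul_mem (b : B)
    (hb : φ.hom (s i) * b ∈ Ideal.span {MvPolynomial.eval₂ φ.hom a G}) :
    b ∈ Ideal.span {MvPolynomial.eval₂ φ.hom a G} :=
  have := (isStandardChart_chartRing (R := κ) i).isDomain
  mem_span_singleton_of_mul_mem h.ker_eq h.isAffineBlowUp.mem_nonZeroDivisors
    (h.map_strictTransform_ne_zero hc) hb

lemma onChart_strictTransform [IsOpenImmersion q₀] (ht : maximalIdeal O = Ideal.span {t}) (hP' : IsClosed P)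
    (hP : q₀ ⁻¹' P = q₀ ⁻¹' {p}) :
    onChart l (strictTransform π (Set.range (specialFibreι f)) P) =
      Ideal.span {MvPolynomial.eval₂ φ.hom a G} := by
  have := h.isOpenImmersion
  have hs : Ideal.span (Set.range s) = onChart q₀ (reducedIdeal P) := by
    rw [onChart_reducedIdeal_congr q₀ hP, hc.ker_eq, hc.isQuasiRegular.span_eq]
  exact SingleBlowUp.onChart_strictTransform ht hc.comp_eq h.isAffineBlowUp (h.map_eq_pow_mul hc)
    h.comm hP' hs (h.mem_span_of_mul_mem hc) (hc.smooth_away i).isReduced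

/-- The intersection of the exceptional divisor and the strict transform is a chart of the
projectivised tangent cone. -/
lemma isResidueSmooth_inter_iff :
    IsResidueSmooth ((Ideal.Quotient.mk (Ideal.span {φ.hom (s i)} ⊔
      Ideal.span {MvPolynomial.eval₂ φ.hom a G})).comp (φ.hom.comp φ₀)) ↔
    ((Ideal.Quotient.mk (Ideal.span {MvPolynomial.eval₂ (chartC κ i) (chartCoord κ i)
      (MvPolynomial.map χ G)})).comp (chartC κ i)).Smooth := by
  obtain ⟨θ, hθ, hsep⟩ := hc.isSeparable
  have hft : θ.FiniteType := by
    have : (θ.comp (residue O)).FiniteType := by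
      rw [hθ]
      exact (RingHom.FiniteType.of_surjective _ hc.isQuasiRegular.surjective).comp hc.finiteType
    exact this.of_comp_finiteType
  have hker := ker_mk_comp h.surjective (MvPolynomial.eval₂ φ.hom a G)
  rw [h.ker_eq] at hker
  rw [isResidueSmooth_quotient_iff (mk_surjective_comp h.surjective _) hker,
    ← isResidueSmooth_comp_iff hθ hft hsep, ← h.map_strictTransform]
  have : ψ.comp (φ.hom.comp φ₀) = (chartC κ i).comp (χ.comp φ₀) := by
    rw [← RingHom.comp_assoc, h.comp_eq, RingHom.comp_assoc]
  rw [RingHom.comp_assoc, this, RingHom.comp_assoc]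

/-- The divisor is a chart of projective space over `κ`, smooth over `κ` and therefore over the
residue field of `O`. -/
lemma isResidueSmooth_exceptionalDivisor :
    IsResidueSmooth ((Ideal.Quotient.mk (Ideal.span {φ.hom (s i)})).comp (φ.hom.comp φ₀)) := by
  obtain ⟨θ, hθ, hsep⟩ := hc.isSeparable
  have hft : θ.FiniteType := by
    have : (θ.comp (residue O)).FiniteType := by
      rw [hθ]
      exact (RingHom.FiniteType.of_surjective _ hc.isQuasiRegular.surjective).comp hc.finiteType
    exact this.of_comp_finiteType
  have : ψ.comp (φ.hom.comp φ₀) = (chartC κ i).comp (χ.comp φ₀) := by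
    rw [← RingHom.comp_assoc, h.comp_eq, RingHom.comp_assoc]
  rw [isResidueSmooth_quotient_iff h.surjective h.ker_eq, this,
    isResidueSmooth_comp_iff hθ hft hsep]
  exact (isStandardChart_chartRing i).smooth

lemma isNoetherianRing : IsNoetherianRing B := by
  have := hc.isNoetherianRing
  exact isNoetherianRing_of_surjective _ _ _ h.isAffineBlowUp.surjective

lemma isResidueSmooth_strictTransform (ht : maximalIdeal O = Ideal.span {t})
    (hF : ((Ideal.Quotient.mk (Ideal.span {MvPolynomial.eval₂ (chartC κ i) (chartCoord κ i)
      (MvPolynomial.map χ G)})).comp (chartC κ i)).Smooth) :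
    IsResidueSmooth ((Ideal.Quotient.mk (Ideal.span {MvPolynomial.eval₂ φ.hom a G})).comp
      (φ.hom.comp φ₀)) := by
  refine h.isAffineBlowUp.isResidueSmooth_strictTransform (h.map_eq_pow_mul hc) hc.finiteType
    (fun x hx ↦ ?_) (h.mem_span_of_mul_mem hc) ((h.isResidueSmooth_inter_iff hc).mpr hF)
    (hc.smooth_away i)
  rw [ht] at hx
  obtain ⟨c, rfl⟩ := Ideal.mem_span_singleton'.mp hx
  rw [map_mul]
  exact Ideal.mul_mem_left _ _ (Ideal.mem_span_singleton_self _)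

end IsConicalBlowUpChart

end ConicalChart


/-! ### The singular set -/

section SingularSet

open IsLocalRing

variable {O : Type u} [CommRing O] [IsLocalRing O] {X : Scheme.{u}} {f : X ⟶ Spec (.of O)}

lemma isClosed_singularSet (f : X ⟶ Spec (.of O)) : IsClosed (singularSet f) := by
  have h : IsClosed {y | IsSingularPoint f y} := by
    rw [← isOpen_compl_iff]
    refine isOpen_iff_forall_mem_open.mpr fun y hy ↦ ?_
    obtain ⟨U, hyU, hU⟩ := not_not.mp hy
    exact ⟨U, fun z hz ↦ not_not.mpr ⟨U, hz, hU⟩, U.2, hyU⟩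
  exact (Scheme.Hom.isClosedEmbedding (specialFibreι f)).isClosedMap _ h

/-- Every subset of a closed discrete set is closed. Isolated singular points are thus closed
points, so the separability assumption reaches all of them. -/
lemma isClosed_singleton_of_mem_singularSet (hd : _root_.IsDiscrete (singularSet f)) {p : X}
    (hp : p ∈ singularSet f) : IsClosed {p} := by
  obtain ⟨C, hC, h⟩ := isDiscrete_iff_forall_mem_exists_isClosed.mp hd {p}
    (Set.singleton_subset_iff.mpr hp)
  rw [← h]
  exact hC.inter (isClosed_singularSet f)

lemma singularSet_subset_range : singularSet f ⊆ Set.range (specialFibreι f) :=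
  Set.image_subset_range _ _

/-- Away from the singular points, the special fibre is smooth over the residue field. -/
lemma isResidueSmooth_of_disjoint_singularSet {t : O} (ht : maximalIdeal O = Ideal.span {t})
    {A : CommRingCat.{u}} {q : Spec A ⟶ X} [IsOpenImmersion q] {φ : O →+* A}
    (hq : q ≫ f = Spec.map (CommRingCat.ofHom φ)) (h : ∀ x, q x ∉ singularSet f) :
    IsResidueSmooth ((Ideal.Quotient.mk (Ideal.span {φ t})).comp φ) := by
  have hJ := onChart_specialFibreIdeal ht hq
  let e : specialFibre f ⟶ (specialFibreIdeal f).subscheme :=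
    (specialFibreι f).toImage
  have he : e ≫ (specialFibreIdeal f).subschemeι = specialFibreι f := (specialFibreι f).toImage_imageι
  have : IsIso e := inferInstanceAs (IsIso (specialFibreι f).toImage)
  let j := chartι q (specialFibreIdeal f) ≫ inv e
  have hj : j ≫ specialFibreι f = Spec.map (CommRingCat.ofHom (Ideal.Quotient.mk _)) ≫ q := by
    rw [← he, Category.assoc, IsIso.inv_hom_id_assoc, chartι_subschemeι]
  have hsm : Smooth (j ≫ specialFibreToResidue f) := by
    refine IsZariskiLocalAtSource.of_iSup_eq_top (P := @Smooth)
      (fun U : {U : (specialFibre f).Opens // Smooth (U.ι ≫ specialFibreToResidue f)} ↦ j ⁻¹ᵁ U.1)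
      ?_ ?_
    · rw [← top_le_iff]
      intro x _
      have hx : ¬ IsSingularPoint f (j x) := fun hx ↦ by
        refine h (Spec.map (CommRingCat.ofHom (Ideal.Quotient.mk _)) x) ⟨_, hx, ?_⟩
        rw [← Scheme.Hom.comp_apply, hj, Scheme.Hom.comp_apply]
      obtain ⟨U, hxU, hU⟩ := not_not.mp hx
      exact TopologicalSpace.Opens.mem_iSup.mpr ⟨⟨U, hU⟩, hxU⟩
    · rintro ⟨U, hU⟩
      have : (j ⁻¹ᵁ U).ι ≫ j ≫ specialFibreToResidue f =
          (j ∣_ U) ≫ U.ι ≫ specialFibreToResidue f := by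
        rw [morphismRestrict_ι_assoc]
      rw [this]
      infer_instance
  obtain ⟨ψ, hψ⟩ := Spec.map_surjective (j ≫ specialFibreToResidue f)
  rw [← hψ] at hsm
  rw [← hJ]
  refine ⟨ψ.hom, ?_, (HasRingHomProperty.Spec_iff (P := @Smooth)).mp hsm⟩
  have : Spec.map ψ ≫ closedPt O = Spec.map (CommRingCat.ofHom φ ≫
      CommRingCat.ofHom (Ideal.Quotient.mk (onChart q (specialFibreIdeal f)))) := by
    rw [hψ, Category.assoc, ← pullback.condition, ← Category.assoc, hj, Category.assoc, hq,
      ← Spec.map_comp]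
  rw [closedPt, ← Spec.map_comp] at this
  exact congrArg CommRingCat.Hom.hom (Spec.map_injective this)

/-- The same, for a principal open subset of a chart. -/
lemma isResidueSmooth_away {t : O} (ht : maximalIdeal O = Ideal.span {t})
    {A : CommRingCat.{u}} {q : Spec A ⟶ X} [IsOpenImmersion q] {φ : O →+* A}
    (hq : q ≫ f = Spec.map (CommRingCat.ofHom φ)) {a : A}
    (h : ∀ x : PrimeSpectrum A, a ∉ x.asIdeal → q x ∉ singularSet f) :
    IsResidueSmooth ((algebraMap _ (Localization.Away (Ideal.Quotient.mk (Ideal.span {φ t}) a))).comp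
      ((Ideal.Quotient.mk (Ideal.span {φ t})).comp φ)) := by
  let L := Localization.Away a
  let v : Spec (.of L) ⟶ Spec A := Spec.map (CommRingCat.ofHom (algebraMap A L))
  have : IsOpenImmersion v := inferInstance
  have h1 := isResidueSmooth_of_disjoint_singularSet (q := v ≫ q) (φ := (algebraMap A L).comp φ) ht
    (by rw [Category.assoc, hq, ← Spec.map_comp]; rfl) fun x ↦ h (v x) (fun hx ↦ by
      have : algebraMap A L a ∈ (show PrimeSpectrum L from x).asIdeal := hx
      exact (show PrimeSpectrum L from x).isPrime.ne_top
        (Ideal.eq_top_of_isUnit_mem _ this (IsLocalization.Away.algebraMap_isUnit a)))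
  have hI : Ideal.span {(algebraMap A L).comp φ t} = (Ideal.span {φ t}).map (algebraMap A L) := by
    rw [Ideal.map_span, Set.image_singleton]; rfl
  have : IsLocalization.Away (Ideal.Quotient.mk (Ideal.span {φ t}) a)
      (L ⧸ (Ideal.span {φ t}).map (algebraMap A L)) := by
    have : IsLocalization (Algebra.algebraMapSubmonoid (A ⧸ Ideal.span {φ t}) (Submonoid.powers a))
      (L ⧸ (Ideal.span {φ t}).map (algebraMap A L)) := inferInstance
    rwa [Algebra.algebraMapSubmonoid_powers] at this
  let E := IsLocalization.algEquiv (Submonoid.powers (Ideal.Quotient.mk (Ideal.span {φ t}) a))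
    (L ⧸ (Ideal.span {φ t}).map (algebraMap A L))
    (Localization.Away (Ideal.Quotient.mk (Ideal.span {φ t}) a))
  rw [hI] at h1
  rw [← isResidueSmooth_ringEquiv_comp_iff E.toRingEquiv] at h1
  convert h1 using 1
  exact RingHom.ext fun x ↦ (E.commutes (Ideal.Quotient.mk _ (φ x))).symm

omit [IsLocalRing O] in
-- Projective space is of finite type chart by chart, and immersions are locally of finite type.
lemma IsQuasiProjective.locallyOfFiniteType (h : IsQuasiProjective f) : LocallyOfFiniteType f := by
  obtain ⟨N, i, hi, rfl⟩ := h
  have : IsZariskiLocalAtSource (@LocallyOfFiniteType.{u}) :=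
    HasRingHomProperty.instIsZariskiLocalAtSource (Q := RingHom.FiniteType)
  have : LocallyOfFiniteType (projSpaceToSpec O N) := by
    rw [IsZariskiLocalAtSource.iff_of_openCover (P := @LocallyOfFiniteType)
      (openCoverOf (projChart O) exists_mem_range_projChart)]
    intro (j : Fin (N + 1))
    change LocallyOfFiniteType (projChart O j ≫ projSpaceToSpec O N)
    rw [projChart_projSpaceToSpec]
    refine (HasRingHomProperty.Spec_iff (P := @LocallyOfFiniteType)).mpr ?_
    change (chartC O j).FiniteType
    algebraize [chartC O j]
    exact Algebra.FiniteType.of_surjective (MvPolynomial.aeval (chartCoord O j))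
      (isStandardChart_chartRing j).surjective
  infer_instance

end SingularSet


/-! ### Spreading out from the local ring -/

section SpreadingOut

open IsLocalRing

variable {A R : Type*} [CommRing A] [CommRing R] [Algebra A R]

/-- Each of finitely many generators needs one denominator; their product serves for the whole
ideal. -/
lemma exists_forall_mul_mem_of_map_le (M : Submonoid A) [IsLocalization M R] {I J : Ideal A}
    (hI : I.FG) (h : I.map (algebraMap A R) ≤ J.map (algebraMap A R)) :
    ∃ m ∈ M, ∀ x ∈ I, m * x ∈ J := by
  classical
  have key : ∀ x ∈ I, ∃ m ∈ M, m * x ∈ J := fun x hx ↦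
    (IsLocalization.algebraMap_mem_map_algebraMap_iff M R _ _).mp (h (Ideal.mem_map_of_mem _ hx))
  obtain ⟨T, rfl⟩ := hI
  choose! m hm hm' using key
  refine ⟨∏ x ∈ T, m x, M.prod_mem fun x hx ↦ hm x (Ideal.subset_span hx), fun x hx ↦ ?_⟩
  have : Ideal.span (T : Set A) ≤ Submodule.colon J {∏ x ∈ T, m x} := by
    rw [Ideal.span_le]
    intro y hy
    rw [SetLike.mem_coe, Submodule.mem_colon_singleton, smul_eq_mul, ← Finset.mul_prod_erase T m hy,
      ← mul_assoc, mul_comm y]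
    exact Ideal.mul_mem_right _ _ (hm' y (Ideal.subset_span hy))
  have := this hx
  rwa [Submodule.mem_colon_singleton, smul_eq_mul, mul_comm] at this

variable [IsLocalRing R] {m : Ideal A} [hm : m.IsMaximal] [IsLocalization.AtPrime R m]

/-- Powers of a maximal ideal are primary: an element outside `m` is invertible modulo `m ^ e`. So
the order of vanishing at `p` is already visible on an affine neighbourhood. -/
lemma mem_pow_of_algebraMap_mem_pow {a : A} {e : ℕ}
    (h : algebraMap A R a ∈ maximalIdeal R ^ e) : a ∈ m ^ e := by
  rw [← IsLocalization.AtPrime.map_eq_maximalIdeal m R, ← Ideal.map_pow,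
    IsLocalization.algebraMap_mem_map_algebraMap_iff m.primeCompl] at h
  obtain ⟨b, hb, hab⟩ := h
  obtain ⟨y, hy⟩ := Ideal.IsMaximal.exists_inv hm hb
  obtain ⟨z, hz, hyz⟩ := hy
  obtain ⟨c, hc⟩ := sub_dvd_pow_sub_pow (1 : A) z e
  have h1 : a = a * z ^ e + y * c * (b * a) := by
    have : (1 : A) - z ^ e = y * b * c := by rw [one_pow] at hc; rw [hc, ← hyz]; ring
    linear_combination a * this
  rw [h1]
  exact add_mem (Ideal.mul_mem_left _ _ (Ideal.pow_mem_pow hz e)) (Ideal.mul_mem_left _ _ hab)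

omit hm [IsLocalization.AtPrime R m] in
variable (m) in
-- Denominators lie outside the maximal ideal `m`, hence are invertible modulo `m` before
-- localising.
lemma residue_comp_algebraMap_surjective [hm : m.IsMaximal] [IsLocalization.AtPrime R m] :
    Function.Surjective ((residue R).comp (algebraMap A R)) := by
  intro z
  obtain ⟨r, rfl⟩ := residue_surjective z
  obtain ⟨a, b, rfl⟩ := IsLocalization.exists_mk'_eq m.primeCompl r
  obtain ⟨y, z, hz, hyz⟩ := Ideal.IsMaximal.exists_inv hm b.2
  refine ⟨a * y, ?_⟩
  rw [RingHom.comp_apply, ← sub_eq_zero, ← map_sub, residue_eq_zero_iff]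
  have h1 : algebraMap A R (a * y) - IsLocalization.mk' R a b =
      - (algebraMap A R z * IsLocalization.mk' R a b) := by
    have h2 := IsLocalization.mk'_spec R a b
    have h3 : algebraMap A R y * algebraMap A R b + algebraMap A R z = 1 := by
      rw [← map_mul, ← map_add, hyz, map_one]
    rw [map_mul, ← h2]
    linear_combination (IsLocalization.mk' R a b) * h3
  rw [h1, neg_mem_iff]
  refine Ideal.mul_mem_right _ _ ?_
  rw [← IsLocalization.AtPrime.map_eq_maximalIdeal m R]
  exact Ideal.mem_map_of_mem _ hz

end SpreadingOut

/-! ### Conical charts exist -/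

section ConicalCharts

open IsLocalRing

variable {X : Scheme.{u}}

lemma SpecMap_ΓSpecIso_inv_appLE {R : CommRingCat.{u}} (g : X ⟶ Spec R) {W : X.Opens}
    (hW : IsAffineOpen W) :
    Spec.map ((Scheme.ΓSpecIso R).inv ≫ g.appLE ⊤ W le_top) = hW.fromSpec ≫ g := by
  rw [← IsAffineOpen.SpecMap_appLE_fromSpec g (isAffineOpen_top _) hW le_top, Spec.map_comp,
    IsAffineOpen.fromSpec_top]
  congr 1
  rw [Scheme.isoSpec_Spec_inv]

/-- The ring homomorphism corresponding to a morphism to an affine scheme. -/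
noncomputable def sectionsHom {R : Type u} [CommRing R] (g : X ⟶ Spec (.of R)) (W : X.Opens) :
    R →+* Γ(X, W) :=
  ((Scheme.ΓSpecIso (.of R)).inv ≫ g.appLE ⊤ W le_top).hom

lemma fromSpec_comp_eq {R : Type u} [CommRing R] (g : X ⟶ Spec (.of R)) {W : X.Opens}
    (hW : IsAffineOpen W) : hW.fromSpec ≫ g = Spec.map (CommRingCat.ofHom (sectionsHom g W)) :=
  (SpecMap_ΓSpecIso_inv_appLE g hW).symm

lemma sectionsHom_comp_SpecMap {R k : Type u} [CommRing R] [CommRing k] (g : X ⟶ Spec (.of R))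
    (α : k →+* R) {W : X.Opens} (hW : IsAffineOpen W) :
    sectionsHom (g ≫ Spec.map (CommRingCat.ofHom α)) W = (sectionsHom g W).comp α := by
  have h := fromSpec_comp_eq (g ≫ Spec.map (CommRingCat.ofHom α)) hW
  rw [← Category.assoc, fromSpec_comp_eq g hW, ← Spec.map_comp] at h
  exact congrArg CommRingCat.Hom.hom (Spec.map_injective h).symm

lemma SpecMap_evaluation_fromSpec {W : X.Opens} (hW : IsAffineOpen W) {p : X} (hp : p ∈ W) :
    Spec.map (X.evaluation W p hp) ≫ hW.fromSpec = X.fromSpecResidueField p := by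
  rw [← Scheme.germ_residue, Spec.map_comp, Category.assoc, Scheme.fromSpecResidueField,
    ← hW.fromSpecStalk_eq_fromSpecStalk hp]
  rfl

variable {O : Type u} [CommRing O] [IsLocalRing O] {f : X ⟶ Spec (.of O)}

omit [IsLocalRing O] in
lemma germ_sectionsHom (t : O) {W : X.Opens} {p : X} (hp : p ∈ W) :
    (X.presheaf.germ W p hp).hom (sectionsHom f W t) = pullbackGerm f t p := by
  rw [pullbackGerm, ← X.presheaf.germ_res (homOfLE le_top : W ⟶ ⊤) p hp]
  rfl

/-- The residue field of `p` in `X` embeds in that of the corresponding closed point `y` of the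
fibre. Through this embedding the map from `O` kills the maximal ideal, and a subextension of a
separable extension is separable. -/
lemma exists_isSeparable_residueField (hd : _root_.IsDiscrete (singularSet f))
    (hsep : ∀ y : specialFibre f, IsClosed {y} → IsSingularPoint f y →
      HasSeparableResidueField f y) {p : X} (hp : p ∈ singularSet f) :
    ∃ θ : ResidueField O →+* X.residueField p,
      X.fromSpecResidueField p ≫ f = Spec.map (CommRingCat.ofHom (θ.comp (residue O))) ∧
      letI := θ.toAlgebra; Algebra.IsSeparable (ResidueField O) (X.residueField p) := by
  have hcl := isClosed_singleton_of_mem_singularSet hd hp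
  obtain ⟨y, hy, rfl⟩ := hp
  have hycl : IsClosed {y} := by
    have : {y} = specialFibreι f ⁻¹' {specialFibreι f y} := by
      ext z
      exact ((Scheme.Hom.isClosedEmbedding (specialFibreι f)).injective.eq_iff (a := z)).symm
    rw [this]
    exact hcl.preimage (specialFibreι f).continuous
  have hs := hsep y hycl hy
  let ρ : X.residueField (specialFibreι f y) ⟶ (specialFibre f).residueField y :=
    (specialFibreι f).residueFieldMap y
  obtain ⟨α, hα⟩ := Spec.map_surjective (X.fromSpecResidueField (specialFibreι f y) ≫ f)
  obtain ⟨β, hβ⟩ := Spec.map_surjective ((specialFibre f).fromSpecResidueField y ≫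
      specialFibreToResidue f)
  have hβ' : Spec.preimage ((specialFibre f).fromSpecResidueField y ≫
      specialFibreToResidue f) = β := by rw [← hβ, Spec.preimage_map]
  have h1 : α ≫ ρ = CommRingCat.ofHom (residue O) ≫ β := by
    apply Spec.map_injective
    rw [Spec.map_comp, Spec.map_comp, hα, hβ, Category.assoc, ← closedPt, ← pullback.condition,
      ← Category.assoc, ← Category.assoc, Scheme.Hom.SpecMap_residueFieldMap_fromSpecResidueField]
  have h2 : ∀ x, ρ.hom (α.hom x) = β.hom (residue O x) := fun x ↦ congr($h1 x)
  have hinj : Function.Injective ρ.hom := ρ.hom.injective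
  let θ : ResidueField O →+* X.residueField (specialFibreι f y) :=
    Ideal.Quotient.lift _ α.hom fun x hx ↦ hinj (by
      rw [h2, (residue_eq_zero_iff x).mpr hx, map_zero, map_zero])
  have hθ : θ.comp (residue O) = α.hom := Ideal.Quotient.lift_comp_mk _ _ _
  have hβθ : ρ.hom.comp θ = β.hom := by
    refine (RingHom.cancel_right residue_surjective).mp (RingHom.ext fun x ↦ ?_)
    rw [RingHom.comp_assoc, hθ]
    exact h2 x
  refine ⟨θ, by rw [hθ]; exact hα.symm, ?_⟩
  unfold HasSeparableResidueField at hs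
  rw [hβ'] at hs
  let : Algebra (ResidueField O) (X.residueField (specialFibreι f y)) := θ.toAlgebra
  let : Algebra (ResidueField O) ((specialFibre f).residueField y) := β.hom.toAlgebra
  let : Algebra (X.residueField (specialFibreι f y)) ((specialFibre f).residueField y) :=
    ρ.hom.toAlgebra
  have : IsScalarTower (ResidueField O) (X.residueField (specialFibreι f y))
    ((specialFibre f).residueField y) := .of_algebraMap_eq fun x ↦ congr($hβθ x).symm
  have : Algebra.IsSeparable (ResidueField O) ((specialFibre f).residueField y) := hs
  exact Algebra.isSeparable_tower_bot_of_isSeparable (ResidueField O) _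
    ((specialFibre f).residueField y)

variable {k₀ : Type u} [Field k₀] [Algebra k₀ O] [Algebra.IsSeparable k₀ (ResidueField O)]

omit [IsLocalRing O] [Algebra.IsSeparable k₀ (ResidueField O)] in
lemma isNoetherianRing_sections
    (hsm : IsEssSmooth (f ≫ Spec.map (CommRingCat.ofHom (algebraMap k₀ O)))) {W : X.Opens}
    (hW : IsAffineOpen W) : IsNoetherianRing Γ(X, W) := by
  have h := (hsm ⟨W, hW⟩).1
  algebraize [((Scheme.ΓSpecIso (.of k₀)).inv ≫
    (f ≫ Spec.map (CommRingCat.ofHom (algebraMap k₀ O))).appLE ⊤ W le_top).hom]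
  exact Algebra.EssFiniteType.isNoetherianRing k₀ _

omit [IsLocalRing O] [Algebra.IsSeparable k₀ (ResidueField O)] in
lemma isNoetherianRing_stalk
    (hsm : IsEssSmooth (f ≫ Spec.map (CommRingCat.ofHom (algebraMap k₀ O)))) (p : X) :
    IsNoetherianRing (X.presheaf.stalk p) := by
  obtain ⟨W, hW, hp, -⟩ := exists_affine_le (T := X) (U := ⊤) (x := p) trivial
  have := isNoetherianRing_sections hsm hW
  let : Algebra Γ(X, W) (X.presheaf.stalk p) := (X.presheaf.germ W p hp).hom.toAlgebra
  have : IsLocalization.AtPrime (X.presheaf.stalk p) (hW.primeIdealOf ⟨p, hp⟩).asIdeal :=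
    hW.isLocalization_stalk ⟨p, hp⟩
  exact IsLocalization.isNoetherianRing (hW.primeIdealOf ⟨p, hp⟩).asIdeal.primeCompl _ inferInstance

/-- The separable extensions `k₀ → k → k(p)` make `k(p)` formally smooth over `k₀`, and the stalk is
so as a localisation of an essentially smooth algebra. -/
lemma isQuasiRegularSystem_stalk
    (hsm : IsEssSmooth (f ≫ Spec.map (CommRingCat.ofHom (algebraMap k₀ O))))
    (hd : _root_.IsDiscrete (singularSet f))
    (hsep : ∀ y : specialFibre f, IsClosed {y} → IsSingularPoint f y →
      HasSeparableResidueField f y) {p : X} (hp : p ∈ singularSet f) {n : ℕ}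
    {s : Fin n → X.presheaf.stalk p}
    (hs : Ideal.span (Set.range s) = maximalIdeal (X.presheaf.stalk p))
    (hn : Module.finrank (ResidueField (X.presheaf.stalk p))
      (CotangentSpace (X.presheaf.stalk p)) = n) : IsQuasiRegularSystem s := by
  obtain ⟨W, hW, hpW, -⟩ := exists_affine_le (T := X) (U := ⊤) (x := p) trivial
  obtain ⟨θ, hθ, hθs⟩ := exists_isSeparable_residueField hd hsep hp
  have h : (sectionsHom (f ≫ Spec.map (CommRingCat.ofHom (algebraMap k₀ O))) W).FormallySmooth :=
    (hsm ⟨W, hW⟩).2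
  rw [sectionsHom_comp_SpecMap f _ hW] at h
  let : Algebra k₀ Γ(X, W) := ((sectionsHom f W).comp (algebraMap k₀ O)).toAlgebra
  have : Algebra.FormallySmooth k₀ Γ(X, W) := h
  let : Algebra k₀ (X.presheaf.stalk p) :=
    ((X.presheaf.germ W p hpW).hom.comp ((sectionsHom f W).comp (algebraMap k₀ O))).toAlgebra
  let : Algebra Γ(X, W) (X.presheaf.stalk p) := (X.presheaf.germ W p hpW).hom.toAlgebra
  have : IsScalarTower k₀ Γ(X, W) (X.presheaf.stalk p) := .of_algebraMap_eq fun _ ↦ rfl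
  have : IsLocalization.AtPrime (X.presheaf.stalk p) (hW.primeIdealOf ⟨p, hpW⟩).asIdeal :=
    hW.isLocalization_stalk ⟨p, hpW⟩
  have : Algebra.FormallySmooth Γ(X, W) (X.presheaf.stalk p) :=
    .of_isLocalization (hW.primeIdealOf ⟨p, hpW⟩).asIdeal.primeCompl
  have : Algebra.FormallySmooth k₀ (X.presheaf.stalk p) := .comp k₀ Γ(X, W) _
  let : Algebra (ResidueField O) (ResidueField (X.presheaf.stalk p)) := θ.toAlgebra
  have : Algebra.IsSeparable (ResidueField O) (ResidueField (X.presheaf.stalk p)) := hθs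
  have e : θ.comp (residue O) = (X.evaluation W p hpW).hom.comp (sectionsHom f W) := by
    rw [← SpecMap_evaluation_fromSpec hW hpW, Category.assoc, fromSpec_comp_eq,
      ← Spec.map_comp] at hθ
    exact (congrArg CommRingCat.Hom.hom (Spec.map_injective hθ)).symm
  have : IsScalarTower k₀ (ResidueField O) (ResidueField (X.presheaf.stalk p)) :=
    .of_algebraMap_eq fun x ↦ congr($e (algebraMap k₀ O x)).symm
  have : Algebra.FormallyEtale k₀ (ResidueField O) := .of_isSeparable _ _
  have : Algebra.FormallyEtale (ResidueField O) (ResidueField (X.presheaf.stalk p)) :=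
    .of_isSeparable _ _
  have : Algebra.FormallySmooth k₀ (ResidueField (X.presheaf.stalk p)) :=
    .comp k₀ (ResidueField O) _
  exact .of_formallySmooth k₀ hs (by rw [hn, Fintype.card_fin])

end ConicalCharts


/-! ### Existence of conical charts -/

section ExistsConicalChart

open IsLocalRing

variable {X : Scheme.{u}}

lemma ker_evaluation {W : X.Opens} (hW : IsAffineOpen W) {p : X} (hp : p ∈ W) :
    RingHom.ker (X.evaluation W p hp).hom = (hW.primeIdealOf ⟨p, hp⟩).asIdeal := by
  rw [hW.primeIdealOf_eq_map_closedPoint]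
  ext x
  exact residue_eq_zero_iff _

lemma ideal_reducedIdeal_singleton {W : X.Opens} (hW : IsAffineOpen W) {p : X} (hp : p ∈ W) :
    (reducedIdeal {p}).ideal ⟨W, hW⟩ = RingHom.ker (X.evaluation W p hp).hom := by
  rw [← onChart_fromSpec hW, onChart_reducedIdeal, ker_evaluation hW hp]
  have : hW.fromSpec ⁻¹' {p} = {hW.primeIdealOf ⟨p, hp⟩} := Set.ext fun x ↦
    ⟨fun h ↦ hW.fromSpec.isOpenEmbedding.injective
      (h.trans (hW.fromSpec_primeIdealOf ⟨p, hp⟩).symm),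
      fun h ↦ h ▸ hW.fromSpec_primeIdealOf ⟨p, hp⟩⟩
  exact (congrArg PrimeSpectrum.vanishingIdeal this).trans
    (PrimeSpectrum.vanishingIdeal_singleton _)

/-- Generators of the maximal ideal of a closed point extend to generators of the ideal of that
point on a suitable affine neighbourhood. -/
lemma exists_span_eq_ker_evaluation {p : X} {n : ℕ} {s : Fin n → X.presheaf.stalk p}
    (hs : Ideal.span (Set.range s) = maximalIdeal (X.presheaf.stalk p)) {V : X.Opens} (hV : p ∈ V)
    (hN : ∀ W : X.Opens, IsAffineOpen W → IsNoetherianRing Γ(X, W)) :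
    ∃ (W : X.Opens) (_ : IsAffineOpen W) (hp : p ∈ W) (s' : Fin n → Γ(X, W)), W ≤ V ∧
      (∀ j, (X.presheaf.germ W p hp).hom (s' j) = s j) ∧
      Ideal.span (Set.range s') = RingHom.ker (X.evaluation W p hp).hom := by
  choose U hU σ hσ using fun j ↦ X.presheaf.exists_germ_eq (s j)
  have hp₀ : p ∈ Finset.univ.inf U ⊓ V := by
    refine ⟨?_, hV⟩
    rw [SetLike.mem_coe, ← SetLike.mem_coe, TopologicalSpace.Opens.coe_finset_inf]
    simpa using hU
  obtain ⟨W₁, hW₁, hp₁, hle₁⟩ := exists_affine_le hp₀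
  have hleU : ∀ j, W₁ ≤ U j := fun j ↦
    (hle₁.trans inf_le_left).trans (Finset.inf_le (Finset.mem_univ j))
  let σ₁ : Fin n → Γ(X, W₁) := fun j ↦ (X.presheaf.map (homOfLE (hleU j)).op).hom (σ j)
  have hσ₁ : ∀ j, (X.presheaf.germ W₁ p hp₁).hom (σ₁ j) = s j := fun j ↦
    (X.presheaf.germ_res_apply (homOfLE (hleU j)) p hp₁ (σ j)).trans (hσ j)
  let : Algebra Γ(X, W₁) (X.presheaf.stalk p) := (X.presheaf.germ W₁ p hp₁).hom.toAlgebra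
  have : IsLocalization.AtPrime (X.presheaf.stalk p) (hW₁.primeIdealOf ⟨p, hp₁⟩).asIdeal :=
    hW₁.isLocalization_stalk ⟨p, hp₁⟩
  set m := (hW₁.primeIdealOf ⟨p, hp₁⟩).asIdeal with hm
  have := hN W₁ hW₁
  -- The extended functions generate the ideal of `p` after localising at `p`; as this ideal is
  -- finitely generated, inverting one function `g` not vanishing at `p` suffices.
  obtain ⟨g, hg, hgm⟩ := exists_forall_mul_mem_of_map_le (R := X.presheaf.stalk p) m.primeCompl
    (J := Ideal.span (Set.range σ₁)) (IsNoetherian.noetherian m) (by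
      rw [IsLocalization.AtPrime.map_eq_maximalIdeal m, Ideal.map_span, ← Set.range_comp, ← hs]
      refine le_of_eq (congrArg (fun v ↦ Ideal.span (Set.range v)) (funext fun j ↦ (hσ₁ j).symm)))
  have hp₂ : p ∈ X.basicOpen g := by
    rw [Scheme.mem_basicOpen'']
    exact ⟨hp₁, IsLocalization.map_units (X.presheaf.stalk p) (⟨g, hg⟩ : m.primeCompl)⟩
  have hle₂ : X.basicOpen g ≤ W₁ := X.basicOpen_le g
  let r : Γ(X, W₁) →+* Γ(X, X.basicOpen g) := (X.presheaf.map (homOfLE hle₂).op).hom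
  have hgerm : ∀ j, (X.presheaf.germ _ p hp₂).hom (r (σ₁ j)) = s j := fun j ↦
    (X.presheaf.germ_res_apply (homOfLE hle₂) p hp₂ (σ₁ j)).trans (hσ₁ j)
  refine ⟨X.basicOpen g, hW₁.basicOpen g, hp₂, fun j ↦ r (σ₁ j),
    hle₂.trans (hle₁.trans inf_le_right), hgerm, le_antisymm ?_ ?_⟩
  · rw [Ideal.span_le]
    rintro _ ⟨j, rfl⟩
    change residue _ ((X.presheaf.germ _ p hp₂).hom (r (σ₁ j))) = 0
    rw [hgerm, residue_eq_zero_iff, ← hs]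
    exact Ideal.subset_span ⟨j, rfl⟩
  · rw [← ideal_reducedIdeal_singleton (hW₁.basicOpen g) hp₂]
    have h1 := (reducedIdeal {p}).map_ideal (U := ⟨_, hW₁.basicOpen g⟩) (V := ⟨_, hW₁⟩) hle₂
    rw [← h1, ideal_reducedIdeal_singleton hW₁ hp₁, ker_evaluation hW₁ hp₁, Ideal.map_le_iff_le_comap]
    intro x hx
    have hu : IsUnit (r g) := RingedSpace.isUnit_res_basicOpen _ g
    have h2 : r (g * x) ∈ (Ideal.span (Set.range σ₁)).map r := Ideal.mem_map_of_mem _ (hgm x hx)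
    rw [Ideal.map_span, ← Set.range_comp, map_mul] at h2
    exact (Ideal.unit_mul_mem_iff_mem _ hu).mp h2

variable {O : Type u} [CommRing O] [IsLocalRing O] {f : X ⟶ Spec (.of O)}
  {k₀ : Type u} [Field k₀] [Algebra k₀ O] [Algebra.IsSeparable k₀ (ResidueField O)]

/-- On an affine neighbourhood containing no other singular point, the `s_j` extend to generators of
the ideal `m` of `p`. Since `m ^ e` is primary, `f^*(t)` lies in it there, so it equals the value of
a form `G` with no error term. Quasi-regularity forces the reduction of `G` to be the given leading
form. -/
theorem exists_isConicalChart {t : O} (ht : maximalIdeal O = Ideal.span {t})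
    [LocallyOfFiniteType f]
    (hsm : IsEssSmooth (f ≫ Spec.map (CommRingCat.ofHom (algebraMap k₀ O))))
    (hd : _root_.IsDiscrete (singularSet f))
    (hsep : ∀ y : specialFibre f, IsClosed {y} → IsSingularPoint f y →
      HasSeparableResidueField f y) {p : X} (hp : p ∈ singularSet f) {n e : ℕ}
    {s : Fin (n + 1) → X.presheaf.stalk p} {F : MvPolynomial (Fin (n + 1)) (X.residueField p)}
    (hF : IsLeadingForm (pullbackGerm f t p) s e F) :
    ∃ (W : X.Opens) (hW : IsAffineOpen W) (hpW : p ∈ W) (s' : Fin (n + 1) → Γ(X, W))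
      (G : MvPolynomial (Fin (n + 1)) Γ(X, W)),
      (∀ j, (X.presheaf.germ W p hpW).hom (s' j) = s j) ∧
      (W : Set X) ∩ singularSet f ⊆ {p} ∧
      MvPolynomial.map (X.evaluation W p hpW).hom G = F ∧
      IsConicalChart f t p hW.fromSpec (sectionsHom f W) (X.evaluation W p hpW).hom s' e G := by
  obtain ⟨V, hV, hVp⟩ := isDiscrete_iff_forall_mem_exists_isOpen.mp hd p hp
  have hcl := isClosed_singleton_of_mem_singularSet hd hp
  obtain ⟨W, hW, hpW, s', hWV, hs', hspan⟩ := exists_span_eq_ker_evaluation hF.span_eq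
    (V := ⟨V, hV⟩) (hVp.ge rfl).1 fun W hW ↦ isNoetherianRing_sections hsm hW
  have hWp : (W : Set X) ∩ singularSet f ⊆ {p} :=
    (Set.inter_subset_inter_left _ hWV).trans hVp.le
  let : Algebra Γ(X, W) (X.presheaf.stalk p) := (X.presheaf.germ W p hpW).hom.toAlgebra
  have : IsLocalization.AtPrime (X.presheaf.stalk p) (hW.primeIdealOf ⟨p, hpW⟩).asIdeal :=
    hW.isLocalization_stalk ⟨p, hpW⟩
  have hmax : (hW.primeIdealOf ⟨p, hpW⟩).asIdeal.IsMaximal :=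
    hW.primeIdealOf_isMaximal_of_isClosed ⟨p, hpW⟩ hcl
  have hs'' : (fun j ↦ algebraMap Γ(X, W) (X.presheaf.stalk p) (s' j)) = s := funext hs'
  have hsys := isQuasiRegularSystem_stalk hsm hd hsep hp hF.span_eq hF.finrank_eq
  have hQ : IsQuasiRegular (X.evaluation W p hpW).hom s' :=
    IsQuasiRegularSystem.isQuasiRegular (R := X.presheaf.stalk p) (hs''.symm ▸ hsys)
      (residue_comp_algebraMap_surjective (hW.primeIdealOf ⟨p, hpW⟩).asIdeal) hspan
  have hτ : algebraMap Γ(X, W) (X.presheaf.stalk p) (sectionsHom f W t) = pullbackGerm f t p :=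
    germ_sectionsHom t hpW
  have hmem : sectionsHom f W t ∈ (Ideal.span (Set.range s')) ^ e := by
    rw [hspan, ker_evaluation hW hpW]
    refine mem_pow_of_algebraMap_mem_pow (R := X.presheaf.stalk p) ?_
    rw [hτ]
    exact hF.order.1
  obtain ⟨G, hG, hGe⟩ :=
    (Ideal.mem_span_pow_iff_exists_isHomogeneous s' _).mp hmem
  obtain ⟨G', hG', hG'F, hG'e⟩ := hF.represents
  -- The difference between `G` and the given representative `G'` takes a value in `m ^ (e + 1)` at
  -- `s`, so its reduction vanishes.
  have hGF : MvPolynomial.map (X.evaluation W p hpW).hom G = F := by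
    have h1 : MvPolynomial.eval s (MvPolynomial.map (algebraMap Γ(X, W) (X.presheaf.stalk p)) G) =
        pullbackGerm f t p := by
      rw [← hτ, ← hGe, ← hs'', MvPolynomial.eval_map]
      exact (MvPolynomial.eval₂_comp_left (algebraMap Γ(X, W) (X.presheaf.stalk p)) (RingHom.id _)
        s' G).symm
    have h2 : MvPolynomial.map (residue _)
        (MvPolynomial.map (algebraMap Γ(X, W) (X.presheaf.stalk p)) G - G') = 0 := by
      refine hsys.map_eq_zero e _ ((hG.map _).sub hG') ?_
      rw [map_sub, h1]
      exact hG'e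
    rw [map_sub, sub_eq_zero, MvPolynomial.map_map] at h2
    exact h2.trans hG'F
  refine ⟨W, hW, hpW, s', G, hs', hWp, hGF, fromSpec_comp_eq f hW,
    isNoetherianRing_sections hsm hW, ?_, hQ, ?_, hG, hGe.symm, ?_, fun i ↦ ?_, ?_⟩
  · have h := (HasRingHomProperty.Spec_iff (P := @LocallyOfFiniteType)
      (φ := CommRingCat.ofHom (sectionsHom f W))).mp (by
        rw [← fromSpec_comp_eq f hW]; infer_instance)
    exact h
  · rw [onChart_fromSpec, ideal_reducedIdeal_singleton hW hpW]
  -- A zero leading form would give `f^*(t)` order at least `e + 1`, against maximality of `e`.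
  · rw [hGF]
    rintro rfl
    have h1 := eval_mem_pow_of_map_residue_eq_zero hF.span_eq hG' hG'F
    have h2 : pullbackGerm f t p ∈ maximalIdeal (X.presheaf.stalk p) ^ (e + 1) :=
      (Submodule.sub_mem_iff_left _ h1).mp hG'e
    have h3 : e + 1 ∈ {i : ℕ | pullbackGerm f t p ∈ maximalIdeal (X.presheaf.stalk p) ^ i} := h2
    exact absurd (hF.order.2 h3) (Nat.not_succ_le_self e)
  -- A point where `s' i` does not vanish differs from `p`, the only singular point on this chart.
  · refine isResidueSmooth_away ht (fromSpec_comp_eq f hW) fun x hx hxP ↦ hx ?_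
    have hxW : hW.fromSpec x ∈ (W : Set X) := by
      rw [← hW.range_fromSpec]; exact ⟨x, rfl⟩
    have h1 := (apply_mem_iff_of_isClosed hW.fromSpec hcl x).mp (hWp ⟨hxW, hxP⟩)
    rw [onChart_fromSpec, ideal_reducedIdeal_singleton hW hpW, ← hspan] at h1
    exact h1 (Ideal.subset_span ⟨i, rfl⟩)
  · obtain ⟨θ, hθ, hθs⟩ := exists_isSeparable_residueField hd hsep hp
    refine ⟨θ, ?_, hθs⟩
    rw [← SpecMap_evaluation_fromSpec hW hpW, Category.assoc, fromSpec_comp_eq f hW,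
      ← Spec.map_comp] at hθ
    exact (congrArg CommRingCat.Hom.hom (Spec.map_injective hθ)).symm

end ExistsConicalChart


/-! ### Reducedness of the special fibre -/

section ReducedAlgebra

open IsLocalRing

variable {A R : Type*} [CommRing A] [CommRing R] [Algebra A R] {n : ℕ} {s : Fin (n + 1) → A}

/-- Off `V(s)` the quotient is reduced, so a nilpotent is killed by powers of all the `s i`. As `n ≠
0` there are at least two of them, and positive depth makes the nilpotent vanish at `m`; at every
other maximal ideal some `s i` is invertible. -/
lemma isReduced_quotient_of_isQuasiRegularSystem [IsLocalRing R] [IsNoetherianRing R]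
    (m : Ideal A) [hm : m.IsMaximal] [IsLocalization.AtPrime R m]
    (hspan : Ideal.span (Set.range s) = m)
    (hs : IsQuasiRegularSystem fun j ↦ algebraMap A R (s j)) (hn : n ≠ 0) {τ : A}
    (hτ : algebraMap A R τ ≠ 0)
    (hred : ∀ i, _root_.IsReduced (Localization.Away (Ideal.Quotient.mk (Ideal.span {τ}) (s i)))) :
    _root_.IsReduced (A ⧸ Ideal.span {τ}) := by
  rw [isReduced_iff_pow_one_lt 2 one_lt_two]
  intro b hb
  obtain ⟨b, rfl⟩ := Ideal.Quotient.mk_surjective b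
  have hpow : ∀ i, ∃ N, s i ^ N * b ∈ Ideal.span {τ} := fun i ↦ by
    have h1 : algebraMap _ (Localization.Away (Ideal.Quotient.mk (Ideal.span {τ}) (s i)))
        (Ideal.Quotient.mk (Ideal.span {τ}) b) = 0 := by
      have := hred i
      refine pow_eq_zero_iff (two_ne_zero) |>.mp ?_
      rw [← map_pow, hb, map_zero]
    obtain ⟨⟨_, N, rfl⟩, h2⟩ := (IsLocalization.map_eq_zero_iff (Submonoid.powers
      (Ideal.Quotient.mk (Ideal.span {τ}) (s i))) _ _).mp h1
    refine ⟨N, ?_⟩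
    rw [← Ideal.Quotient.eq_zero_iff_mem, map_mul, map_pow]
    exact h2
  have hR : algebraMap A R b ∈ Ideal.span {algebraMap A R τ} := by
    refine hs.mem_span_of_forall_pow_mul_mem (by simpa [Nat.pos_iff_ne_zero] using hn) hτ fun i ↦ ?_
    obtain ⟨N, h⟩ := hpow i
    refine ⟨N, ?_⟩
    have := Ideal.mem_map_of_mem (algebraMap A R) h
    rwa [Ideal.map_span, Set.image_singleton, map_mul, map_pow] at this
  obtain ⟨u, hu, hub⟩ := exists_forall_mul_mem_of_map_le (R := R) m.primeCompl
    (I := Ideal.span {b}) (J := Ideal.span {τ}) ⟨{b}, by simp⟩ (by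
      rw [Ideal.map_span, Set.image_singleton, Ideal.map_span, Set.image_singleton,
        Ideal.span_singleton_le_iff_mem]
      exact hR)
  by_contra hb'
  -- A maximal ideal above the colon ideal would contain every `s i`, hence equal `m`; but it also
  -- contains `u`, which lies outside `m`.
  let K : Ideal A := (Ideal.span {τ}).colon {b}
  have hK : ∀ x, x ∈ K ↔ x * b ∈ Ideal.span {τ} := fun x ↦ by
    rw [Submodule.mem_colon_singleton, smul_eq_mul]
  have hK1 : K ≠ ⊤ := fun h ↦ hb' (by
    have := (hK 1).mp (h ▸ Submodule.mem_top)
    rw [one_mul] at this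
    exact Ideal.Quotient.eq_zero_iff_mem.mpr this)
  obtain ⟨M, hM, hKM⟩ := Ideal.exists_le_maximal K hK1
  have hmM : m ≤ M := by
    rw [← hspan, Ideal.span_le]
    rintro _ ⟨i, rfl⟩
    obtain ⟨N, h⟩ := hpow i
    exact hM.isPrime.mem_of_pow_mem N (hKM ((hK _).mpr h))
  exact hu ((hm.eq_of_le hM.ne_top hmM).ge
    (hKM ((hK u).mpr (hub b (Ideal.mem_span_singleton_self b)))))

omit [Algebra A R] [CommRing R] in
-- In one variable the form is `c T ^ e` with `c` nonzero at the point. A prime below the point that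
-- contains its value contains `s 0`, so the point is already a minimal prime of the quotient.
lemma ringKrullDim_localization_quotient_le_zero {κ : Type*} [Field κ] {χ : A →+* κ} {s : Fin 1 → A}
    (hspan : Ideal.span (Set.range s) = RingHom.ker χ) {e : ℕ} {G : MvPolynomial (Fin 1) A}
    (hG : G.IsHomogeneous e) (hG0 : MvPolynomial.map χ G ≠ 0) {I : Ideal A}
    (hI : MvPolynomial.eval s G ∈ I) (x : Ideal (A ⧸ I)) [x.IsPrime]
    (hx : x.comap (Ideal.Quotient.mk I) = RingHom.ker χ) :
    ringKrullDim (Localization.AtPrime x) ≤ 0 := by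
  have hG' : G = MvPolynomial.monomial (Finsupp.single 0 e)
      (MvPolynomial.coeff (Finsupp.single 0 e) G) := by
    ext d
    rw [MvPolynomial.coeff_monomial]
    split_ifs with h
    · rw [h]
    · by_contra h0
      refine h (Finsupp.ext fun i ↦ ?_)
      have := hG h0
      rw [Finsupp.weight_apply, Finsupp.sum_fintype _ _ (by simp)] at this
      obtain rfl := Subsingleton.elim i 0
      simpa using this.symm
  set c := MvPolynomial.coeff (Finsupp.single 0 e) G
  have hc : χ c ≠ 0 := by
    rw [hG'] at hG0
    intro h
    rw [MvPolynomial.map_monomial, h, MvPolynomial.monomial_zero] at hG0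
    exact hG0 rfl
  have hev : MvPolynomial.eval s G = c * s 0 ^ e := by
    rw [hG', MvPolynomial.eval_monomial]
    simp
  have hmin : x ∈ minimalPrimes (A ⧸ I) := by
    refine ⟨⟨inferInstance, bot_le⟩, fun y ⟨hy, _⟩ hyx ↦ ?_⟩
    have h1 : Ideal.Quotient.mk I (c * s 0 ^ e) ∈ y := by
      rw [← hev, Ideal.Quotient.eq_zero_iff_mem.mpr hI]
      exact y.zero_mem
    rw [map_mul, map_pow] at h1
    have h2 : Ideal.Quotient.mk I (s 0) ∈ y := by
      refine hy.mem_of_pow_mem e ((hy.mem_or_mem h1).resolve_left fun h ↦ hc ?_)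
      exact (RingHom.mem_ker).mp (hx.le (hyx h))
    rw [← Ideal.comap_le_comap_iff_of_surjective _ Ideal.Quotient.mk_surjective, hx, ← hspan,
      Ideal.span_le]
    rintro _ ⟨i, rfl⟩
    obtain rfl := Subsingleton.elim i 0
    exact h2
  rw [IsLocalization.AtPrime.ringKrullDim_eq_height x, Ideal.height_eq_zero_iff.mpr hmin]
  rfl

end ReducedAlgebra

/-! ### Local rings of the special fibre -/

section ReducedFibre

open IsLocalRing

variable {O : Type u} [CommRing O] [IsLocalRing O] {X : Scheme.{u}} {f : X ⟶ Spec (.of O)}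

/-- The local rings of the special fibre on an affine chart. -/
lemma exists_stalk_specialFibre_equiv {t : O} (ht : maximalIdeal O = Ideal.span {t})
    {A : CommRingCat.{u}} {q : Spec A ⟶ X} [IsOpenImmersion q] {φ : O →+* A}
    (hq : q ≫ f = Spec.map (CommRingCat.ofHom φ)) (y : specialFibre f)
    (hy : specialFibreι f y ∈ Set.range q) :
    ∃ x : PrimeSpectrum (A ⧸ Ideal.span {φ t}),
      q (PrimeSpectrum.comap (Ideal.Quotient.mk (Ideal.span {φ t})) x) = specialFibreι f y ∧
      Nonempty ((specialFibre f).presheaf.stalk y ≃+* Localization.AtPrime x.asIdeal) := by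
  rw [← onChart_specialFibreIdeal ht hq]
  let e : specialFibre f ⟶ (specialFibreIdeal f).subscheme :=
    (specialFibreι f).toImage
  have he : e ≫ (specialFibreIdeal f).subschemeι = specialFibreι f := (specialFibreι f).toImage_imageι
  have : IsIso e := inferInstanceAs (IsIso (specialFibreι f).toImage)
  let j := chartι q (specialFibreIdeal f) ≫ inv e
  have hj : j ≫ specialFibreι f = Spec.map (CommRingCat.ofHom (Ideal.Quotient.mk _)) ≫ q := by
    rw [← he, Category.assoc, IsIso.inv_hom_id_assoc, chartι_subschemeι]
  obtain ⟨x, hx⟩ := exists_chartι_eq q (specialFibreIdeal f) (e y) (by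
    rw [← Scheme.Hom.comp_apply, he]; exact hy)
  have hxy : j x = y := by
    rw [Scheme.Hom.comp_apply, hx, ← Scheme.Hom.comp_apply, IsIso.hom_inv_id]
    rfl
  subst hxy
  refine ⟨x, ?_, ⟨?_⟩⟩
  · rw [← Scheme.Hom.comp_apply, hj]
    rfl
  · have : IsIso (j.stalkMap x) := inferInstance
    exact (asIso (j.stalkMap x) ≪≫ Spec.stalkIso (.of (A ⧸ _)) x).commRingCatIsoToRingEquiv

lemma isReduced_stalk_specialFibre {t : O} (ht : maximalIdeal O = Ideal.span {t})
    {A : CommRingCat.{u}} {q : Spec A ⟶ X} [IsOpenImmersion q] {φ : O →+* A}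
    (hq : q ≫ f = Spec.map (CommRingCat.ofHom φ)) (y : specialFibre f)
    (hy : specialFibreι f y ∈ Set.range q) (hred : _root_.IsReduced (A ⧸ Ideal.span {φ t})) :
    _root_.IsReduced ((specialFibre f).presheaf.stalk y) := by
  obtain ⟨x, -, ⟨E⟩⟩ := exists_stalk_specialFibre_equiv ht hq y hy
  have : _root_.IsReduced (Localization.AtPrime x.asIdeal) :=
    isReduced_localizationPreserves x.asIdeal.primeCompl _ inferInstance
  exact isReduced_of_injective E E.injective

end ReducedFibre

/-! ### Blow-ups of conical singularities -/

section Conical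

open IsLocalRing

variable {O : Type u} [CommRing O] [IsLocalRing O] {X Y : Scheme.{u}} {f : X ⟶ Spec (.of O)}
  {t : O} {π : Y ⟶ X} {P : Set X}

/-- Blowing up does nothing away from the centre. -/
lemma exists_chart_of_notMem (ht : maximalIdeal O = Ideal.span {t})
    (hπ : IsBlowUp π (reducedIdeal P)) (hP : IsClosed P) {y : Y} (hy : π y ∉ P)
    (hf : π y ∉ singularSet f) :
    ∃ (B : CommRingCat.{u}) (l : Spec B ⟶ Y) (φ : O →+* B), IsOpenImmersion l ∧
      y ∈ Set.range l ∧ l ≫ π ≫ f = Spec.map (CommRingCat.ofHom φ) ∧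
      onChart l (strictTransform π (Set.range (specialFibreι f)) P) = Ideal.span {φ t} ∧
      IsResidueSmooth ((Ideal.Quotient.mk (Ideal.span {φ t})).comp φ) ∧
      ∀ p ∈ P, onChart l (exceptionalDivisor π p) = ⊤ := by
  obtain ⟨W, hW, hyW, hWP⟩ := exists_affine_le (x := π y)
    (U := ⟨(P ∪ singularSet f)ᶜ, (hP.union (isClosed_singularSet f)).isOpen_compl⟩)
    (not_or.mpr ⟨hy, hf⟩)
  let A := Γ(X, W)
  have hq : ∀ x, hW.fromSpec x ∉ P ∪ singularSet f := fun x ↦ hWP (by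
    rw [← SetLike.mem_coe, ← hW.range_fromSpec]; exact ⟨x, rfl⟩)
  have htop : ∀ Q ⊆ P, onChart hW.fromSpec (reducedIdeal Q) = ⊤ := fun Q hQ ↦ by
    rw [onChart_reducedIdeal]
    have : hW.fromSpec ⁻¹' Q = ∅ := Set.eq_empty_iff_forall_notMem.mpr fun x hx ↦ hq x (.inl (hQ hx))
    exact (congrArg PrimeSpectrum.vanishingIdeal this).trans PrimeSpectrum.vanishingIdeal_empty
  -- Off the centre the ideal is the unit ideal, generated by `1`, and `A` is its own affine blow-up
  -- algebra.
  let s : Unit → A := fun _ ↦ 1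
  have hs : Ideal.span (Set.range s) = onChart hW.fromSpec (reducedIdeal P) := by
    rw [htop P subset_rfl, Ideal.eq_top_iff_one]
    exact Ideal.subset_span ⟨(), rfl⟩
  have h : ∀ i : Unit, IsAffineBlowUp (𝟙 A : A ⟶ A).hom s i s := fun i ↦
    { map_eq := fun j ↦ by simp [s]
      mem_nonZeroDivisors := by simp [s]
      surjective := fun b ↦ ⟨MvPolynomial.C b, by simp⟩
      exists_pow_mul_eq_zero := fun x hx ↦ ⟨0, by simpa using hx⟩ }
  obtain ⟨l, hl, hl'⟩ := hπ.exists_charts hW.fromSpec hs (φ := fun _ ↦ 𝟙 A) h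
  obtain ⟨i, hi⟩ := hl' y (by rw [hW.range_fromSpec]; exact hyW)
  have := (hl i).2
  have hsm := isResidueSmooth_of_disjoint_singularSet ht (fromSpec_comp_eq f hW)
    fun x hx ↦ hq x (.inr hx)
  refine ⟨A, l i, sectionsHom f W, (hl i).2, hi, ?_, ?_, hsm, fun p hp ↦ ?_⟩
  · rw [← Category.assoc, (hl i).1, Spec.map_id, Category.id_comp, fromSpec_comp_eq]
  -- No exceptional factor splits off here, whence exponent `0`: the strict transform is the whole
  -- special fibre.
  · refine onChart_strictTransform (e := 0) ht (fromSpec_comp_eq f hW) (h i)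
      (show sectionsHom f W t = 1 ^ 0 * sectionsHom f W t by simp) (hl i).1 hP hs
      (fun b hb ↦ by simpa [s] using hb) ?_
    have := hsm.isReduced
    exact isReduced_localizationPreserves (Submonoid.powers
      (Ideal.Quotient.mk (Ideal.span {sectionsHom f W t}) (s i))) _ inferInstance
  · rw [exceptionalDivisor, onChart_comap_eq_map (hl i).1,
      htop {p} (Set.singleton_subset_iff.mpr hp), Ideal.map_top]

end Conical


/-! ### Blowing up conical singularities with smooth projectivised tangent cone -/

section SmoothlyConical

open IsLocalRing

variable {O : Type u} [CommRing O] [IsLocalRing O] {X Y : Scheme.{u}} {f : X ⟶ Spec (.of O)}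
  {t : O} {π : Y ⟶ X} {P : Set X}

/-- The point `x` lies on a conical chart containing only one point of `P`, on which the
projectivised tangent cone of the special fibre is smooth. -/
def IsSmoothlyConicalAt (f : X ⟶ Spec (.of O)) (t : O) (P : Set X) (x : X) : Prop :=
  ∃ (p : X) (A : CommRingCat.{u}) (q₀ : Spec A ⟶ X) (φ₀ : O →+* A) (κ : Type u) (_ : Field κ) (χ : A →+* κ)
    (n e : ℕ) (s : Fin (n + 1) → A) (G : MvPolynomial (Fin (n + 1)) A),
    IsOpenImmersion q₀ ∧ x ∈ Set.range q₀ ∧ q₀ ⁻¹' P = q₀ ⁻¹' {p} ∧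
    IsConicalChart f t p q₀ φ₀ χ s e G ∧
    ∀ i, ((Ideal.Quotient.mk (Ideal.span {MvPolynomial.eval₂ (chartC κ i) (chartCoord κ i)
      (MvPolynomial.map χ G)})).comp (chartC κ i)).Smooth

lemma isResidueSmooth_mk_of_eq_top {B : Type u} [CommRing B] {φ : O →+* B} {I : Ideal B}
    (h : I = ⊤) : IsResidueSmooth ((Ideal.Quotient.mk I).comp φ) :=
  have : Subsingleton (B ⧸ I) := Ideal.Quotient.subsingleton_iff.mpr h
  .of_subsingleton

variable (ht : maximalIdeal O = Ideal.span {t}) (hπ : IsBlowUp π (reducedIdeal P))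
  (hP : IsClosed P)
  (H : ∀ x, IsSmoothlyConicalAt f t P x ∨ x ∉ P ∧ x ∉ singularSet f)

include ht hπ hP H

/-- The question is local on `Y`: over a conical chart it is answered by the smooth tangent cone,
elsewhere the blow-up leaves a smooth fibre unchanged. -/
theorem isSmoothOverResidue_strictTransform : IsSmoothOverResidue
    ((strictTransform π (Set.range (specialFibreι f)) P).subschemeι ≫ π ≫ f) := by
  refine isSmoothOverResidue_of_forall_exists_chart fun y ↦ ?_
  obtain ⟨p, A, q₀, φ₀, κ, _, χ, n, e, s, G, hq₀, hp, hPp, hc, hF⟩ | ⟨hy, hy'⟩ := H (π y)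
  · obtain ⟨B, φ, a, ψ, l, hl, hl'⟩ := hc.exists_charts hπ hPp
    obtain ⟨i, hi⟩ := hl' y hp
    refine ⟨B i, l i, _, (hl i).isOpenImmersion, hi, (hl i).comp_eq_SpecMap hc, ?_⟩
    rw [(hl i).onChart_strictTransform hc ht hP hPp]
    exact (hl i).isResidueSmooth_strictTransform hc ht (hF i)
  · obtain ⟨B, l, φ, h1, h2, h3, h4, h5, -⟩ := exists_chart_of_notMem ht hπ hP hy hy'
    exact ⟨B, l, φ, h1, h2, h3, h4 ▸ h5⟩

theorem meetTransversely_exceptionalDivisor_strictTransform {p : X} (hp : p ∈ P) :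
    MeetTransversely (π ≫ f) (exceptionalDivisor π p)
      (strictTransform π (Set.range (specialFibreι f)) P) := by
  refine meetTransversely_of_forall_exists_chart fun y ↦ ?_
  obtain ⟨p', A, q₀, φ₀, κ, _, χ, n, e, s, G, hq₀, hp', hPp, hc, hF⟩ | ⟨hy, hy'⟩ := H (π y)
  · obtain ⟨B, φ, a, ψ, l, hl, hl'⟩ := hc.exists_charts hπ hPp
    obtain ⟨i, hi⟩ := hl' y hp'
    refine ⟨B i, l i, _, (hl i).isOpenImmersion, hi, (hl i).comp_eq_SpecMap hc, ?_⟩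
    rw [onChart_sup, (hl i).onChart_strictTransform hc ht hP hPp]
    obtain rfl | hne := eq_or_ne p p'
    · rw [(hl i).onChart_exceptionalDivisor hc]
      exact ⟨((hl i).isResidueSmooth_inter_iff hc).mpr (hF i), .inr ⟨(hl i).isNoetherianRing hc, _,
        (hl i).isAffineBlowUp.mem_nonZeroDivisors, rfl, (hl i).mem_span_of_mul_mem hc⟩⟩
    -- This chart surrounds a different centre `p'`, so the exceptional divisor over `p` does not
    -- meet it.
    · have hE : onChart (l i) (exceptionalDivisor π p) = ⊤ := by
        have h0 : q₀ ⁻¹' {p} = ∅ := Set.eq_empty_iff_forall_notMem.mpr fun x hx ↦ by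
          have h1 : x ∈ q₀ ⁻¹' P := (congrArg (· ∈ P) (show q₀ x = p from hx)).mpr hp
          rw [hPp] at h1
          exact hne ((show q₀ x = p from hx).symm.trans h1)
        have h1 : onChart q₀ (reducedIdeal {p}) = ⊤ := (onChart_reducedIdeal q₀ {p}).trans
          ((congrArg PrimeSpectrum.vanishingIdeal h0).trans PrimeSpectrum.vanishingIdeal_empty)
        rw [exceptionalDivisor, onChart_comap_eq_map (hl i).comm, h1, Ideal.map_top]
      rw [hE, top_sup_eq]
      exact ⟨isResidueSmooth_mk_of_eq_top rfl, .inl rfl⟩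
  · obtain ⟨B, l, φ, h1, h2, h3, -, -, h5⟩ := exists_chart_of_notMem ht hπ hP hy hy'
    have h6 : onChart l (exceptionalDivisor π p ⊔
        strictTransform π (Set.range (specialFibreι f)) P) = ⊤ := by
      rw [onChart_sup, h5 p hp, top_sup_eq]
    exact ⟨B, l, φ, h1, h2, h3, isResidueSmooth_mk_of_eq_top h6, .inl h6⟩

omit H in
/-- If the strict transform meets the exceptional divisor transversely, then the projectivised
tangent cone is smooth. -/
theorem IsConicalChart.smooth_of_meetTransversely {p : X} {A : CommRingCat.{u}} {q₀ : Spec A ⟶ X}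
    [IsOpenImmersion q₀] {φ₀ : O →+* A} {κ : Type u} [Field κ] {χ : A →+* κ} {n e : ℕ}
    {s : Fin (n + 1) → A} {G : MvPolynomial (Fin (n + 1)) A}
    (hc : IsConicalChart f t p q₀ φ₀ χ s e G) (hPp : q₀ ⁻¹' P = q₀ ⁻¹' {p})
    (hm : MeetTransversely (π ≫ f) (exceptionalDivisor π p)
      (strictTransform π (Set.range (specialFibreι f)) P)) (i : Fin (n + 1)) :
    ((Ideal.Quotient.mk (Ideal.span {MvPolynomial.eval₂ (chartC κ i) (chartCoord κ i)
      (MvPolynomial.map χ G)})).comp (chartC κ i)).Smooth := by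
  obtain ⟨B, φ, a, ψ, l, hl, -⟩ := hc.exists_charts hπ hPp
  have := (hl i).isOpenImmersion
  rw [← (hl i).isResidueSmooth_inter_iff hc]
  have := hm.smooth.isResidueSmooth (l i) ((hl i).comp_eq_SpecMap hc)
  rwa [onChart_sup, (hl i).onChart_strictTransform hc ht hP hPp,
    (hl i).onChart_exceptionalDivisor hc] at this

end SmoothlyConical

/-! ### The equivalence -/

section Equivalence

open IsLocalRing

variable {O : Type u} [CommRing O] [IsLocalRing O] {X : Scheme.{u}} {f : X ⟶ Spec (.of O)}
  {k₀ : Type u} [Field k₀] [Algebra k₀ O] [Algebra.IsSeparable k₀ (ResidueField O)]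
  {t : O} (ht : maximalIdeal O = Ideal.span {t})
  (hsm : IsEssSmooth (f ≫ Spec.map (CommRingCat.ofHom (algebraMap k₀ O))))
  (hsep : ∀ y : specialFibre f, IsClosed {y} → IsSingularPoint f y → HasSeparableResidueField f y)

lemma fromSpec_preimage_eq {p : X} {W : X.Opens} (hW : IsAffineOpen W) {P : Set X} (hp : p ∈ P)
    (h : (W : Set X) ∩ P ⊆ {p}) : hW.fromSpec ⁻¹' P = hW.fromSpec ⁻¹' {p} := by
  refine Set.ext fun x ↦ ⟨fun hx ↦ h ⟨?_, hx⟩, fun hx ↦ ?_⟩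
  · rw [← hW.range_fromSpec]; exact ⟨x, rfl⟩
  · exact (congrArg (· ∈ P) (show hW.fromSpec x = p from hx)).mpr hp

include ht hsm hsep in
-- On charts the intersection of the exceptional divisor and the strict transform is `V(F)`, so its
-- smoothness is smoothness of the leading form. The argument applies to every choice of generators
-- and form.
theorem ResolvedBySingleBlowUp.smooth_leadingForm [LocallyOfFiniteType f]
    (h : ResolvedBySingleBlowUp f) {p : X} (hp : p ∈ singularSet f) {n e : ℕ}
    {s : Fin (n + 1) → X.presheaf.stalk p} {F : MvPolynomial (Fin (n + 1)) (X.residueField p)}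
    (hF : IsLeadingForm (pullbackGerm f t p) s e F) :
    Smooth ((projHypersurface F e hF.homogeneous).subschemeι ≫
      projSpaceToSpec (X.residueField p) n) := by
  obtain ⟨W, hW, hpW, s', G, -, hWp, rfl, hc⟩ := exists_isConicalChart ht hsm h.isolated hsep hp hF
  obtain ⟨Y, π, hπ, -, hm⟩ := h.blowUp
  refine (smooth_projHypersurface_iff _ e hF.homogeneous).mpr ?_
  exact hc.smooth_of_meetTransversely ht hπ (isClosed_singularSet f) (fromSpec_preimage_eq hW hp hWp)
    (hm p hp)

omit [IsLocalRing O] in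
-- A nonzerodivisor stays one along the flat maps from `O` to the stalk.
lemma pullbackGerm_ne_zero [Flat f] (ht0 : t ∈ nonZeroDivisors O) (p : X) :
    pullbackGerm f t p ≠ 0 := by
  obtain ⟨W, hW, hpW, -⟩ := exists_affine_le (T := X) (U := ⊤) (x := p) trivial
  have h1 : (sectionsHom f W).Flat :=
    (HasRingHomProperty.Spec_iff (P := @Flat) (φ := CommRingCat.ofHom (sectionsHom f W))).mp (by
      rw [← fromSpec_comp_eq f hW]; infer_instance)
  let : Algebra Γ(X, W) (X.presheaf.stalk p) := (X.presheaf.germ W p hpW).hom.toAlgebra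
  have : IsLocalization.AtPrime (X.presheaf.stalk p) (hW.primeIdealOf ⟨p, hpW⟩).asIdeal :=
    hW.isLocalization_stalk ⟨p, hpW⟩
  have h2 : (algebraMap Γ(X, W) (X.presheaf.stalk p)).Flat := by
    rw [RingHom.flat_algebraMap_iff]
    exact IsLocalization.flat _ (hW.primeIdealOf ⟨p, hpW⟩).asIdeal.primeCompl
  rw [← germ_sectionsHom t hpW]
  exact nonZeroDivisors.ne_zero (map_mem_nonZeroDivisors_of_flat h2
    (map_mem_nonZeroDivisors_of_flat h1 ht0))

include ht in
lemma pullbackGerm_mem {p : X} (hp : p ∈ Set.range (specialFibreι f)) :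
    pullbackGerm f t p ∈ maximalIdeal (X.presheaf.stalk p) := by
  obtain ⟨W, hW, hpW, -⟩ := exists_affine_le (T := X) (U := ⊤) (x := p) trivial
  have h := (apply_mem_specialFibre_iff ht (fromSpec_comp_eq f hW) _).mp
    ((congrArg (· ∈ Set.range (specialFibreι f)) (hW.fromSpec_primeIdealOf ⟨p, hpW⟩)).mpr hp)
  let : Algebra Γ(X, W) (X.presheaf.stalk p) := (X.presheaf.germ W p hpW).hom.toAlgebra
  have : IsLocalization.AtPrime (X.presheaf.stalk p) (hW.primeIdealOf ⟨p, hpW⟩).asIdeal :=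
    hW.isLocalization_stalk ⟨p, hpW⟩
  rw [← germ_sectionsHom t hpW]
  exact (IsLocalization.AtPrime.to_map_mem_maximal_iff (X.presheaf.stalk p)
    (hW.primeIdealOf ⟨p, hpW⟩).asIdeal _).mpr h

omit [Algebra.IsSeparable k₀ (ResidueField O)] in
include ht hsm in
-- The germ of `t` is nonzero and lies in the maximal ideal. Hence the stalk is not a field, which
-- makes the number of generators at least one and so of the form `n + 1`; and Krull's theorem gives
-- the germ a finite order.
lemma exists_isLeadingForm [Flat f] (ht0 : t ∈ nonZeroDivisors O) {p : X}
    (hp : p ∈ Set.range (specialFibreι f)) :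
    ∃ (n e : ℕ) (s : Fin (n + 1) → X.presheaf.stalk p)
      (F : MvPolynomial (Fin (n + 1)) (X.residueField p)),
      IsLeadingForm (pullbackGerm f t p) s e F := by
  have := isNoetherianRing_stalk hsm p
  have h0 := pullbackGerm_ne_zero (f := f) ht0 p
  obtain ⟨n, hn⟩ : ∃ n, Module.finrank (ResidueField (X.presheaf.stalk p))
      (CotangentSpace (X.presheaf.stalk p)) = n + 1 := by
    refine Nat.exists_eq_succ_of_ne_zero fun h ↦ h0 ?_
    have h1 := pullbackGerm_mem ht hp
    rwa [isField_iff_maximalIdeal_eq.mp (finrank_cotangentSpace_eq_zero_iff.mp h)] at h1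
  obtain ⟨s, hs⟩ : ∃ s : Fin (n + 1) → X.presheaf.stalk p,
      Ideal.span (Set.range s) = maximalIdeal (X.presheaf.stalk p) :=
    hn ▸ exists_minimalGenerators (X.presheaf.stalk p)
  obtain ⟨e, G, hG, hGa, hG0, hd⟩ := exists_leadingForm hs h0
  exact ⟨n, e, s, MvPolynomial.map (residue _) G, hs, hn, hd, hG.map _, G, hG, rfl, by
    rw [hGa, sub_self]; exact zero_mem _⟩

include ht hsm hsep in
theorem HasSmoothLeadingForm.isSmoothlyConicalAt [LocallyOfFiniteType f]
    (hd : _root_.IsDiscrete (singularSet f)) {p : X} (hp : p ∈ singularSet f)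
    (h : HasSmoothLeadingForm f t p) : IsSmoothlyConicalAt f t (singularSet f) p := by
  obtain ⟨n, e, s, F, hF, h⟩ := h
  obtain ⟨W, hW, hpW, s', G, -, hWp, rfl, hc⟩ := exists_isConicalChart ht hsm hd hsep hp hF
  have h := (smooth_projHypersurface_iff _ e hF.homogeneous).mp h
  exact ⟨p, _, hW.fromSpec, _, _, _, _, n, e, s', G, inferInstance,
    by rw [hW.range_fromSpec]; exact hpW, fromSpec_preimage_eq hW hp hWp, hc, h⟩

include ht hsm hsep in
-- Isolatedness already forces reducedness. At a singular point with one generator the fibre has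
-- dimension zero, which `hy` excludes; with more generators positive depth applies; elsewhere the
-- fibre is smooth.
theorem isReduced_stalk_specialFibre_of_isDiscrete [Flat f] [LocallyOfFiniteType f]
    (ht0 : t ∈ nonZeroDivisors O) (hd : _root_.IsDiscrete (singularSet f)) (y : specialFibre f)
    (hy : 1 ≤ ringKrullDim ((specialFibre f).presheaf.stalk y)) :
    _root_.IsReduced ((specialFibre f).presheaf.stalk y) := by
  by_cases hp : specialFibreι f y ∈ singularSet f
  · set p := specialFibreι f y
    obtain ⟨n, e, s, F, hF⟩ := exists_isLeadingForm ht hsm (f := f) ht0 (p := p) ⟨y, rfl⟩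
    obtain ⟨W, hW, hpW, s', G, hs', hWp, rfl, hc⟩ := exists_isConicalChart ht hsm hd hsep hp hF
    have hyW : p ∈ Set.range hW.fromSpec := by rw [hW.range_fromSpec]; exact hpW
    have hcl := isClosed_singleton_of_mem_singularSet hd hp
    have hmax : (hW.primeIdealOf ⟨p, hpW⟩).asIdeal.IsMaximal :=
      hW.primeIdealOf_isMaximal_of_isClosed ⟨p, hpW⟩ hcl
    by_cases hn : n = 0
    · subst hn
      obtain ⟨x, hx, ⟨E⟩⟩ := exists_stalk_specialFibre_equiv ht hc.comp_eq y hyW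
      have h1 := ringKrullDim_localization_quotient_le_zero hc.isQuasiRegular.span_eq
        hc.isHomogeneous hc.map_ne_zero (I := Ideal.span {sectionsHom f W t})
        (hc.eval_eq ▸ Ideal.mem_span_singleton_self _) x.asIdeal (by
          rw [ker_evaluation hW hpW]
          exact congrArg PrimeSpectrum.asIdeal (hW.fromSpec.isOpenEmbedding.injective
            (hx.trans (hW.fromSpec_primeIdealOf ⟨p, hpW⟩).symm)))
      rw [← ringKrullDim_eq_of_ringEquiv E] at h1
      exact absurd (hy.trans h1) (by decide)
    · refine isReduced_stalk_specialFibre ht hc.comp_eq y hyW ?_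
      let : Algebra Γ(X, W) (X.presheaf.stalk p) := (X.presheaf.germ W p hpW).hom.toAlgebra
      have : IsLocalization.AtPrime (X.presheaf.stalk p) (hW.primeIdealOf ⟨p, hpW⟩).asIdeal :=
        hW.isLocalization_stalk ⟨p, hpW⟩
      have := isNoetherianRing_stalk hsm p
      refine isReduced_quotient_of_isQuasiRegularSystem (R := X.presheaf.stalk p)
        (hW.primeIdealOf ⟨p, hpW⟩).asIdeal (s := s') ?_ ?_ hn ?_ fun i ↦ (hc.smooth_away i).isReduced
      · rw [hc.isQuasiRegular.span_eq, ker_evaluation hW hpW]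
      · have : (fun j ↦ algebraMap Γ(X, W) (X.presheaf.stalk p) (s' j)) = s := funext hs'
        rw [this]
        exact isQuasiRegularSystem_stalk hsm hd hsep hp hF.span_eq hF.finrank_eq
      · exact fun h ↦ pullbackGerm_ne_zero (f := f) ht0 p ((germ_sectionsHom t hpW).symm.trans h)
  · obtain ⟨W, hW, hyW, hWP⟩ := exists_affine_le
      (U := ⟨(singularSet f)ᶜ, (isClosed_singularSet f).isOpen_compl⟩) (x := specialFibreι f y) hp
    refine isReduced_stalk_specialFibre ht (fromSpec_comp_eq f hW) y
      (by rw [hW.range_fromSpec]; exact hyW)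
      (isResidueSmooth_of_disjoint_singularSet ht (fromSpec_comp_eq f hW) fun x ↦ hWP ?_).isReduced
    rw [← SetLike.mem_coe, ← hW.range_fromSpec]; exact ⟨x, rfl⟩

include ht hsm hsep in
theorem resolvedBySingleBlowUp_iff [Flat f] [LocallyOfFiniteType f]
    (ht0 : t ∈ nonZeroDivisors O) : ResolvedBySingleBlowUp f ↔
      _root_.IsDiscrete (singularSet f) ∧ ∀ p ∈ singularSet f, HasSmoothLeadingForm f t p := by
  refine ⟨fun h ↦ ⟨h.isolated, fun p hp ↦ ?_⟩, fun ⟨hd, H⟩ ↦ ⟨hd,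
    isReduced_stalk_specialFibre_of_isDiscrete ht hsm hsep ht0 hd, ?_⟩⟩
  · obtain ⟨n, e, s, F, hF⟩ := exists_isLeadingForm ht hsm (f := f) ht0 (singularSet_subset_range hp)
    exact ⟨n, e, s, F, hF, h.smooth_leadingForm ht hsm hsep hp hF⟩
  · obtain ⟨Y, π, hπ⟩ := exists_isBlowUp (reducedIdeal (singularSet f))
    have H' : ∀ x, IsSmoothlyConicalAt f t (singularSet f) x ∨
        x ∉ singularSet f ∧ x ∉ singularSet f := fun x ↦ by
      by_cases hx : x ∈ singularSet f
      · exact .inl ((H x hx).isSmoothlyConicalAt ht hsm hsep hd hx)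
      · exact .inr ⟨hx, hx⟩
    exact ⟨Y, π, hπ, isSmoothOverResidue_strictTransform ht hπ (isClosed_singularSet f) H',
      fun p hp ↦ meetTransversely_exceptionalDivisor_strictTransform ht hπ (isClosed_singularSet f) H' hp⟩

end Equivalence


/-! ### Local isomorphisms -/

section LocalIso

variable {X Y : Scheme.{u}} {ι : Type*} {Z : ι → Scheme.{u}} (q : ∀ i, Z i ⟶ X)
  [∀ i, IsOpenImmersion (q i)] (hq : ∀ x, ∃ i, x ∈ Set.range (q i)) {f : X ⟶ Y}

include hq in
/-- An injective morphism that is an open immersion locally on the source is an open immersion. -/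
lemma isOpenImmersion_of_injective (h : ∀ i, IsOpenImmersion (q i ≫ f))
    (hf : Function.Injective f) : IsOpenImmersion f := by
  have hopen : IsOpenMap f := by
    intro U hU
    have : f '' U = ⋃ i, (q i ≫ f) '' (q i ⁻¹' U) := by
      ext y
      simp only [Set.mem_image, Set.mem_iUnion, Set.mem_preimage]
      constructor
      · rintro ⟨x, hx, rfl⟩
        obtain ⟨i, z, rfl⟩ := hq x
        exact ⟨i, z, hx, Scheme.Hom.comp_apply ..⟩
      · rintro ⟨i, z, hz, rfl⟩
        exact ⟨_, hz, (Scheme.Hom.comp_apply ..).symm⟩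
    rw [this]
    exact isOpen_iUnion fun i ↦
      (q i ≫ f).isOpenEmbedding.isOpenMap _ (hU.preimage (q i).continuous)
  have (x : X) : IsIso (f.stalkMap x) := by
    obtain ⟨i, z, rfl⟩ := hq x
    have := h i
    have h1 : IsIso ((q i ≫ f).stalkMap z) := inferInstance
    have : IsIso (f.stalkMap (q i z) ≫ (q i).stalkMap z) :=
      (iff_of_eq (congrArg (fun g ↦ IsIso g) (Scheme.Hom.stalkMap_comp (q i) f z))).mp h1
    exact IsIso.of_isIso_comp_right _ ((q i).stalkMap z)
  exact IsOpenImmersion.of_isIso_stalkMap f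
    (.of_continuous_injective_isOpenMap f.continuous hf hopen)

end LocalIso

/-! ### The exceptional divisor of a blow-up as a projective space -/

section ProjectiveSpace

open IsLocalRing

lemma projChart_apply_mem_range {R : Type u} [CommRing R] {n : ℕ} {i j : Fin (n + 1)}
    (w : PrimeSpectrum (chartRing R i)) (hw : chartCoord R i j ∉ w.asIdeal) :
    projChart R i w ∈ Set.range (projChart R j) := by
  have h := Proj.awayι_preimage_basicOpen (grading R n) (X_mem_grading (R := R) i) one_pos
    (X_mem_grading (R := R) j) one_pos
  have hw' : w ∈ PrimeSpectrum.basicOpen (HomogeneousLocalization.Away.isLocalizationElem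
      (X_mem_grading (R := R) i) (X_mem_grading (R := R) j)) := by
    have : HomogeneousLocalization.Away.isLocalizationElem
      (X_mem_grading (R := R) i) (X_mem_grading (R := R) j) = chartCoord R i j := by
      apply HomogeneousLocalization.val_injective
      rw [chartCoord, val_dehomogenise]
      exact (HomogeneousLocalization.Away.val_mk ..).trans (by simp)
    rw [this]
    exact hw
  have h2 : projChart R i w ∈ chart R j := h.ge hw'
  rw [← opensRange_projChart] at h2
  exact h2

variable {X Y : Scheme.{u}} {π : Y ⟶ X} {I : X.IdealSheafData} {A : CommRingCat.{u}}
  {q₀ : Spec A ⟶ X} {ι : Type*} {s : ι → A} {B B' D : CommRingCat.{u}} {i j : ι} {φ : A ⟶ B}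
  {φ' : A ⟶ B'} {a : ι → B} {a' : ι → B'} {l : Spec B ⟶ Y} {l' : Spec B' ⟶ Y}

/-- The ideal need not become invertible on `D`, which in the application lies over the centre, so
the universal property cannot be used there. It is used on `B[1 / a j]`, an open part of the chart
where both charts agree, and the equality is then restricted to `D`. -/
lemma SpecMap_comp_eq_of_eq_mul (hπ : IsBlowUp π I) (h : IsAffineBlowUp φ.hom s i a)
    (h' : IsAffineBlowUp φ'.hom s j a') (hl : l ≫ π = Spec.map φ ≫ q₀)
    (hl' : l' ≫ π = Spec.map φ' ≫ q₀) [IsOpenImmersion l] {α : B ⟶ D} {β : B' ⟶ D}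
    (hαβ : φ ≫ α = φ' ≫ β) (H : ∀ k, α (a k) = β (a' k) * α (a j)) :
    Spec.map α ≫ l = Spec.map β ≫ l' := by
  let L := Localization.Away (a j)
  let v : B ⟶ .of L := CommRingCat.ofHom (algebraMap B L)
  have hu : algebraMap B L (a j) * IsLocalization.Away.invSelf (a j) = 1 :=
    IsLocalization.Away.mul_invSelf (a j)
  have hαu : IsUnit (α (a j)) := by
    have := H i
    rw [h.eq_one, map_one] at this
    exact IsUnit.of_mul_eq_one_right _ this.symm
  have hnz : algebraMap B L (φ (s i)) ∈ nonZeroDivisors L :=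
    IsLocalization.map_nonZeroDivisors_le (Submonoid.powers (a j)) L
      ⟨_, h.mem_nonZeroDivisors, rfl⟩
  have hv : ∀ k, algebraMap B L (φ (s k)) = algebraMap B L (a k) * algebraMap B L (φ (s i)) :=
    fun k ↦ by rw [← map_mul]; exact congrArg _ (h.map_eq k)
  obtain ⟨g, hg⟩ := h'.exists_lift ((algebraMap B L).comp φ.hom) (by
      change algebraMap B L (φ (s j)) ∈ _
      rw [hv]
      exact mul_mem (IsUnit.of_mul_eq_one _ hu).mem_nonZeroDivisors hnz) fun k ↦
    ⟨algebraMap B L (a k) * IsLocalization.Away.invSelf (a j), by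
      change algebraMap B L (φ (s k)) = _ * algebraMap B L (φ (s j))
      rw [hv k, hv j]
      linear_combination (-algebraMap B L (a k) * algebraMap B L (φ (s i))) * hu⟩
  have hgφ : ∀ x, g (φ' x) = algebraMap B L (φ x) := fun x ↦ RingHom.congr_fun hg x
  have hga : ∀ k, algebraMap B L (a k) = g (a' k) * algebraMap B L (a j) := fun k ↦ by
    have h1 : g (φ' (s k)) = g (a' k) * g (φ' (s j)) := by
      rw [← map_mul]; exact congrArg _ (h'.map_eq k)
    rw [hgφ, hgφ, hv k, hv j, ← mul_assoc] at h1
    exact (mem_nonZeroDivisors_iff_right.mp hnz |> fun h2 ↦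
      sub_eq_zero.mp (h2 _ (by rw [sub_mul, h1, sub_self])))
  have key : Spec.map v ≫ l = Spec.map (CommRingCat.ofHom g) ≫ l' := by
    refine (hπ.hom_ext ?_ ?_).symm
    · rw [Category.assoc, hl', Category.assoc, hl, ← Spec.map_comp_assoc, ← Spec.map_comp_assoc]
      congr 2
      exact CommRingCat.hom_ext hg
    · rw [Scheme.IdealSheafData.comap_comp]
      have : IsOpenImmersion (Spec.map v) := inferInstanceAs
        (IsOpenImmersion (Spec.map (CommRingCat.ofHom (algebraMap B (Localization.Away (a j))))))
      exact isInvertible_comap _ hπ.invertible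
  let α' : L →+* D := IsLocalization.Away.lift (a j) (g := α.hom) hαu
  have hα' : ∀ b, α' (algebraMap B L b) = α b := IsLocalization.Away.lift_eq (a j) hαu
  have e1 : v ≫ CommRingCat.ofHom α' = α := CommRingCat.hom_ext (RingHom.ext hα')
  have e2 : CommRingCat.ofHom g ≫ CommRingCat.ofHom α' = β := by
    refine CommRingCat.hom_ext ?_
    rw [← RingHom.cancel_right h'.surjective]
    refine MvPolynomial.ringHom_ext (fun r ↦ ?_) fun k ↦ ?_
    · simp only [RingHom.comp_apply, MvPolynomial.coe_eval₂Hom, MvPolynomial.eval₂_C]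
      exact (congrArg α' (hgφ r)).trans ((hα' _).trans congr($(hαβ).hom r))
    · simp only [RingHom.comp_apply, MvPolynomial.coe_eval₂Hom, MvPolynomial.eval₂_X]
      have h1 := congrArg α' (hga k)
      rw [map_mul, hα', hα', H k] at h1
      exact (hαu.mul_right_cancel h1).symm
  rw [← e1, ← e2, Spec.map_comp, Spec.map_comp, Category.assoc, Category.assoc, key]

/-- On the intersection of the two charts, `s i` and `s j` are regular multiples of each other, so
`a j` is invertible there with inverse `a' i`. -/
lemma notMem_of_apply_eq (h : IsAffineBlowUp φ.hom s i a)
    (h' : IsAffineBlowUp φ'.hom s j a') (hl : l ≫ π = Spec.map φ ≫ q₀)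
    (hl' : l' ≫ π = Spec.map φ' ≫ q₀) [Mono q₀] [IsOpenImmersion l] [IsOpenImmersion l']
    {w : PrimeSpectrum B} {z : PrimeSpectrum B'} (hwz : l w = l' z) : a j ∉ w.asIdeal := by
  obtain ⟨x, hxw, -⟩ := Scheme.exists_preimage_of_isPullback (IsPullback.of_hasPullback l l') w z hwz
  obtain ⟨V, hV, hxV, -⟩ := exists_affine_le (U := ⊤) (x := x) trivial
  obtain ⟨α, hα⟩ := Spec.map_surjective (hV.fromSpec ≫ pullback.fst l l')
  obtain ⟨β, hβ⟩ := Spec.map_surjective (hV.fromSpec ≫ pullback.snd l l')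
  have hflat : α.hom.Flat := by
    have : Flat (Spec.map α) := by rw [hα]; infer_instance
    exact (HasRingHomProperty.Spec_iff (P := @Flat)).mp this
  have e : φ ≫ α = φ' ≫ β := by
    apply Spec.map_injective
    rw [← cancel_mono q₀, Spec.map_comp, Spec.map_comp, Category.assoc, Category.assoc, ← hl, ← hl',
      hα, hβ, Category.assoc, Category.assoc, pullback.condition_assoc]
  have e' : ∀ x, α (φ x) = β (φ' x) := fun x ↦ congr($(e).hom x)
  have hnz : α (φ (s i)) ∈ nonZeroDivisors Γ(pullback l l', V) :=
    map_mem_nonZeroDivisors_of_flat hflat h.mem_nonZeroDivisors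
  have h1 : α (φ (s j)) = α (a j) * α (φ (s i)) := by
    rw [← map_mul]; exact congrArg _ (h.map_eq j)
  have h2 : β (φ' (s i)) = β (a' i) * β (φ' (s j)) := by
    rw [← map_mul]; exact congrArg _ (h'.map_eq i)
  have h3 : (1 - β (a' i) * α (a j)) * α (φ (s i)) = 0 := by
    rw [← e', ← e', h1] at h2
    linear_combination h2
  have h4 : 1 = β (a' i) * α (a j) :=
    sub_eq_zero.mp (mem_nonZeroDivisors_iff_right.mp hnz _ h3)
  intro hw
  obtain ⟨y, hy⟩ : x ∈ Set.range hV.fromSpec := by rw [hV.range_fromSpec]; exact hxV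
  have hyw : Spec.map α y = w := by
    rw [hα, Scheme.Hom.comp_apply, hy, hxw]
  have h5 : α (a j) ∈ (show PrimeSpectrum Γ(pullback l l', V) from y).asIdeal :=
    (congrArg (fun v : PrimeSpectrum B ↦ a j ∈ v.asIdeal) hyw).mpr hw
  refine (show PrimeSpectrum Γ(pullback l l', V) from y).isPrime.ne_top ((Ideal.eq_top_iff_one _).mpr ?_)
  rw [h4]
  exact Ideal.mul_mem_left _ _ h5

end ProjectiveSpace


/-! ### Glueing the exceptional charts to a projective space -/

section ExceptionalDivisorIso

open IsLocalRing

variable {X Y : Scheme.{u}} {π : Y ⟶ X} {I : X.IdealSheafData} {A : CommRingCat.{u}}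
  {q₀ : Spec A ⟶ X} {n : ℕ} {s : Fin (n + 1) → A} {κ : Type u} [Field κ] {χ : A →+* κ}
  {B : Fin (n + 1) → CommRingCat.{u}} {φ : ∀ i, A ⟶ B i} {a : ∀ i, Fin (n + 1) → B i}
  {ψ : ∀ i, B i →+* chartRing κ i} {l : ∀ i, Spec (B i) ⟶ Y} {D : Y.IdealSheafData}

/-- The exceptional divisor of a blow-up which is covered by conical charts is a projective
space. -/
theorem exists_projSpace_iso (hπ : IsBlowUp π I) [Mono q₀]
    (h : ∀ i, IsConicalBlowUpChart π q₀ χ s i (φ i) (a i) (ψ i) (l i))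
    (hcov : ∀ y, ∃ i, y ∈ Set.range (l i))
    (hD : ∀ i, onChart (l i) D = Ideal.span {(φ i).hom (s i)}) :
    ∃ Φ : projSpace κ n ≅ D.subscheme, ∀ i,
      projChart κ i ≫ Φ.hom ≫ D.subschemeι = Spec.map (CommRingCat.ofHom (ψ i)) ≫ l i := by
  have hl := fun i ↦ (h i).isOpenImmersion
  obtain ⟨k, hkopen, hk, hk'⟩ : ∃ k : ∀ i, Spec (.of (chartRing κ i)) ⟶ D.subscheme,
      (∀ i, IsOpenImmersion (k i)) ∧
      (∀ i, k i ≫ D.subschemeι = Spec.map (CommRingCat.ofHom (ψ i)) ≫ l i) ∧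
      ∀ i y, D.subschemeι y ∈ Set.range (l i) → y ∈ Set.range (k i) := by
    let E (i) : (B i ⧸ onChart (l i) D) ≃+* chartRing κ i :=
      (Ideal.quotEquivOfEq ((hD i).trans (h i).ker_eq.symm)).trans
        (RingHom.quotientKerEquivOfSurjective (h i).surjective)
    have hE (i) : IsIso (Spec.map (CommRingCat.ofHom
        (E i : (B i ⧸ onChart (l i) D) →+* chartRing κ i))) :=
      have : IsIso (CommRingCat.ofHom (E i : (B i ⧸ onChart (l i) D) →+* chartRing κ i)) :=
        (E i).toCommRingCatIso.isIso_hom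
      inferInstance
    refine ⟨fun i ↦ Spec.map (CommRingCat.ofHom
        (E i : (B i ⧸ onChart (l i) D) →+* chartRing κ i)) ≫ chartι (l i) D,
      fun i ↦ inferInstance, fun i ↦ ?_, fun i y hy ↦ ?_⟩
    · rw [Category.assoc, chartι_subschemeι, ← Spec.map_comp_assoc]
      rfl
    · obtain ⟨x, rfl⟩ := exists_chartι_eq (l i) D y hy
      obtain ⟨w, rfl⟩ := (Spec.map (CommRingCat.ofHom
        (E i : (B i ⧸ onChart (l i) D) →+* chartRing κ i))).surjective x
      exact ⟨w, Scheme.Hom.comp_apply ..⟩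
  -- Compatibility on overlaps comes from `T_m / T_i = (T_m / T_j) * (T_j / T_i)`, the relation
  -- required to compare two charts of the blow-up.
  obtain ⟨Φ, hΦ⟩ := exists_glueMorphisms (projChart κ) exists_mem_range_projChart k fun i j ↦ by
    have H := isPullback_projChart (R := κ) i j
    rw [← cancel_epi H.isoPullback.hom, H.isoPullback_hom_fst_assoc, H.isoPullback_hom_snd_assoc,
      ← cancel_mono D.subschemeι, Category.assoc, Category.assoc, hk, hk, ← Spec.map_comp_assoc,
      ← Spec.map_comp_assoc]
    refine SpecMap_comp_eq_of_eq_mul hπ (h i).isAffineBlowUp (h j).isAffineBlowUp (h i).comm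
      (h j).comm ?_ fun m ↦ ?_
    · refine CommRingCat.hom_ext ?_
      change (overlapLeft κ i j).comp ((ψ i).comp (φ i).hom) =
        (overlapRight κ i j).comp ((ψ j).comp (φ j).hom)
      rw [(h i).comp_eq, (h j).comp_eq, ← RingHom.comp_assoc, ← RingHom.comp_assoc,
        overlapLeft_chartC]
    · change overlapLeft κ i j (ψ i (a i m)) =
        overlapRight κ i j (ψ j (a j m)) * overlapLeft κ i j (ψ i (a i j))
      rw [(h i).map_coord, (h j).map_coord, (h i).map_coord, overlapLeft_chartCoord]
  have hΦι (i) : projChart κ i ≫ Φ ≫ D.subschemeι = Spec.map (CommRingCat.ofHom (ψ i)) ≫ l i := by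
    rw [← Category.assoc, hΦ, hk]
  -- If points of charts `i` and `j` have the same image, then `a j`, hence `T_j / T_i`, does not
  -- vanish at the first. Both points then lie in chart `j`, where `k j` is injective.
  have hinj : Function.Injective Φ := by
    intro x x' hxx'
    obtain ⟨i, w, rfl⟩ := exists_mem_range_projChart x
    obtain ⟨j, z, rfl⟩ := exists_mem_range_projChart x'
    have h1 : l i (Spec.map (CommRingCat.ofHom (ψ i)) w) =
        l j (Spec.map (CommRingCat.ofHom (ψ j)) z) := by
      rw [← Scheme.Hom.comp_apply, ← Scheme.Hom.comp_apply, ← hΦι, ← hΦι]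
      simp only [Scheme.Hom.comp_apply, hxx']
    have h2 := notMem_of_apply_eq (h i).isAffineBlowUp (h j).isAffineBlowUp (h i).comm (h j).comm h1
    obtain ⟨w', hw'⟩ := projChart_apply_mem_range (R := κ) (i := i) (j := j) w fun h3 ↦ h2 (by
      rw [← (h i).map_coord] at h3
      exact h3)
    rw [← hw'] at hxx' ⊢
    rw [← Scheme.Hom.comp_apply, ← Scheme.Hom.comp_apply, hΦ] at hxx'
    rw [(k j).isOpenEmbedding.injective hxx']
  have hsurj : Function.Surjective Φ := fun y ↦ by
    obtain ⟨i, hi⟩ := hcov (D.subschemeι y)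
    obtain ⟨w, rfl⟩ := hk' i y hi
    refine ⟨projChart κ i w, ?_⟩
    rw [← Scheme.Hom.comp_apply, hΦ]
  have := isOpenImmersion_of_injective (projChart κ) exists_mem_range_projChart (f := Φ)
    (fun i ↦ by rw [hΦ]; infer_instance) hinj
  have : IsIso Φ := (isIso_iff_isOpenImmersion_and_surjective Φ).mpr ⟨inferInstance, ⟨hsurj⟩⟩
  exact ⟨asIso Φ, hΦι⟩

end ExceptionalDivisorIso


/-! ### Homogeneous coordinates on the exceptional divisor -/

section Coordinates

variable {X Y : Scheme.{u}} {κ : Type u} [CommRing κ] {n : ℕ}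

lemma appLE_opensRange_comp_ΓSpecIso_hom {B C : CommRingCat.{u}} (l : Spec B ⟶ Y)
    [IsOpenImmersion l] (ψ : B ⟶ C) (h : ⊤ ≤ (Spec.map ψ ≫ l) ⁻¹ᵁ l.opensRange) :
    (Spec.map ψ ≫ l).appLE l.opensRange ⊤ h ≫ (Scheme.ΓSpecIso C).hom = (chartIso l).hom ≫ ψ := by
  apply Spec.map_injective
  rw [← cancel_mono (isAffineOpen_opensRange l).fromSpec, SpecMap_appLE_ΓSpecIso_fromSpec,
    Spec.map_comp, Category.assoc, SpecMap_chartIso_fromSpec]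

lemma appLE_opensRange_comp_chartIso_hom {W : X.Opens} (hW : IsAffineOpen W) (g : Y ⟶ X)
    {B : CommRingCat.{u}} {φ : Γ(X, W) ⟶ B} {l : Spec B ⟶ Y} [IsOpenImmersion l]
    (hl : l ≫ g = Spec.map φ ≫ hW.fromSpec) (hV : l.opensRange ≤ g ⁻¹ᵁ W) :
    g.appLE W l.opensRange hV ≫ (chartIso l).hom = φ := by
  apply Spec.map_injective
  rw [← cancel_mono hW.fromSpec, Spec.map_comp, Category.assoc,
    IsAffineOpen.SpecMap_appLE_fromSpec g hW (isAffineOpen_opensRange l),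
    ← Category.assoc, SpecMap_chartIso_fromSpec, hl]

lemma appLE_injective_of_opensRange_eq {B : CommRingCat.{u}} (l : Spec B ⟶ Y) [IsOpenImmersion l]
    {V : Y.Opens} (hV : l.opensRange = V) (h : ⊤ ≤ l ⁻¹ᵁ V) :
    Function.Injective (l.appLE V ⊤ h).hom := by
  subst hV
  have h1 : l.appLE l.opensRange ⊤ h ≫ (Scheme.ΓSpecIso B).hom = (chartIso l).hom := rfl
  have h2 : Function.Injective ((Scheme.ΓSpecIso B).hom.hom ∘ (l.appLE l.opensRange ⊤ h).hom) := by
    have : ⇑(chartIso l).hom.hom = (Scheme.ΓSpecIso B).hom.hom ∘ (l.appLE l.opensRange ⊤ h).hom := by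
      rw [← h1]; rfl
    rw [← this]
    exact (ConcreteCategory.bijective_of_isIso (chartIso l).hom).1
  exact h2.of_comp

/-- The coordinates of projective space, as functions on a chart of the blow-up. -/
lemma exists_coordinates {W : X.Opens} (hW : IsAffineOpen W) (g : Y ⟶ X) {i : Fin (n + 1)}
    {s : Fin (n + 1) → Γ(X, W)} {B : CommRingCat.{u}} {φ : Γ(X, W) ⟶ B} {a : Fin (n + 1) → B}
    {ψ : B →+* chartRing κ i} {l : Spec B ⟶ Y} [IsOpenImmersion l]
    (hl : l ≫ g = Spec.map φ ≫ hW.fromSpec) (ha : ∀ j, φ.hom (s j) = a j * φ.hom (s i))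
    (hψ : ∀ j, ψ (a j) = chartCoord κ i j) {k : projSpace κ n ⟶ Y}
    (hk : projChart κ i ≫ k = Spec.map (CommRingCat.ofHom ψ) ≫ l) :
    ∃ (V : Y.Opens) (hV : V ≤ g ⁻¹ᵁ W) (hi : chart κ i ≤ k ⁻¹ᵁ V) (a' : Fin (n + 1) → Γ(Y, V)),
      ∀ j, (g.appLE W V hV).hom (s j) = a' j * (g.appLE W V hV).hom (s i) ∧
        (k.appLE V (chart κ i) hi).hom (a' j) = coordinate κ i j := by
  have hV : l.opensRange ≤ g ⁻¹ᵁ W := by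
    rintro _ ⟨x, rfl⟩
    have : g (l x) = hW.fromSpec (Spec.map φ x) := by
      rw [← Scheme.Hom.comp_apply, hl, Scheme.Hom.comp_apply]
    change g (l x) ∈ (W : Set X)
    rw [← hW.range_fromSpec, this]
    exact ⟨_, rfl⟩
  have hi : chart κ i ≤ k ⁻¹ᵁ l.opensRange := by
    rw [← opensRange_projChart]
    rintro _ ⟨x, rfl⟩
    refine ⟨Spec.map (CommRingCat.ofHom ψ) x, ?_⟩
    exact (Scheme.Hom.comp_apply ..).symm.trans
      ((congrArg (fun v : _ ⟶ Y ↦ v x) hk.symm).trans (Scheme.Hom.comp_apply ..))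
  have hinv : ∀ b, (chartIso l).hom.hom ((chartIso l).inv.hom b) = b := fun b ↦
    congr($((chartIso l).inv_hom_id).hom b)
  refine ⟨l.opensRange, hV, hi, fun j ↦ (chartIso l).inv.hom (a j), fun j ↦ ⟨?_, ?_⟩⟩
  · have h1 : ∀ x, (chartIso l).hom.hom ((g.appLE W l.opensRange hV).hom x) = φ.hom x := fun x ↦
      congr($(appLE_opensRange_comp_chartIso_hom hW g hl hV).hom x)
    apply (ConcreteCategory.bijective_of_isIso (chartIso l).hom).1
    change (chartIso l).hom.hom _ = (chartIso l).hom.hom _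
    rw [map_mul, h1, h1, ha]
    congr 1
    exact (hinv _).symm
  · have ht : ⊤ ≤ projChart κ i ⁻¹ᵁ chart κ i := by
      rw [← opensRange_projChart]
      exact top_le_preimage_opensRange _
    apply appLE_injective_of_opensRange_eq (projChart κ i) (opensRange_projChart i) ht
    rw [awayToSection_appLE, ← hψ]
    have h1 := Scheme.Hom.appLE_comp_appLE (projChart κ i) k l.opensRange (chart κ i) ⊤ hi ht
    have h2 : ∀ (v : Spec (.of (chartRing κ i)) ⟶ Y) (hv : v = Spec.map (CommRingCat.ofHom ψ) ≫ l)
        (h : ⊤ ≤ v ⁻¹ᵁ l.opensRange), v.appLE l.opensRange ⊤ h ≫ (Scheme.ΓSpecIso _).hom =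
          (chartIso l).hom ≫ CommRingCat.ofHom ψ := by
      rintro _ rfl h
      exact appLE_opensRange_comp_ΓSpecIso_hom l _ h
    have h3 := h2 _ hk (ht.trans (Scheme.Hom.preimage_mono _ hi))
    rw [← h1, ← Iso.eq_comp_inv] at h3
    refine (congr($(h3).hom ((chartIso l).inv.hom (a j)))).trans ?_
    change (Scheme.ΓSpecIso (.of (chartRing κ i))).inv.hom (ψ ((chartIso l).hom.hom ((chartIso l).inv.hom (a j)))) = _
    rw [hinv]

end Coordinates

/-! ### The blow-up of a conical neighbourhood -/

section Description

open IsLocalRing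

variable {O : Type u} [CommRing O] [IsLocalRing O] {X : Scheme.{u}} {f : X ⟶ Spec (.of O)} {t : O}

/-- Conical charts can be computed in an open subscheme. -/
lemma IsConicalChart.of_comp {U : Scheme.{u}} {j : U ⟶ X} [IsOpenImmersion j] {p : U}
    {A : CommRingCat.{u}} {q₀ : Spec A ⟶ U} [IsOpenImmersion q₀] {φ₀ : O →+* A} {κ : Type u}
    [Field κ] {χ : A →+* κ} {n e : ℕ} {s : Fin (n + 1) → A} {G : MvPolynomial (Fin (n + 1)) A}
    (hc : IsConicalChart f t (j p) (q₀ ≫ j) φ₀ χ s e G) :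
    IsConicalChart (j ≫ f) t p q₀ φ₀ χ s e G where
  comp_eq := (Category.assoc ..).symm.trans hc.comp_eq
  isNoetherianRing := hc.isNoetherianRing
  finiteType := hc.finiteType
  isQuasiRegular := hc.isQuasiRegular
  ker_eq := by
    rw [← hc.ker_eq, onChart_reducedIdeal, onChart_reducedIdeal]
    refine congrArg PrimeSpectrum.vanishingIdeal (Set.ext fun x ↦ ?_)
    exact (j.isOpenEmbedding.injective.eq_iff (a := q₀ x) (b := p)).symm.trans
      (iff_of_eq (congrArg (· = j p) (Scheme.Hom.comp_apply q₀ j x).symm))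
  isHomogeneous := hc.isHomogeneous
  eval_eq := hc.eval_eq
  map_ne_zero := hc.map_ne_zero
  smooth_away := hc.smooth_away
  isSeparable := hc.isSeparable

/-- The blow-up of a conical chart. -/
theorem IsConicalChart.blowUp (ht : maximalIdeal O = Ideal.span {t}) {p : X}
    {A : CommRingCat.{u}} {q₀ : Spec A ⟶ X} [IsOpenImmersion q₀] {φ₀ : O →+* A} {κ : Type u}
    [Field κ] {χ : A →+* κ} {n e : ℕ} {s : Fin (n + 1) → A} {G : MvPolynomial (Fin (n + 1)) A}
    (hc : IsConicalChart f t p q₀ φ₀ χ s e G) (hsurj : Function.Surjective q₀)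
    (hcl : IsClosed {p})
    (hsm : ∀ i, ((Ideal.Quotient.mk (Ideal.span {MvPolynomial.eval₂ (chartC κ i)
      (chartCoord κ i) (MvPolynomial.map χ G)})).comp (chartC κ i)).Smooth)
    {Y : Scheme.{u}} {ρ : Y ⟶ X} (hρ : IsBlowUp ρ (reducedIdeal {p}))
    {D₁ D₂ : Y.IdealSheafData} (hD₁ : exceptionalDivisor ρ p = D₁)
    (hD₂ : strictTransform ρ (Set.range (specialFibreι f)) {p} = D₂) :
    specialFibreIdeal (ρ ≫ f) = D₁ ^ e * D₂ ∧
    AlgebraicGeometry.IsReduced D₁.subscheme ∧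
    IsSmoothOverResidue (D₁.subschemeι ≫ ρ ≫ f) ∧
    IsSmoothOverResidue (D₂.subschemeι ≫ ρ ≫ f) ∧
    MeetTransversely (ρ ≫ f) D₁ D₂ ∧
    ∃ Φ : projSpace κ n ≅ D₁.subscheme,
      Φ.hom ≫ D₁.subschemeι ≫ ρ = projSpaceToSpec κ n ≫ Spec.map (CommRingCat.ofHom χ) ≫ q₀ ∧
      (∀ i, ∃ (B : CommRingCat.{u}) (φ : A ⟶ B) (a : Fin (n + 1) → B) (ψ : B →+* chartRing κ i)
        (l : Spec B ⟶ Y), IsConicalBlowUpChart ρ q₀ χ s i φ a ψ l ∧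
        projChart κ i ≫ Φ.hom ≫ D₁.subschemeι = Spec.map (CommRingCat.ofHom ψ) ≫ l) ∧
      D₂.comap (Φ.hom ≫ D₁.subschemeι) =
        projHypersurface (MvPolynomial.map χ G) e (hc.isHomogeneous.map χ) := by
  subst hD₁ hD₂
  obtain ⟨B, φ, a, ψ, l, hl, hcov⟩ := hc.exists_charts hρ rfl
  have hcov : ∀ y, ∃ i, y ∈ Set.range (l i) := fun y ↦ hcov y (hsurj _)
  have hopen := fun i ↦ (hl i).isOpenImmersion
  have hE := fun i ↦ (hl i).onChart_exceptionalDivisor hc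
  have hS := fun i ↦ (hl i).onChart_strictTransform hc ht hcl rfl
  -- Since `q₀` is surjective, every point lies on the conical chart and no separate analysis away
  -- from `p` is needed.
  have H : ∀ x, IsSmoothlyConicalAt f t {p} x ∨ x ∉ ({p} : Set X) ∧ x ∉ singularSet f := fun x ↦
    .inl ⟨p, _, q₀, _, κ, inferInstance, χ, n, e, s, G, inferInstance, hsurj x, rfl, hc, hsm⟩
  obtain ⟨Φ, hΦ⟩ := exists_projSpace_iso hρ hl hcov hE
  refine ⟨?_, ?_, ?_, isSmoothOverResidue_strictTransform ht hρ hcl H,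
    meetTransversely_exceptionalDivisor_strictTransform ht hρ hcl H rfl, Φ, ?_,
    fun i ↦ ⟨_, _, _, _, _, hl i, hΦ i⟩, ?_⟩
  -- On each chart the divisor identity reads `τ = s_i ^ e * G(a)`.
  · refine ext_of_onChart l hcov fun i ↦ ?_
    rw [onChart_mul, onChart_pow, hE, hS, onChart_specialFibreIdeal ht ((hl i).comp_eq_SpecMap hc),
      Ideal.span_singleton_pow, Ideal.span_singleton_mul_span_singleton,
      ← (hl i).map_eq_pow_mul hc]
    rfl
  · refine isReduced_subscheme l hcov _ fun i ↦ ?_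
    have := (isStandardChart_chartRing (R := κ) i).isDomain
    let E := (Ideal.quotEquivOfEq ((hE i).trans (hl i).ker_eq.symm)).trans
      (RingHom.quotientKerEquivOfSurjective (hl i).surjective)
    exact isReduced_of_injective E E.injective
  · refine isSmoothOverResidue_of_forall_exists_chart fun y ↦ ?_
    obtain ⟨i, hi⟩ := hcov y
    refine ⟨B i, l i, _, hopen i, hi, (hl i).comp_eq_SpecMap hc, ?_⟩
    rw [hE]
    exact (hl i).isResidueSmooth_exceptionalDivisor hc
  · refine hom_ext_of_openImmersions (projChart κ) exists_mem_range_projChart fun i ↦ ?_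
    have h1 := reassoc_of% (hΦ i)
    rw [h1, (hl i).comm, ← Category.assoc (projChart κ i), projChart_projSpaceToSpec,
      ← Spec.map_comp_assoc, ← Spec.map_comp_assoc]
    congr 2
    exact CommRingCat.hom_ext (hl i).comp_eq
  -- The image of the local equation `G(a)` in the coordinate ring of the standard chart is the
  -- dehomogenised leading form.
  · refine ext_of_onChart (projChart κ) exists_mem_range_projChart fun i ↦ ?_
    rw [onChart_comap, hΦ, onChart_SpecMap_comp, hS, Ideal.map_span, Set.image_singleton,
      onChart_projHypersurface, ← eval₂_chartCoord, ← (hl i).map_strictTransform]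
    rfl

/-- The blow-up of an affine conical neighbourhood of `p`. -/
theorem blowUpDescription_of_isConicalChart (ht : maximalIdeal O = Ideal.span {t}) {p : X}
    {W : X.Opens} (hW : IsAffineOpen W) (hp : p ∈ W) {n e : ℕ} {s : Fin (n + 1) → Γ(X, W)}
    {G : MvPolynomial (Fin (n + 1)) Γ(X, W)} (hcl : IsClosed {p})
    (hc : IsConicalChart f t p hW.fromSpec (sectionsHom f W) (X.evaluation W p hp).hom s e G)
    {F : MvPolynomial (Fin (n + 1)) (X.residueField p)}
    (hGF : MvPolynomial.map (X.evaluation W p hp).hom G = F) (hF : F.IsHomogeneous e)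
    (hsm : Smooth ((projHypersurface F e hF).subschemeι ≫ projSpaceToSpec (X.residueField p) n))
    {Y : Scheme.{u}} {ρ : Y ⟶ W} (hρ : IsBlowUp ρ (reducedIdeal {(⟨p, hp⟩ : W)})) :
    BlowUpDescription f hp s e F hF ρ (exceptionalDivisor ρ ⟨p, hp⟩)
      (strictTransform ρ (Set.range (specialFibreι (W.ι ≫ f))) {(⟨p, hp⟩ : W)}) := by
  subst hGF
  have hcl' : IsClosed {(⟨p, hp⟩ : W)} := by
    have := hcl.preimage (continuous_subtype_val (p := (· ∈ W)))
    convert this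
    ext x
    exact Subtype.ext_iff
  have hq₀ : hW.isoSpec.inv ≫ W.ι = hW.fromSpec := rfl
  have hc' := IsConicalChart.of_comp (j := W.ι) (p := ⟨p, hp⟩) (q₀ := hW.isoSpec.inv) hc
  have hsurj : Function.Surjective hW.isoSpec.inv := hW.isoSpec.inv.surjective
  obtain ⟨h1, h2, h3, h4, h5, Φ, h6, h7, h8⟩ := hc'.blowUp ht hsurj hcl'
    ((smooth_projHypersurface_iff _ e hF).mp hsm) hρ rfl rfl
  refine ⟨h1, h2, h3, h4, h5, Φ, ?_, fun i ↦ ?_, h8⟩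
  · have h9 := congrArg (· ≫ W.ι) h6
    simp only [Category.assoc] at h9
    exact h9.trans (congrArg (_ ≫ ·) (SpecMap_evaluation_fromSpec hW hp))
  · obtain ⟨B, φ, a, ψ, l, hl, hΦ⟩ := h7 i
    have := hl.isOpenImmersion
    exact exists_coordinates hW (ρ ≫ W.ι) (by rw [reassoc_of% hl.comm, hq₀])
      hl.isAffineBlowUp.map_eq hl.map_coord hΦ

end Description

end SingleBlowUp

theorem mainTheorem12
    {k₀ O : Type u} [Field k₀] [CommRing O] [IsDomain O] [IsDiscreteValuationRing O]
    [Algebra k₀ O] [Algebra.EssFiniteType k₀ O] [Algebra.FormallySmooth k₀ O]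
    [Module.Finite k₀ (IsLocalRing.ResidueField O)]
    [Algebra.IsSeparable k₀ (IsLocalRing.ResidueField O)]
    (t : O) (ht : Irreducible t)
    {X : Scheme.{u}} (f : X ⟶ Spec (.of O)) [Flat f]
    (hqp : SingleBlowUp.IsQuasiProjective f)
    (hsm : SingleBlowUp.IsEssSmooth (f ≫ Spec.map (CommRingCat.ofHom (algebraMap k₀ O))))
    (hgen : Smooth (pullback.snd f (SingleBlowUp.genericPt O)))
    (hsep : ∀ y : SingleBlowUp.specialFibre f, IsClosed {y} →
      SingleBlowUp.IsSingularPoint f y → SingleBlowUp.HasSeparableResidueField f y) :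
    (SingleBlowUp.ResolvedBySingleBlowUp f ↔
      _root_.IsDiscrete (SingleBlowUp.singularSet f) ∧
      ∀ p ∈ SingleBlowUp.singularSet f, SingleBlowUp.HasSmoothLeadingForm f t p) ∧
    (SingleBlowUp.ResolvedBySingleBlowUp f → ∀ p ∈ SingleBlowUp.singularSet f,
      ∀ (n e : ℕ) (s : Fin (n + 1) → X.presheaf.stalk p)
        (F : MvPolynomial (Fin (n + 1)) (X.residueField p))
        (hF : SingleBlowUp.IsLeadingForm (SingleBlowUp.pullbackGerm f t p) s e F),
      ∃ (U : X.Opens) (hp : p ∈ U) (s' : Fin (n + 1) → Γ(X, U)),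
        (∀ j, (X.presheaf.germ U p hp).hom (s' j) = s j) ∧
        (∃ (Y : Scheme.{u}) (ρ : Y ⟶ U),
          SingleBlowUp.IsBlowUp ρ (SingleBlowUp.reducedIdeal {(⟨p, hp⟩ : U)})) ∧
        ∀ (Y : Scheme.{u}) (ρ : Y ⟶ U),
          SingleBlowUp.IsBlowUp ρ (SingleBlowUp.reducedIdeal {(⟨p, hp⟩ : U)}) →
          SingleBlowUp.BlowUpDescription f hp s' e F hF.homogeneous ρ
            (SingleBlowUp.exceptionalDivisor ρ ⟨p, hp⟩)
            (SingleBlowUp.strictTransform ρ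
              (Set.range (SingleBlowUp.specialFibreι (U.ι ≫ f))) {(⟨p, hp⟩ : U)})) := by
  have ht' := ht.maximalIdeal_eq
  have ht0 : t ∈ nonZeroDivisors O := mem_nonZeroDivisors_of_ne_zero ht.ne_zero
  have := hqp.locallyOfFiniteType
  refine ⟨SingleBlowUp.resolvedBySingleBlowUp_iff ht' hsm hsep ht0, fun h p hp n e s F hF ↦ ?_⟩
  obtain ⟨W, hW, hpW, s', G, hs', -, hGF, hc⟩ :=
    SingleBlowUp.exists_isConicalChart ht' hsm h.isolated hsep hp hF
  -- The neighbourhood is the affine open set of the conical chart. The description uses only the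
  -- universal property of the blow-up, so it holds for every model of it.
  exact ⟨W, hpW, s', hs', SingleBlowUp.exists_isBlowUp _, fun Y ρ hρ ↦
    SingleBlowUp.blowUpDescription_of_isConicalChart ht' hW hpW
      (SingleBlowUp.isClosed_singleton_of_mem_singularSet h.isolated hp) hc hGF hF.homogeneous
      (h.smooth_leadingForm ht' hsm hsep hp hF) hρ⟩
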